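/- Conventions. For a field $g:\mathbb R^3\to\mathbb C^3$ the Fourier transform $\hat g$ is normalised by $g(x)=\int_{\mathbb R^3}e^{ik\cdot x}\hat g(k)\,dk$, $\hat g\in L^1$, and $\|\hat g\|_{\mu,\beta}=\sup_{k\in\mathbb R^3}(1+|k|)^\mu e^{\beta|k|}|\hat g(k)|$. Let $P_kw=w-k\,(k\cdot w)/|k|^2$, let $\mathcal P$ be the Hodge projection (the Fourier multiplier with symbol $P_k$), and let $\hat *$ denote convolution in $k$. Theorem. Let $\beta>0$, $\mu>3$, and let $v_0,f:\mathbb R^3\to\mathbb C^3$ (in particular, real fields) be divergence free with $\|\hat v_0\|_{\mu+2,\beta}<\infty$ and $\|\hat f\|_{\mu,\beta}<\infty$. Then there is $\alpha>0$ such that the Navier–Stokes problem $$v_t-\Delta v=-\mathcal P[v\cdot\nabla v]+f(x),\qquad \nabla\cdot v=0,\qquad v(x,0)=v_0(x),\qquad x\in\mathbb R^3,$$ has a classical solution $v(x,t)$ for complex $t$ with $\mathrm{Re}\,\frac1t>\alpha$ and with $\|\hat v(\cdot,t)\|_{\mu,\beta}$ bounded uniformly in $t$; every classical solution on a real interval $0<t<T$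 with $\|\hat v(\cdot,t)\|_{\mu,\beta}$ bounded uniformly in $t$ coincides with it for $0<t<\min(T,\alpha^{-1})$. This solution is Borel summable in $1/t$: there is a function $U(x,p)$ such that $$v(x,t)=v_0(x)+\int_0^\infty U(x,p)\,e^{-p/t}\,dp\qquad\Big(x\in\mathbb R^3,\ \mathrm{Re}\,\tfrac1t>\alpha\Big),$$ and such that for every $\beta'\in(0,\beta)$ there are $\delta>0$ and $C$ for which $U$ is analytic in $(x,p)\in\mathbb C^3\times\mathbb C$ for $|\mathrm{Im}\,x|<\beta'$, $\mathrm{dist}(p,[0,\infty))<\delta$, and satisfies $|U(x,p)|\le Ce^{\alpha|p|}$ there. (In particular $U$ is analytic in $x$ for $|\mathrm{Im}\,x|<\beta$, and analytic in $p$ in a neighbourhood of $\mathbb R^+\cup\{0\}$.) Consequently there are functions $v_m(x)$, $m\ge1$, with $v(x,t)\sim v_0(x)+\sum_{m\ge1}t^mv_m(x)$ as $t\to0$; that is, for each $N\ge 0$, $v(x,t)-v_0(x)-\sum_{m=1}^Nt^mv_m(x)=O(|t|^{N+1})$, uniformly in $x\in\mathbb R^3$ and in $t$ with $\mathrm{Re}\,\frac1t>\alpha$.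 Moreover $$|v_m(x)|\le m!\,A_0B_0^m\qquad(m\ge1,\ x\in\mathbb R^3)$$ for all constants $A_0,B_0>0$ satisfying the following three conditions, and such constants exist. With $\hat v_1=-|k|^2\hat v_0-ik_jP_k[\hat v_{0,j}\hat *\hat v_0]+\hat f$ (summed over $j$), $n_0=\|\hat v_0\|_{\mu,\beta}$, $n_1=\|\hat v_1\|_{\mu,\beta}$ and $C_0=\frac{32\pi2^\mu}{(\mu-1)(\mu-2)(\mu-3)}$, the conditions are $$A_0B_0\ge\frac{18}{\beta^2}n_1(1+\beta C_0n_0),$$ $$A_0B_0^2\ge\frac{3A_0B_0}{\beta^2}+A_0B_0n_0\frac{2^\mu36\pi}{\beta^2}+\frac{C_0}{\beta}n_1^2,$$ $$\frac{6}{\beta^2}B_0+2^\mu\frac{18\pi}{\beta^3}B_0n_0+\frac{2^\mu18\pi}{\beta^3}n_1+\frac{9A_02^\mu}{\beta^3}\le B_0^2 .$$ -/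

import Mathlib

open MeasureTheory Filter Topology
open scoped ENNReal

noncomputable section

namespace NSBorel

/-- Physical space (and wave-number space) `ℝ³` with the Euclidean norm. -/
abbrev R3 : Type := EuclideanSpace ℝ (Fin 3)

/-- `ℂ³` with the Hermitian norm: values of velocity fields, and complexified positions. -/
abbrev C3 : Type := EuclideanSpace ℂ (Fin 3)

/-- The inclusion `ℝ³ ⊆ ℂ³`. -/
def toC3 (x : R3) : C3 := WithLp.toLp 2 fun j => ((x j : ℝ) : ℂ)

/-- The imaginary part `Im x ∈ ℝ³` of `x ∈ ℂ³`. -/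
def imC3 (x : C3) : R3 := WithLp.toLp 2 fun j => (x j).im

/-- `vhat` is the Fourier transform of `v`, normalised so that
`v(x) = ∫ e^{i k·x} vhat(k) dk` (products go to convolutions without a constant). -/
def IsFourierPair (v vhat : R3 → C3) : Prop :=
  Integrable vhat ∧
    ∀ x, v x = ∫ k, Complex.exp (Complex.I * ((inner ℝ k x : ℝ) : ℂ)) • vhat k

/-- The weighted norm `sup_k (1+|k|)^μ e^{β|k|} |g(k)|`, with values in `[0,∞]`. -/
def wnorm (μ β : ℝ) (g : R3 → C3) : ℝ≥0∞ :=
  ⨆ k, ENNReal.ofReal ((1 + ‖k‖) ^ μ * Real.exp (β * ‖k‖) * ‖g k‖)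

/-- The symbol `P_k w = w - k (k·w)/|k|²` of the Hodge projection. -/
def hodgeSymbol (k : R3) (w : C3) : C3 :=
  w - ((∑ j, (k j : ℂ) * w j) / ((‖k‖ ^ 2 : ℝ) : ℂ)) • toC3 k

/-- `h` is the Hodge projection of the field `g` onto divergence free fields: the Fourier
transform of `h` is `P_k` applied to that of `g`. -/
def IsHodgeProjection (g h : R3 → C3) : Prop :=
  ∃ ghat : R3 → C3, IsFourierPair g ghat ∧
    IsFourierPair h (fun k => hodgeSymbol k (ghat k))

/-- The partial derivative `∂_j v`. -/
def pderiv (j : Fin 3) (v : R3 → C3) (x : R3) : C3 :=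
  fderiv ℝ v x (EuclideanSpace.single j 1)

/-- `∇ · v = 0` everywhere. -/
def IsDivFree (v : R3 → C3) : Prop := ∀ x, ∑ j, pderiv j v x j = 0

/-- The convective term `(v · ∇) v`. -/
def convect (v : R3 → C3) (x : R3) : C3 := ∑ j, v x j • pderiv j v x

/-- `v` is a (classical) solution, on the set `D` of real or complex times, of
`v_t - Δ v = - P[v·∇v] + f`, `∇·v = 0`, `v(·,0) = v₀`, whose Fourier transform is bounded in
the norm `‖·‖_{μ,β}` uniformly for `t ∈ D`. -/
structure IsNSSolution (μ β : ℝ) (v₀ f : R3 → C3) (D : Set ℂ) (v : ℂ → R3 → C3) : Prop where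
  bounded : ∃ M : ℝ≥0∞, M < ⊤ ∧
    ∀ t ∈ D, ∃ vhat : R3 → C3, IsFourierPair (v t) vhat ∧ wnorm μ β vhat ≤ M
  contDiff : ∀ t ∈ D, ContDiff ℝ 2 (v t)
  divFree : ∀ t ∈ D, IsDivFree (v t)
  equation : ∀ t ∈ D, ∃ N : R3 → C3, IsHodgeProjection (convect (v t)) N ∧
    ∀ x, HasDerivWithinAt (fun s => v s x) (Laplacian.laplacian (v t) x - N x + f x) D t
  initial : ∀ x, Tendsto (fun t => v t x) (𝓝[D] 0) (𝓝 (v₀ x))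

/-- The Fourier convolution `u_j * w` of the `j`-th component of `u` with `w`. -/
def fconv (j : Fin 3) (u w : R3 → C3) (k : R3) : C3 := ∫ k', u k' j • w (k - k')

/-- `v̂₁ = -|k|² v̂₀ - i k_j P_k[v̂_{0,j} * v̂₀] + f̂`. -/
def v1hat (v0hat fhat : R3 → C3) (k : R3) : C3 :=
  -((‖k‖ ^ 2 : ℝ) : ℂ) • v0hat k
    - ∑ j, (Complex.I * (k j : ℂ)) • hodgeSymbol k (fconv j v0hat v0hat k)
    + fhat k

/-- `C₀(μ) = 32 π 2^μ / ((μ-1)(μ-2)(μ-3))`. -/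
def C0 (μ : ℝ) : ℝ := 32 * Real.pi * 2 ^ μ / ((μ - 1) * (μ - 2) * (μ - 3))

/-- The explicit conditions on the Gevrey constants `A₀, B₀ > 0`, in terms of
`n₀ = ‖v̂₀‖_{μ,β}` and `n₁ = ‖v̂₁‖_{μ,β}`. -/
structure GevreyConstants (μ β n₀ n₁ A₀ B₀ : ℝ) : Prop where
  A_pos : 0 < A₀
  B_pos : 0 < B₀
  first : 18 / β ^ 2 * n₁ * (1 + β * C0 μ * n₀) ≤ A₀ * B₀
  second : 3 * A₀ * B₀ / β ^ 2 + A₀ * B₀ * n₀ * (2 ^ μ * 36 * Real.pi / β ^ 2)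
    + C0 μ / β * n₁ ^ 2 ≤ A₀ * B₀ ^ 2
  third : 6 / β ^ 2 * B₀ + 2 ^ μ * (18 * Real.pi / β ^ 3) * B₀ * n₀
    + 2 ^ μ * 18 * Real.pi / β ^ 3 * n₁ + 9 * A₀ * 2 ^ μ / β ^ 3 ≤ B₀ ^ 2

/-- The complex times `t` with `Re (1/t) > α` (for `α > 0` this excludes `t = 0`). -/
def timeDomain (α : ℝ) : Set ℂ := {t | α < (1 / t).re}

/-- The `δ`-neighbourhood of the half line `[0,∞)` in the complex plane. -/
def halfLineNhd (δ : ℝ) : Set ℂ := Metric.thickening δ (Complex.ofReal '' Set.Ici (0 : ℝ))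

end NSBorel

end

open MeasureTheory Filter Topology
open scoped ENNReal

noncomputable section

/-! The equation is solved on the Fourier side, where for each wave number k it reads V' = -|k|²V +
f̂ - B(V,V) with B(g,h) = i k_j P_k[g_j * h]. For μ > 3 the weight (1+|k|)^{-μ} e^{-β|k|} is
reproduced by convolution up to a constant, so B costs a single factor |k| (`norm_bil_le`).

Existence. The set Re(1/t) > α is the disc α|t|² < Re t, tangent to the imaginary axis at 0 and
star-shaped about 0, so the Duhamel integral can be taken along rays. There the heat factor gives
|k| |t| ∫₀¹ e^{-|k|² Re t (1-θ)} dθ ≤ |t| / √(Re t) ≤ 1/√α, which pays for the factor |k|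
(`norm_duhamel_le`). Hence the Picard map is a contraction for large α, and its fixed point is
holomorphic in t.

Gevrey bounds. The coefficients of the formal solution ∑ t^m V_m lose a factor |k|² at each step.
The loss is measured by the scaled moments ∫ (σ|k|)^j / j! |V_m| dk. Regard them as power series
coefficients in j: multiplication by |k| becomes differentiation, and convolution becomes a product.
The moments of V_{N+1} are dominated by the coefficients of Q B^N N! (1-z)^{-(2N+2)}. This family
reproduces itself, because two derivatives raise the exponent by two and the resulting factor
(2N+2)(2N+3) is balanced by the division by N+2 and the growth of the factorial (`gevreyMaj_rec`).
The remainders V - ∑_{m<N} t^m V_m vanish at t = 0 and solve equations of the same shape, so one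
recursive majorant `maj` controls both coefficients and remainders (`enorm_flowRem_le_maj`). The
weight e^{β'|k|} is submultiplicative and can be carried through the same argument
(`exists_lintegral_maj_le`).

Borel summation. Let F be holomorphic on the disc with remainders bounded by r_N |t|^N. Its Borel
transform is an inverse Laplace integral over a circle Re(1/t) = c with c > α. Moving one Taylor
term at a time out of the remainder gives all its derivatives on the half line, with bounds of size
(r_{n+1} + r_{n+2}) e^{cq}. With Gevrey growth of r_N the Taylor series have a common radius δ and
fit together into a continuation off the half line. Fubini and Cauchy's formula show that the
Laplace transform returns F (`laplace_borelCoeff`). This is done for almost every k and then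
integrated against e^{i k·x} with complex x, where e^{β'|k|} absorbs the growth of the exponential
(`differentiableOn_borelU`).

Uniqueness. For a classical solution only the field, not its transform at a given k, is known to be
differentiable in t. The difference of two solutions is therefore tested with bumps shrinking to k₀.
The resulting linear differential inequality with rate |k₀|² contracts in a norm with a large weight
e^{λt} (`TwoFlows.contraction`). -/

namespace NSBorel

/-! ### The Hodge symbol -/

/-- The bilinear pairing `k · w` of a real wave number with a complex vector. -/
def kdot (k : R3) (w : C3) : ℂ := ∑ j, (k j : ℂ) * w j

lemma kdot_add (k : R3) (u w : C3) : kdot k (u + w) = kdot k u + kdot k w := by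
  simp [kdot, mul_add, Finset.sum_add_distrib]

lemma kdot_smul (k : R3) (c : ℂ) (w : C3) : kdot k (c • w) = c * kdot k w := by
  simp only [kdot, PiLp.smul_apply, smul_eq_mul, Finset.mul_sum]
  exact Finset.sum_congr rfl fun j _ => by ring

lemma kdot_toC3 (k : R3) : kdot k (toC3 k) = ((‖k‖ ^ 2 : ℝ) : ℂ) := by
  rw [EuclideanSpace.norm_sq_eq]
  simp [kdot, toC3, sq]

lemma hodgeSymbol_eq (k : R3) (w : C3) :
    hodgeSymbol k w = w - (kdot k w / ((‖k‖ ^ 2 : ℝ) : ℂ)) • toC3 k := rfl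

lemma hodgeSymbol_add (k : R3) (u w : C3) :
    hodgeSymbol k (u + w) = hodgeSymbol k u + hodgeSymbol k w := by
  simp only [hodgeSymbol_eq, kdot_add, add_div, add_smul]
  abel

lemma hodgeSymbol_smul (k : R3) (c : ℂ) (w : C3) :
    hodgeSymbol k (c • w) = c • hodgeSymbol k w := by
  simp only [hodgeSymbol_eq, kdot_smul, smul_sub, smul_smul, mul_div_assoc]

/-- The Hodge symbol at `k` as a linear map. -/
def hodgeLin (k : R3) : C3 →ₗ[ℂ] C3 where
  toFun := hodgeSymbol k
  map_add' := hodgeSymbol_add k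
  map_smul' := hodgeSymbol_smul k

@[simp] lemma hodgeLin_apply (k : R3) (w : C3) : hodgeLin k w = hodgeSymbol k w := rfl

lemma kdot_hodgeSymbol (k : R3) (w : C3) : kdot k (hodgeSymbol k w) = 0 := by
  by_cases hk : k = 0
  · simp [kdot, hk]
  · have h : ((‖k‖ ^ 2 : ℝ) : ℂ) ≠ 0 := by
      exact_mod_cast pow_ne_zero 2 (norm_ne_zero_iff.2 hk)
    rw [hodgeSymbol_eq, sub_eq_add_neg, ← neg_smul, kdot_add, kdot_smul, kdot_toC3]
    field_simp
    ring

lemma inner_toC3 (k : R3) (w : C3) : inner ℂ (toC3 k) w = kdot k w := by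
  simp only [kdot, toC3, PiLp.inner_apply, RCLike.inner_apply, Complex.conj_ofReal, mul_comm]

/-- For k ≠ 0 the symbol is the orthogonal projection onto the complement of k, so Pythagoras
applies. At k = 0 the division by zero makes it the identity, and the same computation holds. -/
lemma norm_hodgeSymbol_le (k : R3) (w : C3) : ‖hodgeSymbol k w‖ ≤ ‖w‖ := by
  have h0 : inner ℂ (hodgeSymbol k w) ((kdot k w / ((‖k‖ ^ 2 : ℝ) : ℂ)) • toC3 k) = 0 := by
    rw [inner_smul_right, ← inner_conj_symm, inner_toC3, kdot_hodgeSymbol]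
    simp
  have h1 := norm_add_sq_eq_norm_sq_add_norm_sq_of_inner_eq_zero _ _ h0
  have h2 : hodgeSymbol k w + (kdot k w / ((‖k‖ ^ 2 : ℝ) : ℂ)) • toC3 k = w := by
    rw [hodgeSymbol_eq]; abel
  rw [h2] at h1
  nlinarith [norm_nonneg (hodgeSymbol k w), norm_nonneg w,
    mul_self_nonneg ‖(kdot k w / ((‖k‖ ^ 2 : ℝ) : ℂ)) • toC3 k‖]

lemma sum_norm_mul_le (k : R3) (w : C3) : ∑ j, ‖k j‖ * ‖w j‖ ≤ ‖k‖ * ‖w‖ := by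
  have h := Finset.sum_mul_sq_le_sq_mul_sq Finset.univ (fun j => ‖k j‖) (fun j => ‖w j‖)
  rw [← EuclideanSpace.norm_sq_eq, ← EuclideanSpace.norm_sq_eq, ← mul_pow] at h
  exact abs_le_of_sq_le_sq' h (by positivity) |>.2

lemma norm_kdot_le (k : R3) (w : C3) : ‖kdot k w‖ ≤ ‖k‖ * ‖w‖ := by
  refine (norm_sum_le _ _).trans (le_trans (le_of_eq ?_) (sum_norm_mul_le k w))
  exact Finset.sum_congr rfl fun j _ => by rw [norm_mul, Complex.norm_real]

@[fun_prop]
lemma continuous_toC3 : Continuous toC3 := by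
  unfold toC3; fun_prop

@[fun_prop]
lemma measurable_toC3 : Measurable toC3 := continuous_toC3.measurable

lemma measurable_hodgeSymbol : Measurable fun z : R3 × C3 => hodgeSymbol z.1 z.2 := by
  unfold hodgeSymbol
  fun_prop

/-! ### Convolutions of nonnegative functions and the quadratic term -/

/-- Convolution of `[0,∞]`-valued functions on wave-number space. -/
def lconv (f g : R3 → ℝ≥0∞) (k : R3) : ℝ≥0∞ := ∫⁻ k', f k' * g (k - k')

lemma lconv_mono {f f' g g' : R3 → ℝ≥0∞} (hf : f ≤ f') (hg : g ≤ g') : lconv f g ≤ lconv f' g' :=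
  fun _ => lintegral_mono fun _ => mul_le_mul' (hf _) (hg _)

lemma measurable_lconv {f g : R3 → ℝ≥0∞} (hf : Measurable f) (hg : Measurable g) :
    Measurable (lconv f g) := by
  unfold lconv
  refine Measurable.lintegral_prod_right' (f := fun z : R3 × R3 => f z.2 * g (z.1 - z.2)) ?_
  fun_prop

/-- The Fourier side `i k_j P_k [g_j * h]` (summed over `j`) of the projected quadratic term. -/
def bil (g h : R3 → C3) (k : R3) : C3 :=
  ∑ j, (Complex.I * (k j : ℂ)) • hodgeSymbol k (fconv j g h k)

lemma bil_eq (g h : R3 → C3) (k : R3) :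
    bil g h k = hodgeSymbol k (∑ j, (Complex.I * (k j : ℂ)) • fconv j g h k) := by
  simp_rw [← hodgeLin_apply, map_sum, map_smul]
  rfl

lemma kdot_bil (g h : R3 → C3) (k : R3) : kdot k (bil g h k) = 0 := by
  rw [bil_eq, kdot_hodgeSymbol]

/-- Cauchy–Schwarz in the index j is applied under the convolution integral, so the factor |k|
appears with constant one. The explicit Gevrey conditions depend on this constant. -/
lemma enorm_bil_le (g h : R3 → C3) (hg : Measurable g) (hh : Measurable h) (k : R3) :
    ‖bil g h k‖ₑ ≤ ‖k‖ₑ * lconv (fun k => ‖g k‖ₑ) (fun k => ‖h k‖ₑ) k := by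
  have h1 : ∀ j, ‖(Complex.I * (k j : ℂ)) • hodgeSymbol k (fconv j g h k)‖ₑ
      ≤ ∫⁻ k', ‖k j‖ₑ * ‖g k' j‖ₑ * ‖h (k - k')‖ₑ := by
    intro j
    have h2 : ‖hodgeSymbol k (fconv j g h k)‖ₑ ≤ ‖fconv j g h k‖ₑ := by
      rw [← ofReal_norm, ← ofReal_norm]
      exact ENNReal.ofReal_le_ofReal (norm_hodgeSymbol_le _ _)
    calc ‖(Complex.I * (k j : ℂ)) • hodgeSymbol k (fconv j g h k)‖ₑ
        ≤ ‖k j‖ₑ * ‖fconv j g h k‖ₑ := by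
          rw [enorm_smul, enorm_mul]
          gcongr
          rw [← ofReal_norm, ← ofReal_norm, ← ofReal_norm]
          simp
      _ ≤ ‖k j‖ₑ * ∫⁻ k', ‖g k' j • h (k - k')‖ₑ := by
          gcongr; exact enorm_integral_le_lintegral_enorm _
      _ = _ := by
          rw [← lintegral_const_mul _ (by fun_prop)]
          simp only [enorm_smul, mul_assoc]
  calc ‖bil g h k‖ₑ ≤ ∑ j, ‖(Complex.I * (k j : ℂ)) • hodgeSymbol k (fconv j g h k)‖ₑ :=
        enorm_sum_le _ _
    _ ≤ ∑ j, ∫⁻ k', ‖k j‖ₑ * ‖g k' j‖ₑ * ‖h (k - k')‖ₑ := Finset.sum_le_sum fun j _ => h1 j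
    _ = ∫⁻ k', ∑ j, ‖k j‖ₑ * ‖g k' j‖ₑ * ‖h (k - k')‖ₑ := by
        rw [lintegral_finsetSum _ fun j _ => by fun_prop]
    _ ≤ ∫⁻ k', ‖k‖ₑ * (‖g k'‖ₑ * ‖h (k - k')‖ₑ) := by
        refine lintegral_mono fun k' => ?_
        rw [← Finset.sum_mul, ← mul_assoc]
        gcongr
        simp only [← ofReal_norm]
        simp_rw [← ENNReal.ofReal_mul (norm_nonneg _)]
        rw [← ENNReal.ofReal_sum_of_nonneg fun i _ => by positivity]
        exact ENNReal.ofReal_le_ofReal (sum_norm_mul_le _ _)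
    _ = _ := by rw [lintegral_const_mul _ (by fun_prop)]; rfl

/-- Measurable fields that are both integrable and bounded. -/
structure Tame (g : R3 → C3) : Prop where
  meas : StronglyMeasurable g
  int : Integrable g
  bdd : ∃ C, ∀ k, ‖g k‖ ≤ C

lemma Tame.add {g h : R3 → C3} (hg : Tame g) (hh : Tame h) : Tame (g + h) := by
  obtain ⟨C, hC⟩ := hg.bdd
  obtain ⟨C', hC'⟩ := hh.bdd
  exact ⟨hg.meas.add hh.meas, hg.int.add hh.int, C + C', fun k =>
    (norm_add_le _ _).trans (add_le_add (hC k) (hC' k))⟩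

lemma Tame.const_smul {g : R3 → C3} (hg : Tame g) (c : ℂ) : Tame (c • g) := by
  obtain ⟨C, hC⟩ := hg.bdd
  refine ⟨hg.meas.const_smul c, hg.int.smul c, ‖c‖ * C, fun k => ?_⟩
  rw [Pi.smul_apply, norm_smul]
  exact mul_le_mul_of_nonneg_left (hC k) (norm_nonneg c)

lemma Tame.sub {g h : R3 → C3} (hg : Tame g) (hh : Tame h) : Tame (g - h) := by
  have := hg.add (hh.const_smul (-1))
  rwa [neg_one_smul, ← sub_eq_add_neg] at this

lemma Tame.integrable_conv {g h : R3 → C3} (hg : Tame g) (hh : Tame h) (j : Fin 3) (k : R3) :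
    Integrable fun k' => g k' j • h (k - k') := by
  obtain ⟨C, hC⟩ := hg.bdd
  have h1 : Integrable fun k' => h (k - k') := hh.int.comp_sub_left k
  have hm : StronglyMeasurable fun k' => g k' j := by
    have := hg.meas.measurable
    exact (show Measurable fun k' => g k' j by fun_prop).stronglyMeasurable
  refine h1.bdd_smul C hm.aestronglyMeasurable ?_
  exact Eventually.of_forall fun k' => (PiLp.norm_apply_le (g k') j).trans (hC k')

lemma fconv_add_left {g g' h : R3 → C3} (hg : Tame g) (hg' : Tame g') (hh : Tame h) (j : Fin 3)
    (k : R3) : fconv j (g + g') h k = fconv j g h k + fconv j g' h k := by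
  unfold fconv
  rw [← integral_add (hg.integrable_conv hh j k) (hg'.integrable_conv hh j k)]
  exact integral_congr_ae (Eventually.of_forall fun k' => by simp [add_smul])

lemma fconv_add_right {g h h' : R3 → C3} (hg : Tame g) (hh : Tame h) (hh' : Tame h') (j : Fin 3)
    (k : R3) : fconv j g (h + h') k = fconv j g h k + fconv j g h' k := by
  unfold fconv
  rw [← integral_add (hg.integrable_conv hh j k) (hg.integrable_conv hh' j k)]
  exact integral_congr_ae (Eventually.of_forall fun k' => by simp [smul_add])

lemma fconv_smul_left (c : ℂ) (g h : R3 → C3) (j : Fin 3) (k : R3) :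
    fconv j (c • g) h k = c • fconv j g h k := by
  unfold fconv
  rw [← integral_smul]
  exact integral_congr_ae (Eventually.of_forall fun k' => by simp [mul_smul])

lemma fconv_smul_right (c : ℂ) (g h : R3 → C3) (j : Fin 3) (k : R3) :
    fconv j g (c • h) k = c • fconv j g h k := by
  unfold fconv
  rw [← integral_smul]
  exact integral_congr_ae (Eventually.of_forall fun k' => by simp [smul_comm c])

lemma bil_add_left {g g' h : R3 → C3} (hg : Tame g) (hg' : Tame g') (hh : Tame h) (k : R3) :
    bil (g + g') h k = bil g h k + bil g' h k := by
  simp only [bil, fconv_add_left hg hg' hh, hodgeSymbol_add, smul_add, Finset.sum_add_distrib]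

lemma bil_add_right {g h h' : R3 → C3} (hg : Tame g) (hh : Tame h) (hh' : Tame h') (k : R3) :
    bil g (h + h') k = bil g h k + bil g h' k := by
  simp only [bil, fconv_add_right hg hh hh', hodgeSymbol_add, smul_add, Finset.sum_add_distrib]

lemma bil_smul_left (c : ℂ) (g h : R3 → C3) (k : R3) : bil (c • g) h k = c • bil g h k := by
  simp only [bil, fconv_smul_left, hodgeSymbol_smul, Finset.smul_sum, smul_comm c]

lemma bil_smul_right (c : ℂ) (g h : R3 → C3) (k : R3) : bil g (c • h) k = c • bil g h k := by
  simp only [bil, fconv_smul_right, hodgeSymbol_smul, Finset.smul_sum, smul_comm c]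

lemma bil_sub_left {g g' h : R3 → C3} (hg : Tame g) (hg' : Tame g') (hh : Tame h) (k : R3) :
    bil (g - g') h k = bil g h k - bil g' h k := by
  have := bil_add_left (hg.sub hg') hg' hh k
  rw [sub_add_cancel] at this
  rw [this, add_sub_cancel_right]

lemma bil_sub_right {g h h' : R3 → C3} (hg : Tame g) (hh : Tame h) (hh' : Tame h') (k : R3) :
    bil g (h - h') k = bil g h k - bil g h' k := by
  have := bil_add_right hg (hh.sub hh') hh' k
  rw [sub_add_cancel] at this
  rw [this, add_sub_cancel_right]

/-- The Lipschitz form of the quadratic term, used for the contraction of the Picard map and for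
uniqueness. -/
lemma bil_self_sub {g h : R3 → C3} (hg : Tame g) (hh : Tame h) (k : R3) :
    bil g g k - bil h h k = bil (g - h) g k + bil h (g - h) k := by
  rw [bil_sub_left hg hh hg, bil_sub_right hh hg hh]
  abel

/-- Joint measurability in time and wave number is what keeps the Duhamel integral measurable in k.
-/
lemma stronglyMeasurable_bil_param {X : Type*} [MeasurableSpace X] {g h : X → R3 → C3}
    (hg : StronglyMeasurable (Function.uncurry g)) (hh : StronglyMeasurable (Function.uncurry h)) :
    StronglyMeasurable fun z : X × R3 => bil (g z.1) (h z.1) z.2 := by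
  have hc : ∀ j, StronglyMeasurable fun z : X × R3 => fconv j (g z.1) (h z.1) z.2 := by
    intro j
    unfold fconv
    refine StronglyMeasurable.integral_prod_right'
      (f := fun y : (X × R3) × R3 => g y.1.1 y.2 j • h y.1.1 (y.1.2 - y.2)) ?_
    have hg' := hg.measurable
    have hh' := hh.measurable
    have e1 : Measurable fun y : (X × R3) × R3 => g y.1.1 y.2 := by
      exact hg'.comp (f := fun y : (X × R3) × R3 => (y.1.1, y.2)) (by fun_prop)
    have e2 : Measurable fun y : (X × R3) × R3 => h y.1.1 (y.1.2 - y.2) := by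
      exact hh'.comp (f := fun y : (X × R3) × R3 => (y.1.1, y.1.2 - y.2)) (by fun_prop)
    have : Measurable fun y : (X × R3) × R3 => g y.1.1 y.2 j • h y.1.1 (y.1.2 - y.2) := by
      fun_prop
    exact this.stronglyMeasurable
  unfold bil
  refine Measurable.stronglyMeasurable ?_
  refine Finset.measurable_sum _ fun j _ => ?_
  have := (hc j).measurable
  have h3 : Measurable fun z : X × R3 => hodgeSymbol z.2 (fconv j (g z.1) (h z.1) z.2) :=
    measurable_hodgeSymbol.comp (measurable_snd.prodMk this)
  fun_prop

lemma stronglyMeasurable_bil {g h : R3 → C3} (hg : StronglyMeasurable g)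
    (hh : StronglyMeasurable h) : StronglyMeasurable (bil g h) := by
  have := stronglyMeasurable_bil_param (X := Unit) (g := fun _ => g) (h := fun _ => h)
    (hg.comp_measurable measurable_snd) (hh.comp_measurable measurable_snd)
  exact this.comp_measurable (g := fun k : R3 => ((), k)) (by fun_prop)

/-! ### Weights -/

/-- The weight `(1+|k|)^{-μ} e^{-b|k|}`. -/
def wt (μ b : ℝ) (k : R3) : ℝ := (1 + ‖k‖) ^ (-μ) * Real.exp (-(b * ‖k‖))

lemma wt_pos (μ b : ℝ) (k : R3) : 0 < wt μ b k := by
  unfold wt; positivity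

@[fun_prop]
lemma continuous_wt (μ b : ℝ) : Continuous (wt μ b) := by
  unfold wt
  refine Continuous.mul ?_ (by fun_prop)
  exact (continuous_const.add continuous_norm).rpow_const fun k => Or.inl (by
    have h : (0 : ℝ) < 1 + ‖k‖ := by positivity
    exact h.ne')

@[fun_prop]
lemma measurable_wt (μ b : ℝ) : Measurable (wt μ b) := (continuous_wt μ b).measurable

lemma wt_le_one {μ b : ℝ} (hμ : 0 ≤ μ) (hb : 0 ≤ b) (k : R3) : wt μ b k ≤ 1 := by
  unfold wt
  have h1 : (1 + ‖k‖) ^ (-μ) ≤ 1 :=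
    Real.rpow_le_one_of_one_le_of_nonpos (by linarith [norm_nonneg k]) (by linarith)
  have h2 : Real.exp (-(b * ‖k‖)) ≤ 1 := Real.exp_le_one_iff.2 (by
    have := mul_nonneg hb (norm_nonneg k); linarith)
  exact mul_le_one₀ h1 (Real.exp_pos _).le h2

lemma wt_mono {μ b b' : ℝ} (h : b' ≤ b) (k : R3) : wt μ b k ≤ wt μ b' k := by
  unfold wt
  gcongr

lemma exp_mul_wt (μ b c : ℝ) (k : R3) : Real.exp (c * ‖k‖) * wt μ b k = wt μ (b - c) k := by
  unfold wt
  rw [mul_left_comm, ← Real.exp_add]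
  ring_nf

lemma integrable_wt {μ b : ℝ} (hμ : 3 < μ) (hb : 0 ≤ b) : Integrable (wt μ b) := by
  have h : Integrable fun k : R3 => (1 + ‖k‖) ^ (-μ) := integrable_one_add_norm (by simpa using hμ)
  refine h.mono' (by fun_prop) (Eventually.of_forall fun k => ?_)
  rw [Real.norm_of_nonneg (wt_pos μ b k).le]
  unfold wt
  have h2 : Real.exp (-(b * ‖k‖)) ≤ 1 := Real.exp_le_one_iff.2 (by
    have := mul_nonneg hb (norm_nonneg k); linarith)
  exact mul_le_of_le_one_right (by positivity) h2

lemma pow_mul_exp_neg_le {b x : ℝ} (hb : 0 < b) (hx : 0 ≤ x) (n : ℕ) :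
    x ^ n * Real.exp (-(b * x)) ≤ n.factorial / b ^ n := by
  have h := Real.pow_div_factorial_le_exp (b * x) (by positivity) n
  rw [mul_pow, div_le_iff₀ (by positivity)] at h
  rw [Real.exp_neg, ← div_eq_mul_inv, div_le_div_iff₀ (Real.exp_pos _) (by positivity)]
  linarith

/-- Powers of |k| are paid for by lowering the exponential rate, however slightly. -/
lemma pow_mul_wt_le {μ b c : ℝ} (hc : c < b) (n : ℕ) (k : R3) :
    ‖k‖ ^ n * wt μ b k ≤ n.factorial / (b - c) ^ n * wt μ c k := by
  have h := pow_mul_exp_neg_le (sub_pos.2 hc) (norm_nonneg k) n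
  have h2 : wt μ b k = Real.exp (-((b - c) * ‖k‖)) * wt μ c k := by
    rw [← neg_mul, exp_mul_wt]; ring_nf
  rw [h2, ← mul_assoc]
  exact mul_le_mul_of_nonneg_right h (wt_pos μ c k).le

lemma integrable_pow_mul_wt {μ b : ℝ} (hμ : 3 < μ) (hb : 0 < b) (n : ℕ) :
    Integrable fun k => ‖k‖ ^ n * wt μ b k := by
  refine ((integrable_wt (b := b / 2) hμ (by positivity)).const_mul
    (n.factorial / (b - b / 2) ^ n)).mono' (by fun_prop) (Eventually.of_forall fun k => ?_)
  rw [Real.norm_of_nonneg (mul_nonneg (by positivity) (wt_pos μ b k).le)]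
  exact pow_mul_wt_le (by linarith) n k

lemma norm_le_of_wnorm {μ b : ℝ} {g : R3 → C3} (h : wnorm μ b g < ⊤) (k : R3) :
    ‖g k‖ ≤ (wnorm μ b g).toReal * wt μ b k := by
  have h1 : ENNReal.ofReal ((1 + ‖k‖) ^ μ * Real.exp (b * ‖k‖) * ‖g k‖) ≤ wnorm μ b g :=
    le_iSup (fun k => ENNReal.ofReal ((1 + ‖k‖) ^ μ * Real.exp (b * ‖k‖) * ‖g k‖)) k
  have h2 := (ENNReal.ofReal_le_iff_le_toReal h.ne).1 h1
  have h3 : wt μ b k = ((1 + ‖k‖) ^ μ * Real.exp (b * ‖k‖))⁻¹ := by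
    unfold wt
    rw [Real.rpow_neg (by positivity), Real.exp_neg, mul_inv]
  rw [h3, ← div_eq_mul_inv, le_div_iff₀ (by positivity)]
  linarith

lemma wnorm_le_of_norm_le {μ b M : ℝ} {g : R3 → C3} (h : ∀ k, ‖g k‖ ≤ M * wt μ b k) :
    wnorm μ b g ≤ ENNReal.ofReal M := by
  refine iSup_le fun k => ENNReal.ofReal_le_ofReal ?_
  have h3 : ((1 + ‖k‖) ^ μ * Real.exp (b * ‖k‖)) * wt μ b k = 1 := by
    unfold wt
    rw [Real.rpow_neg (by positivity), Real.exp_neg]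
    field_simp
  calc (1 + ‖k‖) ^ μ * Real.exp (b * ‖k‖) * ‖g k‖
      ≤ (1 + ‖k‖) ^ μ * Real.exp (b * ‖k‖) * (M * wt μ b k) := by gcongr; exact h k
    _ = M := by rw [mul_left_comm, h3, mul_one]

/-- The constant in the convolution inequality for the weights. -/
def convConst (μ : ℝ) : ℝ := 2 ^ μ * (2 * ∫ k : R3, (1 + ‖k‖) ^ (-μ))

lemma convConst_nonneg (μ : ℝ) : 0 ≤ convConst μ := by
  unfold convConst
  have : 0 ≤ ∫ k : R3, (1 + ‖k‖) ^ (-μ) := integral_nonneg fun k => by positivity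
  positivity

/-- The exponentials combine by the triangle inequality. For the algebraic factors, the larger of
|k'| and |k - k'| is at least |k|/2, so its factor is at most 2^μ (1+|k|)^{-μ}, and the other factor
is kept. -/
lemma wt_mul_wt_le {μ b : ℝ} (hμ : 0 ≤ μ) (hb : 0 ≤ b) (k k' : R3) :
    wt μ b k' * wt μ b (k - k') ≤
      wt μ b k * (2 ^ μ * ((1 + ‖k'‖) ^ (-μ) + (1 + ‖k - k'‖) ^ (-μ))) := by
  have htri : ‖k‖ ≤ ‖k'‖ + ‖k - k'‖ := by
    simpa using norm_add_le k' (k - k')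
  have hexp : Real.exp (-(b * ‖k'‖)) * Real.exp (-(b * ‖k - k'‖)) ≤ Real.exp (-(b * ‖k‖)) := by
    rw [← Real.exp_add, Real.exp_le_exp]
    nlinarith
  have key : ∀ x y : ℝ, 0 ≤ x → 0 ≤ y → ‖k‖ ≤ x + y → x ≤ y →
      (1 + x) ^ (-μ) * (1 + y) ^ (-μ) ≤
        (1 + ‖k‖) ^ (-μ) * (2 ^ μ * ((1 + x) ^ (-μ) + (1 + y) ^ (-μ))) := by
    intro x y hx hy hxy hle
    have h1 : (1 + y) ^ (-μ) ≤ 2 ^ μ * (1 + ‖k‖) ^ (-μ) := by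
      have h2 : (1 + y) ^ (-μ) ≤ ((1 + ‖k‖) / 2) ^ (-μ) :=
        Real.rpow_le_rpow_of_nonpos (by positivity) (by linarith) (by linarith)
      refine h2.trans (le_of_eq ?_)
      rw [Real.div_rpow (by positivity) (by norm_num), Real.rpow_neg (by norm_num : (0:ℝ) ≤ 2),
        div_inv_eq_mul, mul_comm]
    calc (1 + x) ^ (-μ) * (1 + y) ^ (-μ) ≤ (1 + x) ^ (-μ) * (2 ^ μ * (1 + ‖k‖) ^ (-μ)) := by gcongr
      _ = (1 + ‖k‖) ^ (-μ) * (2 ^ μ * ((1 + x) ^ (-μ) + 0)) := by ring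
      _ ≤ _ := by gcongr; positivity
  have hpol : (1 + ‖k'‖) ^ (-μ) * (1 + ‖k - k'‖) ^ (-μ) ≤
      (1 + ‖k‖) ^ (-μ) * (2 ^ μ * ((1 + ‖k'‖) ^ (-μ) + (1 + ‖k - k'‖) ^ (-μ))) := by
    rcases le_total ‖k'‖ ‖k - k'‖ with h | h
    · exact key _ _ (norm_nonneg _) (norm_nonneg _) htri h
    · have := key _ _ (norm_nonneg _) (norm_nonneg _) (by linarith) h
      rw [mul_comm, add_comm ((1 + ‖k'‖) ^ (-μ))]
      exact this
  unfold wt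
  calc _ = ((1 + ‖k'‖) ^ (-μ) * (1 + ‖k - k'‖) ^ (-μ)) *
        (Real.exp (-(b * ‖k'‖)) * Real.exp (-(b * ‖k - k'‖))) := by ring
    _ ≤ ((1 + ‖k‖) ^ (-μ) * (2 ^ μ * ((1 + ‖k'‖) ^ (-μ) + (1 + ‖k - k'‖) ^ (-μ)))) *
        Real.exp (-(b * ‖k‖)) := by gcongr
    _ = _ := by ring

/-- This makes the weighted space a convolution algebra. The condition μ > 3 enters as integrability
of (1+|k|)^{-μ} on ℝ³. -/
lemma lconv_wt_le {μ b : ℝ} (hμ : 3 < μ) (hb : 0 ≤ b) (k : R3) :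
    lconv (fun k => ENNReal.ofReal (wt μ b k)) (fun k => ENNReal.ofReal (wt μ b k)) k
      ≤ ENNReal.ofReal (convConst μ * wt μ b k) := by
  have hi : Integrable fun k : R3 => (1 + ‖k‖) ^ (-μ) := integrable_one_add_norm (by simpa using hμ)
  have hi2 : Integrable fun k' : R3 =>
      wt μ b k * (2 ^ μ * ((1 + ‖k'‖) ^ (-μ) + (1 + ‖k - k'‖) ^ (-μ))) :=
    ((hi.add (hi.comp_sub_left k)).const_mul _).const_mul _
  calc lconv (fun k => ENNReal.ofReal (wt μ b k)) (fun k => ENNReal.ofReal (wt μ b k)) k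
      ≤ ∫⁻ k', ENNReal.ofReal
          (wt μ b k * (2 ^ μ * ((1 + ‖k'‖) ^ (-μ) + (1 + ‖k - k'‖) ^ (-μ)))) := by
        refine lintegral_mono fun k' => ?_
        rw [← ENNReal.ofReal_mul (wt_pos _ _ _).le]
        exact ENNReal.ofReal_le_ofReal (wt_mul_wt_le (by linarith) hb k k')
    _ = ENNReal.ofReal (∫ k',
          (wt μ b k * (2 ^ μ * ((1 + ‖k'‖) ^ (-μ) + (1 + ‖k - k'‖) ^ (-μ))))) := by
        rw [ofReal_integral_eq_lintegral_ofReal hi2]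
        exact Eventually.of_forall fun k' => mul_nonneg (wt_pos _ _ _).le (by positivity)
    _ = _ := by
        rw [integral_const_mul, integral_const_mul, integral_add hi (hi.comp_sub_left k),
          integral_sub_left_eq_self (fun k : R3 => (1 + ‖k‖) ^ (-μ)) volume k]
        congr 1
        unfold convConst
        ring

lemma norm_bil_le {μ b : ℝ} (hμ : 3 < μ) (hb : 0 ≤ b) {g h : R3 → C3} (hg : StronglyMeasurable g)
    (hh : StronglyMeasurable h) {A B : ℝ} (hA : 0 ≤ A) (hB : 0 ≤ B)
    (hgA : ∀ k, ‖g k‖ ≤ A * wt μ b k) (hhB : ∀ k, ‖h k‖ ≤ B * wt μ b k) (k : R3) :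
    ‖bil g h k‖ ≤ ‖k‖ * (A * B * convConst μ * wt μ b k) := by
  have h0 := wt_pos μ b
  have hC := convConst_nonneg μ
  have h1 : lconv (fun k => ‖g k‖ₑ) (fun k => ‖h k‖ₑ) k ≤
      ENNReal.ofReal (A * B * convConst μ * wt μ b k) := by
    calc lconv (fun k => ‖g k‖ₑ) (fun k => ‖h k‖ₑ) k
        ≤ ∫⁻ k', ENNReal.ofReal (A * B) *
            (ENNReal.ofReal (wt μ b k') * ENNReal.ofReal (wt μ b (k - k'))) := by
          refine lintegral_mono fun k' => ?_
          simp only [← ofReal_norm]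
          rw [← ENNReal.ofReal_mul (h0 _).le, ← ENNReal.ofReal_mul (norm_nonneg _),
            ← ENNReal.ofReal_mul (by positivity)]
          refine ENNReal.ofReal_le_ofReal ?_
          calc ‖g k'‖ * ‖h (k - k')‖ ≤ (A * wt μ b k') * (B * wt μ b (k - k')) :=
                mul_le_mul (hgA _) (hhB _) (norm_nonneg _) (mul_nonneg hA (h0 _).le)
            _ = _ := by ring
      _ = ENNReal.ofReal (A * B) * lconv (fun k => ENNReal.ofReal (wt μ b k))
            (fun k => ENNReal.ofReal (wt μ b k)) k := by
          rw [lintegral_const_mul _ (by fun_prop)]; rfl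
      _ ≤ ENNReal.ofReal (A * B) * ENNReal.ofReal (convConst μ * wt μ b k) := by
          gcongr; exact lconv_wt_le hμ hb k
      _ = _ := by rw [← ENNReal.ofReal_mul (by positivity)]; ring_nf
  have h2 := (enorm_bil_le g h hg.measurable hh.measurable k).trans (mul_le_mul_right h1 _)
  rw [← ofReal_norm, ← ofReal_norm, ← ENNReal.ofReal_mul (norm_nonneg _)] at h2
  exact (ENNReal.ofReal_le_ofReal_iff (mul_nonneg (norm_nonneg _)
    (mul_nonneg (by positivity) (h0 k).le))).1 h2

lemma tame_of_wt {μ b : ℝ} (hμ : 3 < μ) (hb : 0 ≤ b) {g : R3 → C3} (hg : StronglyMeasurable g)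
    {A : ℝ} (hgA : ∀ k, ‖g k‖ ≤ A * wt μ b k) : Tame g := by
  refine ⟨hg, ((integrable_wt hμ hb).const_mul A).mono' hg.aestronglyMeasurable
    (Eventually.of_forall hgA), |A|, fun k => (hgA k).trans ?_⟩
  calc A * wt μ b k ≤ |A| * 1 := by
        gcongr
        · exact (wt_pos _ _ _).le
        · exact le_abs_self A
        · exact wt_le_one (by linarith) hb k
    _ = |A| := mul_one _

lemma integrable_pow_mul_of_wt {μ b : ℝ} (hμ : 3 < μ) (hb : 0 < b) {g : R3 → C3}
    (hg : AEStronglyMeasurable g) {A : ℝ} (hgA : ∀ k, ‖g k‖ ≤ A * wt μ b k) (n : ℕ) :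
    Integrable fun k => ‖k‖ ^ n * ‖g k‖ := by
  refine ((integrable_pow_mul_wt hμ hb n).const_mul A).mono' (by fun_prop)
    (Eventually.of_forall fun k => ?_)
  rw [Real.norm_of_nonneg (by positivity), mul_left_comm]
  exact mul_le_mul_of_nonneg_left (hgA k) (by positivity)

/-! ### Radial moments of the weight -/

/-- In polar coordinates the moment is 4π times a one-dimensional integral. Once the algebraic
weight is replaced by 1/(4y), this becomes a Gamma integral with value (j+1)!/b^{j+2}. -/
lemma integral_moment_wt_le {μ b σ : ℝ} (hμ : 3 < μ) (hb : 0 < b) (hσ : 0 ≤ σ) (j : ℕ) :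
    ∫ k, (σ * ‖k‖) ^ j / j.factorial * wt μ b k ≤ Real.pi / b ^ 2 * (j + 1) * (σ / b) ^ j := by
  have hinteg : IntegrableOn (fun y : ℝ => y ^ (j + 1) * Real.exp (-(b * y))) (Set.Ioi 0) := by
    have := integrableOn_rpow_mul_exp_neg_mul_rpow (s := (j + 1 : ℝ)) (p := 1) (b := b)
      (by linarith [(Nat.cast_nonneg j : (0:ℝ) ≤ j)]) one_pos hb
    refine this.congr_fun (fun y hy => ?_) measurableSet_Ioi
    simp only [Real.rpow_one, neg_mul]
    rw [← Real.rpow_natCast]; push_cast; rfl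
  have hval : ∫ y in Set.Ioi (0 : ℝ), y ^ (j + 1) * Real.exp (-(b * y)) =
      (j + 1).factorial / b ^ (j + 2) := by
    have h := Real.integral_rpow_mul_exp_neg_mul_Ioi (a := (j + 2 : ℝ)) (r := b)
      (by positivity) hb
    have e : (j + 2 : ℝ) = ((j + 1 : ℕ) : ℝ) + 1 := by push_cast; ring
    rw [e, Real.Gamma_nat_eq_factorial, ← e] at h
    have e2 : (j : ℝ) + 2 = ((j + 2 : ℕ) : ℝ) := by push_cast; ring
    rw [show (j : ℝ) + 2 - 1 = ((j + 1 : ℕ) : ℝ) by push_cast; ring, e2] at h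
    simp only [Real.rpow_natCast] at h
    rw [h, one_div, inv_pow]
    field_simp
  have hrad := integral_fun_norm_addHaar (volume : Measure R3)
    (fun y : ℝ => (σ * y) ^ j / j.factorial * ((1 + y) ^ (-μ) * Real.exp (-(b * y))))
  have hball : (volume : Measure R3).real (Metric.ball 0 1) = Real.pi * 4 / 3 := by
    rw [Measure.real, EuclideanSpace.volume_ball_fin_three]
    simp
    positivity
  have hdim : Module.finrank ℝ R3 = 3 := by simp
  rw [hball, hdim] at hrad
  change ∫ k : R3, (σ * ‖k‖) ^ j / j.factorial * ((1 + ‖k‖) ^ (-μ) * Real.exp (-(b * ‖k‖))) ≤ _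
  rw [hrad]
  have hle : ∫ y in Set.Ioi (0 : ℝ), y ^ (3 - 1) • ((σ * y) ^ j / j.factorial *
      ((1 + y) ^ (-μ) * Real.exp (-(b * y)))) ≤
      ∫ y in Set.Ioi (0 : ℝ), (σ ^ j / j.factorial / 4) * (y ^ (j + 1) * Real.exp (-(b * y))) := by
    refine integral_mono_of_nonneg ?_ (hinteg.const_mul _) ?_
    · filter_upwards [ae_restrict_mem measurableSet_Ioi] with y hy
      have hy : 0 < y := hy
      simp only [Pi.zero_apply, smul_eq_mul]
      positivity
    · filter_upwards [ae_restrict_mem measurableSet_Ioi] with y hy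
      have hy : 0 < y := hy
      -- Since μ ≥ 2, the left side is at most (1+y)^{-2}, and (1+y)² ≥ 4y. One power of y is
      -- removed, with a constant independent of μ.
      have h1 : (1 + y) ^ (-μ) ≤ (4 * y)⁻¹ := by
        have h2 : (1 + y) ^ (-μ) ≤ (1 + y) ^ (-2 : ℝ) :=
          Real.rpow_le_rpow_of_exponent_le (by linarith) (by linarith)
        refine h2.trans ?_
        rw [Real.rpow_neg (by positivity)]
        refine inv_anti₀ (by positivity) ?_
        rw [Real.rpow_two]
        nlinarith [sq_nonneg (1 - y)]
      simp only [smul_eq_mul]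
      calc y ^ 2 * ((σ * y) ^ j / j.factorial * ((1 + y) ^ (-μ) * Real.exp (-(b * y))))
          ≤ y ^ 2 * ((σ * y) ^ j / j.factorial * ((4 * y)⁻¹ * Real.exp (-(b * y)))) := by
            gcongr
        _ = _ := by rw [mul_pow, pow_succ y j]; field_simp
  rw [integral_const_mul, hval] at hle
  simp only [nsmul_eq_mul, smul_eq_mul]
  calc ((3 : ℕ) : ℝ) * (Real.pi * 4 / 3 * _) ≤ ((3 : ℕ) : ℝ) * (Real.pi * 4 / 3 *
        (σ ^ j / j.factorial / 4 * ((j + 1).factorial / b ^ (j + 2)))) := by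
        gcongr
        exact hle
    _ = _ := by
        rw [Nat.factorial_succ, div_pow]
        push_cast
        field_simp
        ring

lemma lintegral_moment_wt_le {μ b σ : ℝ} (hμ : 3 < μ) (hb : 0 < b) (hσ : 0 ≤ σ) (j : ℕ) :
    ∫⁻ k, ENNReal.ofReal ((σ * ‖k‖) ^ j / j.factorial) * ENNReal.ofReal (wt μ b k) ≤
      ENNReal.ofReal (Real.pi / b ^ 2 * (j + 1) * (σ / b) ^ j) := by
  have hi : Integrable fun k => (σ * ‖k‖) ^ j / j.factorial * wt μ b k := by
    refine ((integrable_pow_mul_wt hμ hb j).const_mul (σ ^ j / j.factorial)).congr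
      (Eventually.of_forall fun k => ?_)
    simp only [mul_pow]
    ring
  refine le_trans (le_of_eq ?_) (ENNReal.ofReal_le_ofReal (integral_moment_wt_le hμ hb hσ j))
  rw [ofReal_integral_eq_lintegral_ofReal hi
    (Eventually.of_forall fun k => mul_nonneg (by positivity) (wt_pos _ _ _).le)]
  exact lintegral_congr fun k => by rw [ENNReal.ofReal_mul (by positivity)]

/-! ### The inverse Fourier transform -/

section Fourier

open scoped FourierTransform RealInnerProductSpace ContDiff

variable {E : Type*} [NormedAddCommGroup E] [NormedSpace ℂ E]

/-- The phase `e^{i k·x}`. -/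
def phase (k x : R3) : ℂ := Complex.exp (Complex.I * ((inner ℝ k x : ℝ) : ℂ))

/-- The field with Fourier transform `g`. -/
def invF (g : R3 → E) (x : R3) : E := ∫ k, phase k x • g k

@[simp] lemma norm_phase (k x : R3) : ‖phase k x‖ = 1 := by
  unfold phase
  rw [mul_comm, Complex.norm_exp_ofReal_mul_I]

@[fun_prop]
lemma continuous_phase_left (x : R3) : Continuous fun k => phase k x := by
  unfold phase; fun_prop

lemma phase_add (k k' x : R3) : phase (k + k') x = phase k x * phase k' x := by
  unfold phase
  rw [inner_add_left, ← Complex.exp_add]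
  push_cast
  ring_nf

lemma isFourierPair_iff {v g : R3 → C3} : IsFourierPair v g ↔ Integrable g ∧ v = invF g := by
  unfold IsFourierPair
  rw [funext_iff]
  rfl

lemma integrable_phase_smul {g : R3 → E} (hg : Integrable g) (x : R3) :
    Integrable fun k => phase k x • g k := by
  refine hg.norm.mono' ((continuous_phase_left x).aestronglyMeasurable.smul
    hg.aestronglyMeasurable) (Eventually.of_forall fun k => ?_)
  rw [norm_smul, norm_phase, one_mul]

lemma norm_invF_le (g : R3 → E) (x : R3) : ‖invF g x‖ ≤ ∫ k, ‖g k‖ := by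
  refine (norm_integral_le_integral_norm _).trans (le_of_eq ?_)
  simp only [norm_smul, norm_phase, one_mul]

lemma invF_congr_ae {g h : R3 → E} (hgh : g =ᵐ[volume] h) : invF g = invF h := by
  ext x
  exact integral_congr_ae (hgh.mono fun k hk => by simp only [hk])

lemma invF_add {g h : R3 → E} (hg : Integrable g) (hh : Integrable h) (x : R3) :
    invF (fun k => g k + h k) x = invF g x + invF h x := by
  unfold invF
  rw [← integral_add (integrable_phase_smul hg x) (integrable_phase_smul hh x)]
  simp only [smul_add]

lemma invF_sub {g h : R3 → E} (hg : Integrable g) (hh : Integrable h) (x : R3) :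
    invF (fun k => g k - h k) x = invF g x - invF h x := by
  unfold invF
  rw [← integral_sub (integrable_phase_smul hg x) (integrable_phase_smul hh x)]
  simp only [smul_sub]

lemma invF_smul (c : ℂ) (g : R3 → E) (x : R3) :
    invF (fun k => c • g k) x = c • invF g x := by
  unfold invF
  rw [← integral_smul]
  simp only [smul_comm c]

lemma invF_sum {ι : Type*} (s : Finset ι) {g : ι → R3 → E} (hg : ∀ i ∈ s, Integrable (g i))
    (x : R3) : invF (fun k => ∑ i ∈ s, g i k) x = ∑ i ∈ s, invF (g i) x := by
  unfold invF
  rw [← integral_finsetSum _ fun i hi => integrable_phase_smul (hg i hi) x]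
  simp only [Finset.smul_sum]

/-- The bilinear form that turns `invF` into a `VectorFourier.fourierIntegral`. -/
def phaseForm : R3 →L[ℝ] R3 →L[ℝ] ℝ := (-(2 * Real.pi)⁻¹) • innerSL ℝ

lemma phaseForm_apply (k x : R3) : phaseForm k x = -(2 * Real.pi)⁻¹ * inner ℝ k x := by
  simp only [phaseForm, _root_.smul_apply, smul_eq_mul]
  rfl

lemma invF_eq_fourierIntegral (g : R3 → E) :
    invF g = VectorFourier.fourierIntegral 𝐞 volume phaseForm.toLinearMap₁₂ g := by
  ext x
  unfold invF VectorFourier.fourierIntegral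
  refine integral_congr_ae (Eventually.of_forall fun k => ?_)
  simp only [Circle.smul_def, Real.fourierChar_apply]
  congr 1
  unfold phase
  congr 1
  have h : -((phaseForm.toLinearMap₁₂ k) x) = (2 * Real.pi)⁻¹ * inner ℝ k x := by
    change -(phaseForm k x) = _
    rw [phaseForm_apply]; ring
  rw [h]
  push_cast
  have : (Real.pi : ℂ) ≠ 0 := by exact_mod_cast Real.pi_ne_zero
  field_simp

lemma contDiff_invF {g : R3 → E} {N : ℕ} (hg : ∀ n ≤ N, Integrable fun k => ‖k‖ ^ n * ‖g k‖) :
    ContDiff ℝ N (invF g) := by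
  rw [invF_eq_fourierIntegral]
  exact VectorFourier.contDiff_fourierIntegral (N := (N : ℕ∞)) phaseForm
    fun n hn => hg n (by exact_mod_cast hn)

lemma fderiv_invF {g : R3 → E} (hg : Integrable g) (hg1 : Integrable fun k => ‖k‖ * ‖g k‖)
    (x e : R3) : fderiv ℝ (invF g) x e =
      invF (fun k => (Complex.I * ((inner ℝ k e : ℝ) : ℂ)) • g k) x := by
  rw [invF_eq_fourierIntegral, VectorFourier.fderiv_fourierIntegral phaseForm hg hg1,
    VectorFourier.fourierIntegral_continuousLinearMap_apply Real.continuous_fourierChar,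
    ← invF_eq_fourierIntegral]
  · unfold invF
    refine integral_congr_ae (Eventually.of_forall fun k => ?_)
    simp only [VectorFourier.fourierSMulRight_apply, phaseForm_apply]
    rw [← Complex.coe_smul, smul_smul (-(2 * (Real.pi : ℂ) * Complex.I))]
    congr 2
    push_cast
    have : (Real.pi : ℂ) ≠ 0 := by exact_mod_cast Real.pi_ne_zero
    field_simp
  · refine (hg1.const_mul (2 * Real.pi * ‖phaseForm‖)).mono' hg.1.fourierSMulRight
      (Eventually.of_forall fun k => ?_)
    refine (VectorFourier.norm_fourierSMulRight_le phaseForm g k).trans (le_of_eq (by ring))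

lemma pderiv_invF {g : R3 → C3} (hg : Integrable g) (hg1 : Integrable fun k => ‖k‖ * ‖g k‖)
    (j : Fin 3) (x : R3) :
    pderiv j (invF g) x = invF (fun k => (Complex.I * (k j : ℂ)) • g k) x := by
  unfold pderiv
  rw [fderiv_invF hg hg1]
  congr 1
  ext k : 1
  simp [EuclideanSpace.inner_single_right]

lemma laplacian_invF {g : R3 → E} (hg : ∀ n ≤ 2, Integrable fun k => ‖k‖ ^ n * ‖g k‖)
    (hgm : AEStronglyMeasurable g) (x : R3) :
    Laplacian.laplacian (invF g) x = invF (fun k => (-((‖k‖ ^ 2 : ℝ) : ℂ)) • g k) x := by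
  have hg' : ∀ n : ℕ, n ≤ (2 : ℕ∞) → Integrable fun k => ‖k‖ ^ n * ‖g k‖ :=
    fun n hn => hg n (by exact_mod_cast hn)
  have hgj : ∀ j : Fin 3, Integrable fun k : R3 => ((-((k j ^ 2 : ℝ)) : ℝ) : ℂ) • g k := by
    intro j
    refine (hg 2 le_rfl).mono' ?_ (Eventually.of_forall fun k => ?_)
    · exact (Continuous.aestronglyMeasurable (by fun_prop)).smul hgm
    · rw [norm_smul, Complex.norm_real, norm_neg, norm_pow]
      gcongr
      exact PiLp.norm_apply_le k j
  rw [InnerProductSpace.laplacian_eq_iteratedFDeriv_orthonormalBasis (invF g)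
    (EuclideanSpace.basisFun (Fin 3) ℝ)]
  have h : ∀ j : Fin 3, iteratedFDeriv ℝ 2 (invF g) x
      ![EuclideanSpace.basisFun (Fin 3) ℝ j, EuclideanSpace.basisFun (Fin 3) ℝ j] =
      invF (fun k : R3 => ((-((k j ^ 2 : ℝ)) : ℝ) : ℂ) • g k) x := by
    intro j
    rw [invF_eq_fourierIntegral, VectorFourier.iteratedFDeriv_fourierIntegral phaseForm hg' hgm
      (n := 2) le_rfl, VectorFourier.fourierIntegral_continuousMultilinearMap_apply
      Real.continuous_fourierChar
      (VectorFourier.integrable_fourierPowSMulRight phaseForm (hg 2 le_rfl) hgm),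
      ← invF_eq_fourierIntegral]
    unfold invF
    refine integral_congr_ae (Eventually.of_forall fun k => ?_)
    simp only [VectorFourier.fourierPowSMulRight_apply, Fin.prod_univ_two, phaseForm_apply]
    rw [← Complex.coe_smul, smul_smul ((-(2 * (Real.pi : ℂ) * Complex.I)) ^ 2)]
    congr 2
    simp only [Matrix.cons_val_zero, Matrix.cons_val_one, EuclideanSpace.basisFun_apply,
      EuclideanSpace.inner_single_right, conj_trivial, one_mul]
    push_cast
    have : (Real.pi : ℂ) ≠ 0 := by exact_mod_cast Real.pi_ne_zero
    field_simp
    rw [Complex.I_sq]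
    ring
  simp only [h]
  rw [← invF_sum _ fun j _ => hgj j]
  congr 1
  ext k : 1
  rw [← Finset.sum_smul]
  congr 1
  rw [EuclideanSpace.norm_sq_eq]
  push_cast
  simp [← Complex.ofReal_pow]

lemma integrable_fconv_integrand {g h : R3 → C3} (hg : Integrable g) (hh : Integrable h)
    (j : Fin 3) : Integrable (fun p : R3 × R3 => g p.2 j • h (p.1 - p.2))
      (volume.prod volume) := by
  have hgj : Integrable fun k => g k j :=
    hg.norm.mono' ((EuclideanSpace.proj (𝕜 := ℂ) j).continuous.comp_aestronglyMeasurable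
      hg.aestronglyMeasurable) (Eventually.of_forall fun k => PiLp.norm_apply_le (g k) j)
  exact hgj.convolution_integrand (ContinuousLinearMap.lsmul ℂ ℂ) hh

lemma integrable_fconv {g h : R3 → C3} (hg : Integrable g) (hh : Integrable h)
    (j : Fin 3) : Integrable (fconv j g h) :=
  (integrable_fconv_integrand hg hh j).integral_prod_left

lemma invF_apply {g : R3 → C3} (hg : Integrable g) (x : R3) (j : Fin 3) :
    invF g x j = invF (fun k => g k j) x := by
  have := (EuclideanSpace.proj j : C3 →L[ℂ] ℂ).integral_comp_comm
    (integrable_phase_smul hg x)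
  exact this.symm

/-- Fubini, translation by k', and multiplicativity of the phase. The chosen normalisation leaves no
constant in front of the convolution. -/
lemma invF_smul_invF {g h : R3 → C3} (hg : Integrable g) (hh : Integrable h)
    (j : Fin 3) (x : R3) : invF g x j • invF h x = invF (fconv j g h) x := by
  have h1 : invF (fconv j g h) x = ∫ k, ∫ k', phase k x • g k' j • h (k - k') := by
    unfold invF fconv
    exact integral_congr_ae (Eventually.of_forall fun k => by simp only [integral_smul])
  have hinteg : Integrable (fun p : R3 × R3 => phase p.1 x • g p.2 j • h (p.1 - p.2))
      (volume.prod volume) := by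
    refine (integrable_fconv_integrand hg hh j).norm.mono' ?_ (Eventually.of_forall fun p => ?_)
    · have hc : Continuous fun p : R3 × R3 => phase p.1 x := by fun_prop
      exact hc.aestronglyMeasurable.smul
        (integrable_fconv_integrand hg hh j).aestronglyMeasurable
    · rw [norm_smul, norm_phase, one_mul]
  rw [h1, integral_integral_swap hinteg, invF_apply hg]
  unfold invF
  rw [← integral_smul_const]
  refine integral_congr_ae (Eventually.of_forall fun k' => ?_)
  simp only
  rw [← integral_sub_right_eq_self (fun k => phase k x • h k) k', ← integral_smul]
  refine integral_congr_ae (Eventually.of_forall fun k => ?_)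
  simp only [smul_smul, smul_eq_mul]
  congr 1
  have : phase k x = phase (k - k') x * phase k' x := by rw [← phase_add, sub_add_cancel]
  rw [this]
  ring

/-- A smooth compactly supported function is the transform of an integrable function. -/
lemma exists_invF_eq {φ : R3 → ℂ} (hφ : ContDiff ℝ ∞ φ) (hφc : HasCompactSupport φ) :
    ∃ Φ : R3 → ℂ, Integrable Φ ∧ φ = invF Φ := by
  let s := hφc.toSchwartzMap hφ
  let ψ : R3 → ℂ := ((𝓕⁻ s : SchwartzMap R3 ℂ) : R3 → ℂ)
  have hψ : Integrable ψ := SchwartzMap.integrable _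
  have h1 : 𝓕 ψ = φ := by
    have : 𝓕 (𝓕⁻ s : SchwartzMap R3 ℂ) = s := FourierTransform.fourier_fourierInv_eq s
    have h2 := congrArg (fun f : SchwartzMap R3 ℂ => (f : R3 → ℂ)) this
    simp only [SchwartzMap.fourier_coe] at h2
    exact h2
  have hpi : (2 * Real.pi)⁻¹ ≠ 0 := by positivity
  -- The transform with 2π in its phase turns into `invF` under the substitution x ↦ -x/(2π). The
  -- factor (2π)⁻³ is its Jacobian.
  refine ⟨fun x => (((2 * Real.pi)⁻¹ ^ 3 : ℝ) : ℂ) • ψ ((-(2 * Real.pi)⁻¹) • x), ?_, ?_⟩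
  · exact ((integrable_comp_smul_iff volume ψ (neg_ne_zero.2 hpi)).2 hψ).smul
      (((2 * Real.pi)⁻¹ ^ 3 : ℝ) : ℂ)
  · ext k
    rw [← h1, invF_smul]
    unfold invF
    have h3 := Measure.integral_comp_smul (volume : Measure R3)
      (fun x => phase ((-(2 * Real.pi)) • x) k • ψ x) (-(2 * Real.pi)⁻¹)
    have h4 : ∀ x : R3, (-(2 * Real.pi)) • (-(2 * Real.pi)⁻¹) • x = x := by
      intro x
      rw [smul_smul, neg_mul_neg, mul_inv_cancel₀ (by positivity), one_smul]
    simp only [h4] at h3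
    rw [h3, Real.fourier_eq]
    have h5 : Module.finrank ℝ R3 = 3 := by simp
    rw [h5, ← Complex.coe_smul, smul_smul]
    have h6 : ((((2 * Real.pi)⁻¹ ^ 3 : ℝ) : ℂ) * ((|((-(2 * Real.pi)⁻¹) ^ 3)⁻¹| : ℝ) : ℂ)) = 1 := by
      have hp : 0 < 2 * Real.pi := by positivity
      have : |((-(2 * Real.pi)⁻¹) ^ 3)⁻¹| = (2 * Real.pi) ^ 3 := by
        rw [abs_inv, abs_pow, abs_neg, abs_inv, abs_of_pos hp, inv_pow, inv_inv]
      rw [this, ← Complex.ofReal_mul, inv_pow, inv_mul_cancel₀ (by positivity), Complex.ofReal_one]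
    rw [h6, one_smul]
    refine integral_congr_ae (Eventually.of_forall fun x => ?_)
    simp only [Circle.smul_def, Real.fourierChar_apply]
    congr 1
    unfold phase
    congr 1
    rw [inner_smul_left]
    simp
    ring

/-- Duality by Fubini, using the symmetry of the phase in k and x. It transfers information about a
field to its transform tested against smooth functions. -/
lemma integral_invF_smul [CompleteSpace E] {Φ : R3 → ℂ} {g : R3 → E} (hΦ : Integrable Φ)
    (hg : Integrable g) : ∫ k, invF Φ k • g k = ∫ x, Φ x • invF g x := by
  have h := VectorFourier.integral_fourierIntegral_smul_eq_flip (L := phaseForm.toLinearMap₁₂)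
    (μ := volume) (ν := volume) Real.continuous_fourierChar
    (by exact phaseForm.continuous₂) hΦ hg
  rw [← invF_eq_fourierIntegral] at h
  rw [h]
  have : VectorFourier.fourierIntegral 𝐞 volume phaseForm.toLinearMap₁₂.flip g = invF g := by
    rw [invF_eq_fourierIntegral]
    ext x
    unfold VectorFourier.fourierIntegral
    refine integral_congr_ae (Eventually.of_forall fun k => ?_)
    have e : phaseForm.toLinearMap₁₂.flip k x = phaseForm.toLinearMap₁₂ k x := by
      change phaseForm x k = phaseForm k x
      rw [phaseForm_apply, phaseForm_apply, real_inner_comm]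
    simp only [e]
  rw [this]

/-- Every smooth compactly supported test function is the transform of an integrable function. By
duality, g therefore annihilates all test functions. -/
lemma ae_eq_zero_of_invF_eq_zero [CompleteSpace E] {g : R3 → E} (hg : Integrable g)
    (h : ∀ x, invF g x = 0) : g =ᵐ[volume] 0 := by
  have : ∀ᵐ k, g k = 0 := by
    refine ae_eq_zero_of_integral_contDiff_smul_eq_zero hg.locallyIntegrable fun φ hφ hφc => ?_
    obtain ⟨Φ, hΦ, hΦe⟩ := exists_invF_eq (φ := fun k => ((φ k : ℝ) : ℂ))
      (Complex.ofRealCLM.contDiff.comp hφ) (hφc.comp_left Complex.ofReal_zero)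
    have h1 := integral_invF_smul hΦ hg
    rw [← hΦe] at h1
    simp only [h, smul_zero, integral_zero, Complex.coe_smul] at h1
    exact h1
  exact this

lemma ae_eq_of_invF_eq [CompleteSpace E] {g h : R3 → E} (hg : Integrable g) (hh : Integrable h)
    (hgh : ∀ x, invF g x = invF h x) : g =ᵐ[volume] h := by
  have := ae_eq_zero_of_invF_eq_zero (g := fun k => g k - h k) (hg.sub hh) fun x => by
    rw [invF_sub hg hh, hgh, sub_self]
  filter_upwards [this] with k hk
  exact sub_eq_zero.1 hk

lemma sum_pderiv_invF {g : R3 → C3} (hg : Integrable g) (hg1 : Integrable fun k => ‖k‖ * ‖g k‖)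
    (x : R3) : ∑ j, pderiv j (invF g) x j = invF (fun k => Complex.I * kdot k (g k)) x := by
  have hj : ∀ j : Fin 3, Integrable fun k : R3 => (Complex.I * (k j : ℂ)) • g k := by
    intro j
    have hc : Continuous fun k : R3 => Complex.I * (k j : ℂ) := by fun_prop
    refine hg1.mono' (hc.aestronglyMeasurable.smul
      hg.aestronglyMeasurable) (Eventually.of_forall fun k => ?_)
    rw [norm_smul, norm_mul, Complex.norm_I, one_mul, Complex.norm_real]
    gcongr
    exact PiLp.norm_apply_le k j
  have hj' : ∀ j : Fin 3, Integrable fun k : R3 => ((Complex.I * (k j : ℂ)) • g k) j := by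
    intro j
    exact (hj j).norm.mono' ((EuclideanSpace.proj (𝕜 := ℂ) j).continuous.comp_aestronglyMeasurable
      (hj j).aestronglyMeasurable) (Eventually.of_forall fun k => PiLp.norm_apply_le _ j)
  have : ∀ j, pderiv j (invF g) x j = invF (fun k : R3 => ((Complex.I * (k j : ℂ)) • g k) j) x := by
    intro j
    rw [pderiv_invF hg hg1, invF_apply (hj j)]
  simp only [this]
  rw [← invF_sum _ fun j _ => hj' j]
  congr 1
  ext k
  simp [kdot, Finset.mul_sum, mul_assoc]

lemma ae_kdot_eq_zero {g : R3 → C3} (hg : Integrable g) (hg1 : Integrable fun k => ‖k‖ * ‖g k‖)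
    (h : IsDivFree (invF g)) : ∀ᵐ k, kdot k (g k) = 0 := by
  have hi : Integrable fun k => Complex.I * kdot k (g k) := by
    refine hg1.mono' ?_ (Eventually.of_forall fun k => ?_)
    · have : ∀ j : Fin 3, AEStronglyMeasurable (fun k => g k j) := fun j =>
        (EuclideanSpace.proj (𝕜 := ℂ) j).continuous.comp_aestronglyMeasurable
          hg.aestronglyMeasurable
      unfold kdot
      refine AEStronglyMeasurable.mul aestronglyMeasurable_const ?_
      refine Finset.aestronglyMeasurable_fun_sum _ fun j _ => ?_
      exact (Continuous.aestronglyMeasurable (by fun_prop)).mul (this j)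
    · rw [norm_mul, Complex.norm_I, one_mul]
      exact norm_kdot_le k (g k)
  have := ae_eq_zero_of_invF_eq_zero hi fun x => by
    rw [← sum_pderiv_invF hg hg1]; exact h x
  filter_upwards [this] with k hk
  simpa using hk

end Fourier

/-! ### The time domain -/

/-- The form in which the domain enters the estimates: it yields |t| < 1/α and |t|/√(Re t) < 1/√α.
Both sides are false at t = 0, where 1/t is 0. -/
lemma mem_timeDomain_iff {α : ℝ} (hα : 0 < α) {t : ℂ} :
    t ∈ timeDomain α ↔ α * ‖t‖ ^ 2 < t.re := by
  unfold timeDomain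
  rw [Set.mem_ofPred_eq, one_div, Complex.inv_re, Complex.normSq_eq_norm_sq]
  by_cases ht : t = 0
  · simp [ht, hα.le]
  · rw [lt_div_iff₀ (by positivity)]

/-- Being a disc, the domain is convex and carries primitives of holomorphic functions; 0 lies on
its boundary. -/
lemma timeDomain_eq_ball {α : ℝ} (hα : 0 < α) :
    timeDomain α = Metric.ball ((1 / (2 * α) : ℝ) : ℂ) (1 / (2 * α)) := by
  ext t
  have hr : 0 < 1 / (2 * α) := by positivity
  rw [mem_timeDomain_iff hα, Metric.mem_ball, dist_eq_norm,
    ← sq_lt_sq₀ (norm_nonneg _) hr.le, ← Complex.normSq_eq_norm_sq, ← Complex.normSq_eq_norm_sq,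
    Complex.normSq_apply, Complex.normSq_apply]
  simp only [Complex.sub_re, Complex.ofReal_re, Complex.sub_im, Complex.ofReal_im, sub_zero]
  have e : (t.re - 1 / (2 * α)) * (t.re - 1 / (2 * α)) + t.im * t.im - (1 / (2 * α)) ^ 2 =
      (α * (t.re * t.re + t.im * t.im) - t.re) / α := by
    field_simp; ring
  constructor
  · intro h
    have : (α * (t.re * t.re + t.im * t.im) - t.re) / α < 0 := div_neg_of_neg_of_pos (by linarith) hα
    linarith
  · intro h
    have : (α * (t.re * t.re + t.im * t.im) - t.re) / α < 0 := by linarith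
    rw [div_lt_iff₀ hα] at this
    linarith

lemma isOpen_timeDomain {α : ℝ} (hα : 0 < α) : IsOpen (timeDomain α) := by
  rw [timeDomain_eq_ball hα]; exact Metric.isOpen_ball

lemma ne_zero_of_mem_timeDomain {α : ℝ} (hα : 0 < α) {t : ℂ} (ht : t ∈ timeDomain α) : t ≠ 0 := by
  rintro rfl
  rw [mem_timeDomain_iff hα] at ht
  simp at ht

lemma re_pos_of_mem_timeDomain {α : ℝ} (hα : 0 < α) {t : ℂ} (ht : t ∈ timeDomain α) :
    0 < t.re := by
  rw [mem_timeDomain_iff hα] at ht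
  have : 0 ≤ α * ‖t‖ ^ 2 := by positivity
  linarith

lemma norm_lt_of_mem_timeDomain {α : ℝ} (hα : 0 < α) {t : ℂ} (ht : t ∈ timeDomain α) :
    ‖t‖ < 1 / α := by
  have h0 : 0 < ‖t‖ := norm_pos_iff.2 (ne_zero_of_mem_timeDomain hα ht)
  rw [mem_timeDomain_iff hα] at ht
  have h1 := Complex.re_le_norm t
  rw [lt_div_iff₀ hα]
  nlinarith

lemma smul_mem_timeDomain {α : ℝ} (hα : 0 < α) {t : ℂ} (ht : t ∈ timeDomain α) {θ : ℝ}
    (h0 : 0 < θ) (h1 : θ ≤ 1) : (θ : ℂ) * t ∈ timeDomain α := by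
  rw [mem_timeDomain_iff hα] at ht ⊢
  rw [norm_mul, Complex.norm_real, Real.norm_of_nonneg h0.le, Complex.re_ofReal_mul]
  have h2 : α * (θ * ‖t‖) ^ 2 = θ * (θ * (α * ‖t‖ ^ 2)) := by ring
  rw [h2]
  refine mul_lt_mul_of_pos_left ?_ h0
  have : 0 ≤ α * ‖t‖ ^ 2 := by positivity
  nlinarith

lemma timeDomain_anti {α α' : ℝ} (h : α ≤ α') : timeDomain α' ⊆ timeDomain α :=
  fun _ ht => lt_of_le_of_lt h ht

/-! ### Integrals depending holomorphically on a parameter -/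

section Holomorphic

variable {E : Type*} [NormedAddCommGroup E] [NormedSpace ℂ E] [CompleteSpace E]

/-- For holomorphic integrands a bound on the functions suffices: Cauchy's estimate on small circles
dominates the derivatives. -/
lemma hasDerivAt_integral_of_holomorphic {X : Type*} [MeasurableSpace X] {ν : Measure X}
    {F : ℂ → X → E} {D : Set ℂ} (hD : IsOpen D) {bound : X → ℝ}
    (hF : ∀ᵐ x ∂ν, DifferentiableOn ℂ (fun t => F t x) D)
    (hm : ∀ t ∈ D, AEStronglyMeasurable (F t) ν)
    (hb : ∀ᵐ x ∂ν, ∀ t ∈ D, ‖F t x‖ ≤ bound x) (hbi : Integrable bound ν) {t : ℂ} (ht : t ∈ D) :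
    HasDerivAt (fun t => ∫ x, F t x ∂ν) (∫ x, deriv (fun t => F t x) t ∂ν) t := by
  obtain ⟨r, hr, hball⟩ := Metric.isOpen_iff.1 hD t ht
  -- Since r/2 + r/3 < r, all circles used in Cauchy's estimate stay in D.
  have hsub : ∀ s ∈ Metric.ball t (r / 2), Metric.closedBall s (r / 3) ⊆ D := by
    intro s hs z hz
    apply hball
    rw [Metric.mem_ball] at hs ⊢
    rw [Metric.mem_closedBall] at hz
    linarith [dist_triangle z s t]
  have hsD : ∀ s ∈ Metric.ball t (r / 2), s ∈ D := fun s hs =>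
    hsub s hs (Metric.mem_closedBall_self (by positivity))
  have hder : ∀ᵐ x ∂ν, ∀ s ∈ Metric.ball t (r / 2),
      HasDerivAt (fun t => F t x) (deriv (fun t => F t x) s) s := by
    filter_upwards [hF] with x hx s hs
    exact ((hx s (hsD s hs)).differentiableAt (hD.mem_nhds (hsD s hs))).hasDerivAt
  refine (hasDerivAt_integral_of_dominated_loc_of_deriv_le
    (bound := fun x => bound x / (r / 3)) (Metric.ball_mem_nhds t (half_pos hr)) ?_ ?_ ?_ ?_ ?_ hder).2
  · filter_upwards [hD.mem_nhds ht] with s hs using hm s hs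
  · exact hbi.mono' (hm t ht) (hb.mono fun x hx => hx t ht)
  · -- the derivative is a limit of difference quotients
    have hseq : Tendsto (fun n : ℕ => t + ((1 / ((n : ℝ) + 1) : ℝ) : ℂ)) atTop (𝓝[≠] t) := by
      refine tendsto_nhdsWithin_iff.2 ⟨?_, Eventually.of_forall fun n => ?_⟩
      · have h1 : Tendsto (fun n : ℕ => ((1 / ((n : ℝ) + 1) : ℝ) : ℂ)) atTop (𝓝 0) := by
          have := (Complex.continuous_ofReal.tendsto 0).comp
            (tendsto_one_div_add_atTop_nhds_zero_nat (𝕜 := ℝ))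
          simpa [Function.comp_def] using! this
        simpa using h1.const_add t
      · simp only [Set.mem_compl_iff, Set.mem_singleton_iff, add_eq_left]
        exact_mod_cast (by positivity : (1 / ((n : ℝ) + 1)) ≠ 0)
    have hev : ∀ᶠ n : ℕ in atTop, t + ((1 / ((n : ℝ) + 1) : ℝ) : ℂ) ∈ D :=
      (tendsto_nhdsWithin_iff.1 hseq).1.eventually (hD.mem_nhds ht)
    obtain ⟨n0, hn0⟩ := eventually_atTop.1 hev
    refine aestronglyMeasurable_of_tendsto_ae atTop
      (f := fun n : ℕ => fun x => slope (fun t => F t x) t (t + ((1 / (((n + n0 : ℕ) : ℝ) + 1) : ℝ) : ℂ)))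
      (fun n => ?_) ?_
    · simp only [slope_def_module]
      exact ((hm _ (hn0 (n + n0) (by omega))).sub (hm t ht)).const_smul _
    · filter_upwards [hder] with x hx
      have := (hasDerivAt_iff_tendsto_slope.1 (hx t (Metric.mem_ball_self (half_pos hr)))).comp
        (hseq.comp (tendsto_add_atTop_nat n0))
      exact this
  · filter_upwards [hF, hb] with x hx hbx s hs
    refine Complex.norm_deriv_le_of_forall_mem_sphere_norm_le (by positivity) ?_ ?_
    · refine DifferentiableOn.diffContOnCl (hx.mono ?_)
      rw [closure_ball _ (by positivity)]
      exact hsub s hs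
    · intro z hz
      exact hbx z (hsub s hs (Metric.sphere_subset_closedBall hz))
  · exact hbi.div_const _

lemma differentiableOn_integral_of_holomorphic {X : Type*} [MeasurableSpace X] {ν : Measure X}
    {F : ℂ → X → E} {D : Set ℂ} (hD : IsOpen D) {bound : X → ℝ}
    (hF : ∀ᵐ x ∂ν, DifferentiableOn ℂ (fun t => F t x) D)
    (hm : ∀ t ∈ D, AEStronglyMeasurable (F t) ν)
    (hb : ∀ᵐ x ∂ν, ∀ t ∈ D, ‖F t x‖ ≤ bound x) (hbi : Integrable bound ν) :
    DifferentiableOn ℂ (fun t => ∫ x, F t x ∂ν) D := fun _ ht =>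
  (hasDerivAt_integral_of_holomorphic hD hF hm hb hbi ht).differentiableAt.differentiableWithinAt

/-! ### Duhamel integrals along rays -/

/-- The ray starts at the boundary point 0, where nothing is known about g beyond its bound. A
primitive P exists on the disc, and the ray integral is shown to differ from P by a constant. -/
lemma hasDerivAt_ray_primitive {α : ℝ} (hα : 0 < α) {g : ℂ → E} {M : ℝ}
    (hg : DifferentiableOn ℂ g (timeDomain α)) (hM : ∀ t ∈ timeDomain α, ‖g t‖ ≤ M) {t : ℂ}
    (ht : t ∈ timeDomain α) :
    HasDerivAt (fun t : ℂ => ∫ θ in (0 : ℝ)..1, t • g (θ * t)) (g t) t := by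
  have hprim : ∃ P : ℂ → E, ∀ s ∈ timeDomain α, HasDerivAt P (g s) s := by
    rw [timeDomain_eq_ball hα] at hg ⊢
    exact hg.isExactOn_ball
  obtain ⟨P, hP⟩ := hprim
  have hconv : Convex ℝ (timeDomain α) := by
    rw [timeDomain_eq_ball hα]; exact convex_ball _ _
  have hLip : ∀ s ∈ timeDomain α, ∀ s' ∈ timeDomain α, ‖P s - P s'‖ ≤ M * ‖s - s'‖ :=
    fun s hs s' hs' => hconv.norm_image_sub_le_of_norm_hasDerivWithin_le
      (fun z hz => (hP z hz).hasDerivWithinAt) hM hs' hs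
  -- the ray integral differs from `P` by a quantity with vanishing increments
  have hray : ∀ s ∈ timeDomain α, ∀ ε : ℝ, 0 < ε → ε ≤ 1 →
      ‖(∫ θ in (0 : ℝ)..1, s • g (θ * s)) - (P s - P (ε * s))‖ ≤ ε * (‖s‖ * M) := by
    intro s hs ε hε hε1
    have hcont : ContinuousOn (fun θ : ℝ => s • g (θ * s)) (Set.Ioc 0 1) := by
      refine continuousOn_const.smul (hg.continuousOn.comp (by fun_prop) fun θ hθ => ?_)
      exact smul_mem_timeDomain hα hs hθ.1 hθ.2
    have hbd : ∀ θ ∈ Set.Ioc (0 : ℝ) 1, ‖s • g (θ * s)‖ ≤ ‖s‖ * M := fun θ hθ => by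
      rw [norm_smul]
      exact mul_le_mul_of_nonneg_left (hM _ (smul_mem_timeDomain hα hs hθ.1 hθ.2)) (norm_nonneg _)
    have hinteg : IntervalIntegrable (fun θ : ℝ => s • g (θ * s)) volume 0 1 := by
      rw [intervalIntegrable_iff_integrableOn_Ioc_of_le zero_le_one]
      refine Integrable.mono' (g := fun _ => ‖s‖ * M) (integrable_const _)
        (hcont.aestronglyMeasurable measurableSet_Ioc) ?_
      filter_upwards [ae_restrict_mem measurableSet_Ioc] with θ hθ using hbd θ hθ
    have hint0 : IntervalIntegrable (fun θ : ℝ => s • g (θ * s)) volume 0 ε :=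
      hinteg.mono_set (by
        rw [Set.uIcc_of_le hε.le, Set.uIcc_of_le zero_le_one]
        exact Set.Icc_subset_Icc le_rfl hε1)
    have hint1 : IntervalIntegrable (fun θ : ℝ => s • g (θ * s)) volume ε 1 :=
      hinteg.mono_set (by
        rw [Set.uIcc_of_le hε1, Set.uIcc_of_le zero_le_one]
        exact Set.Icc_subset_Icc hε.le le_rfl)
    have hftc : ∫ θ in ε..1, s • g (θ * s) = P s - P (ε * s) := by
      have := intervalIntegral.integral_eq_sub_of_hasDerivAt (f := fun θ : ℝ => P (θ * s))
        (f' := fun θ : ℝ => s • g (θ * s)) (a := ε) (b := 1) (fun θ hθ => ?_) hint1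
      · simpa using this
      · rw [Set.uIcc_of_le hε1] at hθ
        have h1 := hP _ (smul_mem_timeDomain hα hs (hε.trans_le hθ.1) hθ.2)
        have h2 : HasDerivAt (fun θ : ℝ => (θ : ℂ) * s) s θ := by
          simpa using (Complex.ofRealCLM.hasDerivAt (x := θ)).mul_const s
        exact h1.scomp θ h2
    rw [← intervalIntegral.integral_add_adjacent_intervals hint0 hint1, hftc, add_sub_cancel_right]
    have := intervalIntegral.norm_integral_le_of_norm_le_const (a := (0 : ℝ)) (b := ε)
      (f := fun θ : ℝ => s • g (θ * s)) (C := ‖s‖ * M) fun θ hθ => by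
        rw [Set.uIoc_of_le hε.le] at hθ
        exact hbd θ ⟨hθ.1, hθ.2.trans hε1⟩
    rw [sub_zero, abs_of_pos hε] at this
    linarith
  -- On the rays cut off at ε, the error consists of two integrals of size O(ε) and of P(εs) -
  -- P(εt). The last is O(ε) because P is Lipschitz.
  have hconst : ∀ s ∈ timeDomain α, (∫ θ in (0 : ℝ)..1, s • g (θ * s)) - P s =
      (∫ θ in (0 : ℝ)..1, t • g (θ * t)) - P t := by
    intro s hs
    have hle : ∀ ε : ℝ, 0 < ε → ε ≤ 1 → ‖((∫ θ in (0 : ℝ)..1, s • g (θ * s)) - P s) -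
        ((∫ θ in (0 : ℝ)..1, t • g (θ * t)) - P t)‖ ≤
        ε * (‖s‖ * M + ‖t‖ * M + M * ‖s - t‖) := by
      intro ε hε hε1
      have h1 := hray s hs ε hε hε1
      have h2 := hray t ht ε hε hε1
      have h3 := hLip _ (smul_mem_timeDomain hα hs hε hε1) _ (smul_mem_timeDomain hα ht hε hε1)
      rw [← mul_sub, norm_mul, Complex.norm_real, Real.norm_of_nonneg hε.le] at h3
      calc _ = ‖((∫ θ in (0 : ℝ)..1, s • g (θ * s)) - (P s - P (ε * s))) -
            ((∫ θ in (0 : ℝ)..1, t • g (θ * t)) - (P t - P (ε * t))) -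
            (P (ε * s) - P (ε * t))‖ := by congr 1; abel
        _ ≤ _ := (norm_sub_le _ _).trans (add_le_add_left (norm_sub_le _ _) _)
        _ ≤ _ := by linarith
    rw [← sub_eq_zero, ← norm_le_zero_iff]
    have hlim : Tendsto (fun ε : ℝ => ε * (‖s‖ * M + ‖t‖ * M + M * ‖s - t‖)) (𝓝[>] 0) (𝓝 0) := by
      have : Tendsto (fun ε : ℝ => ε * (‖s‖ * M + ‖t‖ * M + M * ‖s - t‖)) (𝓝 0)
        (𝓝 (0 * (‖s‖ * M + ‖t‖ * M + M * ‖s - t‖))) := tendsto_id.mul_const _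
      rw [zero_mul] at this
      exact this.mono_left nhdsWithin_le_nhds
    refine ge_of_tendsto hlim ?_
    filter_upwards [Ioc_mem_nhdsGT (zero_lt_one' ℝ)] with ε hε using hle ε hε.1 hε.2
  have hfin : HasDerivAt (fun s => P s + ((∫ θ in (0 : ℝ)..1, t • g (θ * t)) - P t)) (g t) t :=
    (hP t ht).add_const _
  refine hfin.congr_of_eventuallyEq ?_
  filter_upwards [(isOpen_timeDomain hα).mem_nhds ht] with s hs
  rw [← hconst s hs]; abel

/-- The Duhamel integral `∫₀ᵗ e^{-κ(t-s)} G(s) ds` along the ray from `0` to `t`. -/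
def duhamel (κ : ℝ) (G : ℂ → E) (t : ℂ) : E :=
  ∫ θ in (0 : ℝ)..1, (t * Complex.exp (-(κ * t * (1 - θ)))) • G (θ * t)

/-- Factoring e^{-κt} out of the integral leaves the ray primitive of e^{κs} G(s), which is bounded
because the disc is bounded. -/
lemma hasDerivAt_duhamel {α : ℝ} (hα : 0 < α) {G : ℂ → E} {M κ : ℝ}
    (hκ : 0 ≤ κ) (hG : DifferentiableOn ℂ G (timeDomain α)) (hM : ∀ t ∈ timeDomain α, ‖G t‖ ≤ M)
    {t : ℂ} (ht : t ∈ timeDomain α) :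
    HasDerivAt (duhamel κ G) (-(κ : ℂ) • duhamel κ G t + G t) t := by
  have hM0 : 0 ≤ M := (norm_nonneg _).trans (hM t ht)
  have heq : ∀ s : ℂ, duhamel κ G s = Complex.exp (-(κ * s)) •
      ∫ θ in (0 : ℝ)..1, s • (Complex.exp (κ * (θ * s)) • G (θ * s)) := by
    intro s
    rw [← intervalIntegral.integral_smul]
    unfold duhamel
    refine intervalIntegral.integral_congr fun θ _ => ?_
    simp only [smul_smul]
    congr 1
    rw [mul_left_comm, ← Complex.exp_add]
    congr 2
    ring
  have hp := hasDerivAt_ray_primitive hα (g := fun s => Complex.exp (κ * s) • G s)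
    (M := Real.exp (κ * (1 / α)) * M) ?_ ?_ ht
  · have he : HasDerivAt (fun s : ℂ => Complex.exp (-(κ * s)))
        (Complex.exp (-(κ * t)) * -(κ * 1)) t :=
      ((hasDerivAt_id t).const_mul (κ : ℂ)).neg.cexp
    have h := he.smul hp
    refine (h.congr_of_eventuallyEq (Eventually.of_forall fun s => heq s)).congr_deriv ?_
    rw [heq t, smul_smul, smul_smul, ← Complex.exp_add, neg_add_cancel, Complex.exp_zero, one_smul,
      add_comm]
    congr 2
    ring
  · exact DifferentiableOn.smul (by fun_prop) hG
  · intro s hs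
    rw [norm_smul, Complex.norm_exp]
    refine mul_le_mul ?_ (hM s hs) (norm_nonneg _) (Real.exp_pos _).le
    rw [Real.exp_le_exp, Complex.re_ofReal_mul]
    have h1 := Complex.re_le_norm s
    have h2 := norm_lt_of_mem_timeDomain hα hs
    exact mul_le_mul_of_nonneg_left (by linarith) hκ

/-- The integral equals (1 - e^{-y})/y, and 1 - e^{-y} ≤ min(1, y) ≤ √y. -/
lemma integral_exp_le {y : ℝ} (hy : 0 < y) :
    ∫ θ in (0 : ℝ)..1, Real.exp (-(y * (1 - θ))) ≤ 1 / √y := by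
  have h1 : ∫ θ in (0 : ℝ)..1, Real.exp (-(y * (1 - θ))) = (1 - Real.exp (-y)) / y := by
    have := intervalIntegral.integral_eq_sub_of_hasDerivAt (a := (0 : ℝ)) (b := 1)
      (f := fun θ : ℝ => Real.exp (-(y * (1 - θ))) / y)
      (f' := fun θ : ℝ => Real.exp (-(y * (1 - θ)))) (fun θ _ => ?_)
      (Continuous.intervalIntegrable (by fun_prop) _ _)
    · rw [this]; simp; ring
    · have h2 : HasDerivAt (fun θ : ℝ => -(y * (1 - θ))) (-(y * (0 - 1))) θ :=
        (((hasDerivAt_const θ (1 : ℝ)).sub (hasDerivAt_id θ)).const_mul y).neg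
      refine (h2.exp.div_const y).congr_deriv ?_
      field_simp
      ring
  rw [h1, div_le_div_iff₀ hy (Real.sqrt_pos.2 hy), one_mul]
  have hs := Real.sq_sqrt hy.le
  have hsp := Real.sqrt_pos.2 hy
  have h2 : 1 - Real.exp (-y) ≤ 1 := by linarith [Real.exp_pos (-y)]
  have h3 : 1 - Real.exp (-y) ≤ y := by linarith [Real.add_one_le_exp (-y)]
  rcases le_total (√y) 1 with h | h
  · nlinarith
  · nlinarith

/-- This is where the heat semigroup recovers the derivative lost in the quadratic term. With κ =
|k|, the integrated exponential is at most 1/(κ√(Re t)), and |t|/√(Re t) ≤ 1/√α on the disc. The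
part without the factor κ gains |t| ≤ 1/α. -/
lemma norm_duhamel_le {α : ℝ} (hα : 0 < α) {G : ℂ → E} {κ M₀ M₁ : ℝ} (hκ : 0 ≤ κ)
    (hM₀ : 0 ≤ M₀) (hM₁ : 0 ≤ M₁) (hM : ∀ t ∈ timeDomain α, ‖G t‖ ≤ M₀ + κ * M₁) {t : ℂ}
    (ht : t ∈ timeDomain α) : ‖duhamel (κ ^ 2) G t‖ ≤ M₀ / α + M₁ / √α := by
  have hre := re_pos_of_mem_timeDomain hα ht
  have h1 : ‖duhamel (κ ^ 2) G t‖ ≤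
      ∫ θ in (0 : ℝ)..1, ‖t‖ * Real.exp (-(κ ^ 2 * t.re * (1 - θ))) * (M₀ + κ * M₁) := by
    refine intervalIntegral.norm_integral_le_of_norm_le zero_le_one ?_
      (Continuous.intervalIntegrable (by fun_prop) _ _)
    refine Eventually.of_forall fun θ hθ => ?_
    rw [norm_smul, norm_mul, Complex.norm_exp]
    have e : (-(((κ ^ 2 : ℝ) : ℂ) * t * (1 - (θ : ℂ)))).re = -(κ ^ 2 * t.re * (1 - θ)) := by
      rw [Complex.neg_re, mul_assoc, Complex.re_ofReal_mul,
        show (1 - (θ : ℂ)) = ((1 - θ : ℝ) : ℂ) by push_cast; ring, Complex.re_mul_ofReal]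
      ring
    rw [e]
    exact mul_le_mul_of_nonneg_left (hM _ (smul_mem_timeDomain hα ht hθ.1 hθ.2)) (by positivity)
  rw [intervalIntegral.integral_mul_const, intervalIntegral.integral_const_mul] at h1
  set J := ∫ θ in (0 : ℝ)..1, Real.exp (-(κ ^ 2 * t.re * (1 - θ))) with hJ
  have hJ0 : 0 ≤ J := intervalIntegral.integral_nonneg zero_le_one fun θ _ => (Real.exp_pos _).le
  have hJ1 : J ≤ 1 := by
    have h2 : J ≤ ∫ θ in (0 : ℝ)..1, (1 : ℝ) := by
      refine intervalIntegral.integral_mono_on zero_le_one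
        (Continuous.intervalIntegrable (by fun_prop) _ _)
        (Continuous.intervalIntegrable (by fun_prop) _ _) fun θ hθ => ?_
      rw [Real.exp_le_one_iff]
      have : 0 ≤ κ ^ 2 * t.re * (1 - θ) :=
        mul_nonneg (by positivity) (by linarith [hθ.2])
      linarith
    simpa using h2
  have hA : ‖t‖ * J * M₀ ≤ M₀ / α := by
    have := (norm_lt_of_mem_timeDomain hα ht).le
    calc ‖t‖ * J * M₀ ≤ (1 / α) * 1 * M₀ := by gcongr
      _ = M₀ / α := by ring
  have hB : ‖t‖ * J * (κ * M₁) ≤ M₁ / √α := by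
    rcases hκ.eq_or_lt with h | h
    · rw [← h]; simp only [zero_mul, mul_zero]; positivity
    · have hy : 0 < κ ^ 2 * t.re := by positivity
      have h2 : J ≤ 1 / √(κ ^ 2 * t.re) := integral_exp_le hy
      rw [Real.sqrt_mul (by positivity), Real.sqrt_sq hκ] at h2
      have h3 : ‖t‖ / √t.re ≤ 1 / √α := by
        rw [div_le_div_iff₀ (Real.sqrt_pos.2 hre) (Real.sqrt_pos.2 hα), one_mul]
        refine Real.le_sqrt_of_sq_le ?_
        rw [mul_pow, Real.sq_sqrt hα.le]
        have := (mem_timeDomain_iff hα).1 ht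
        linarith
      have hs := Real.sqrt_pos.2 hre
      calc ‖t‖ * J * (κ * M₁) ≤ ‖t‖ * (1 / (κ * √t.re)) * (κ * M₁) := by gcongr
        _ = (‖t‖ / √t.re) * M₁ := by field_simp
        _ ≤ (1 / √α) * M₁ := by gcongr
        _ = M₁ / √α := by ring
  calc _ ≤ _ := h1
    _ = ‖t‖ * J * M₀ + ‖t‖ * J * (κ * M₁) := by ring
    _ ≤ _ := add_le_add hA hB

end Holomorphic

/-! ### The Picard iteration in Fourier space -/

/-- The Fourier side `f̂ - i k_j P_k[g_j * g]` of the forcing and quadratic terms. -/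
def nonlin (fh g : R3 → C3) (k : R3) : C3 := fh k - bil g g k

open Classical in
/-- One step of the Picard iteration for the mild formulation. -/
def picardStep (α : ℝ) (a fh : R3 → C3) (V : ℂ → R3 → C3) (t : ℂ) (k : R3) : C3 :=
  if t ∈ timeDomain α then
    Complex.exp (-(((‖k‖ ^ 2 : ℝ) : ℂ) * t)) • a k
      + duhamel (‖k‖ ^ 2) (fun s => nonlin fh (V s) k) t
  else 0

/-- Fields of Fourier coefficients on the time domain, holomorphic in time and bounded by `R`. -/
structure TimeField (μ β α R : ℝ) (V : ℂ → R3 → C3) : Prop where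
  meas : StronglyMeasurable (Function.uncurry V)
  bound : ∀ t k, ‖V t k‖ ≤ R * wt μ β k
  holo : ∀ k, DifferentiableOn ℂ (fun t => V t k) (timeDomain α)

/-- Measurable Fourier data `a` with `‖a‖_{μ,β} ≤ n`. -/
structure Datum (μ β n : ℝ) (a : R3 → C3) : Prop where
  meas : StronglyMeasurable a
  bound : ∀ k, ‖a k‖ ≤ n * wt μ β k

section Picard

variable {μ β α R n₀ nf : ℝ} {a fh : R3 → C3} {V W : ℂ → R3 → C3}

lemma TimeField.meas_at (hV : TimeField μ β α R V) (t : ℂ) : StronglyMeasurable (V t) :=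
  hV.meas.comp_measurable (g := fun k : R3 => (t, k)) (by fun_prop)

lemma TimeField.nonneg (hV : TimeField μ β α R V) : 0 ≤ R := by
  have := (norm_nonneg _).trans (hV.bound 0 0)
  exact nonneg_of_mul_nonneg_left this (wt_pos _ _ _)

lemma Datum.nonneg (ha : Datum μ β n₀ a) : 0 ≤ n₀ := by
  have := (norm_nonneg _).trans (ha.bound 0)
  exact nonneg_of_mul_nonneg_left this (wt_pos _ _ _)

lemma TimeField.tame (hμ : 3 < μ) (hβ : 0 < β) (hV : TimeField μ β α R V) (t : ℂ) : Tame (V t) :=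
  tame_of_wt hμ hβ.le (hV.meas_at t) (hV.bound t)

lemma TimeField.norm_bil_le (hμ : 3 < μ) (hβ : 0 < β) (hV : TimeField μ β α R V) (t : ℂ) (k : R3) :
    ‖bil (V t) (V t) k‖ ≤ ‖k‖ * (R * R * convConst μ * wt μ β k) :=
  NSBorel.norm_bil_le hμ hβ.le (hV.meas_at t) (hV.meas_at t) hV.nonneg hV.nonneg (hV.bound t)
    (hV.bound t) k

lemma TimeField.norm_nonlin_le (hμ : 3 < μ) (hβ : 0 < β) (hV : TimeField μ β α R V)
    (hf : Datum μ β nf fh) (t : ℂ) (k : R3) :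
    ‖nonlin fh (V t) k‖ ≤ nf * wt μ β k + ‖k‖ * (R * R * convConst μ * wt μ β k) :=
  (norm_sub_le _ _).trans (add_le_add (hf.bound k) (hV.norm_bil_le hμ hβ t k))

lemma TimeField.differentiableOn_fconv (hμ : 3 < μ) (hβ : 0 < β) (hα : 0 < α)
    (hV : TimeField μ β α R V) (j : Fin 3) (k : R3) :
    DifferentiableOn ℂ (fun s => fconv j (V s) (V s) k) (timeDomain α) := by
  have hR := hV.nonneg
  refine differentiableOn_integral_of_holomorphic (isOpen_timeDomain hα)
    (bound := fun k' => (R * 1) * (R * wt μ β (k - k'))) ?_ ?_ ?_ ?_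
  · refine Eventually.of_forall fun k' => DifferentiableOn.fun_smul ?_ (hV.holo _)
    exact (EuclideanSpace.proj (𝕜 := ℂ) j).differentiable.comp_differentiableOn (hV.holo k')
  · intro t _
    exact ((hV.tame hμ hβ t).integrable_conv (hV.tame hμ hβ t) j k).aestronglyMeasurable
  · refine Eventually.of_forall fun k' t _ => ?_
    rw [norm_smul]
    refine mul_le_mul ?_ (hV.bound t _) (norm_nonneg _) (by positivity)
    refine ((PiLp.norm_apply_le (V t k') j).trans (hV.bound t k')).trans ?_
    exact mul_le_mul_of_nonneg_left (wt_le_one (by linarith) hβ.le k') hR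
  · exact (((integrable_wt hμ hβ.le).comp_sub_left k).const_mul R).const_mul _

lemma TimeField.differentiableOn_bil (hμ : 3 < μ) (hβ : 0 < β) (hα : 0 < α)
    (hV : TimeField μ β α R V) (k : R3) :
    DifferentiableOn ℂ (fun s => bil (V s) (V s) k) (timeDomain α) := by
  unfold bil
  refine DifferentiableOn.fun_sum fun j _ => DifferentiableOn.fun_const_smul ?_ _
  exact (LinearMap.toContinuousLinearMap (hodgeLin k)).differentiable.comp_differentiableOn
    (hV.differentiableOn_fconv hμ hβ hα j k)

lemma TimeField.differentiableOn_nonlin (hμ : 3 < μ) (hβ : 0 < β) (hα : 0 < α)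
    (hV : TimeField μ β α R V) (k : R3) :
    DifferentiableOn ℂ (fun s => nonlin fh (V s) k) (timeDomain α) :=
  (differentiableOn_const _).sub (hV.differentiableOn_bil hμ hβ hα k)

lemma TimeField.norm_duhamel_nonlin_le (hμ : 3 < μ) (hβ : 0 < β) (hα : 0 < α)
    (hV : TimeField μ β α R V) (hf : Datum μ β nf fh) {t : ℂ} (ht : t ∈ timeDomain α) (k : R3) :
    ‖duhamel (‖k‖ ^ 2) (fun s => nonlin fh (V s) k) t‖ ≤
      (nf / α + R * R * convConst μ / √α) * wt μ β k := by
  have hw := (wt_pos μ β k).le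
  have h := norm_duhamel_le hα (G := fun s => nonlin fh (V s) k) (norm_nonneg k)
    (mul_nonneg hf.nonneg hw) (mul_nonneg (mul_nonneg (mul_nonneg hV.nonneg hV.nonneg)
      (convConst_nonneg μ)) hw) (fun s _ => hV.norm_nonlin_le hμ hβ hf s k) ht
  refine h.trans (le_of_eq ?_)
  ring

/-- The Picard map preserves the ball of radius R. The value 0 outside the time domain keeps the
bounds and joint measurability valid for all t. -/
lemma TimeField.picardStep (hμ : 3 < μ) (hβ : 0 < β) (hα : 0 < α)
    (hV : TimeField μ β α R V) (ha : Datum μ β n₀ a) (hf : Datum μ β nf fh)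
    (hR : n₀ + (nf / α + R * R * convConst μ / √α) ≤ R) :
    TimeField μ β α R (picardStep α a fh V) where
  meas := by
    have hset : MeasurableSet {z : ℂ × R3 | z.1 ∈ timeDomain α} :=
      (isOpen_timeDomain hα).measurableSet.preimage measurable_fst
    have hnl : Measurable fun z : ℂ × R3 => nonlin fh (V z.1) z.2 :=
      (hf.meas.measurable.comp measurable_snd).sub
        (stronglyMeasurable_bil_param hV.meas hV.meas).measurable
    have hinteg : StronglyMeasurable fun z : ℂ × R3 =>
        duhamel (‖z.2‖ ^ 2) (fun s => nonlin fh (V s) z.2) z.1 := by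
      unfold duhamel
      simp only [intervalIntegral.integral_of_le zero_le_one]
      refine StronglyMeasurable.integral_prod_right'
        (f := fun y : (ℂ × R3) × ℝ => (y.1.1 * Complex.exp
          (-(((‖y.1.2‖ ^ 2 : ℝ) : ℂ) * y.1.1 * (1 - (y.2 : ℂ))))) • nonlin fh (V (y.2 * y.1.1)) y.1.2) ?_
      have h1 : Measurable fun y : (ℂ × R3) × ℝ => nonlin fh (V (y.2 * y.1.1)) y.1.2 :=
        hnl.comp (f := fun y : (ℂ × R3) × ℝ => ((y.2 : ℂ) * y.1.1, y.1.2)) (by fun_prop)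
      exact Measurable.stronglyMeasurable (by fun_prop)
    have ham := ha.meas.measurable
    have hsum : Measurable fun z : ℂ × R3 =>
        Complex.exp (-(((‖z.2‖ ^ 2 : ℝ) : ℂ) * z.1)) • a z.2
          + duhamel (‖z.2‖ ^ 2) (fun s => nonlin fh (V s) z.2) z.1 := by
      have := hinteg.measurable
      fun_prop
    classical
    exact (Measurable.ite hset hsum measurable_const).stronglyMeasurable
  bound := by
    intro t k
    have hw := (wt_pos μ β k).le
    unfold NSBorel.picardStep
    split_ifs with ht
    · have h1 : ‖Complex.exp (-(((‖k‖ ^ 2 : ℝ) : ℂ) * t)) • a k‖ ≤ n₀ * wt μ β k := by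
        rw [norm_smul, Complex.norm_exp, Complex.neg_re, Complex.re_ofReal_mul]
        have h2 : Real.exp (-(‖k‖ ^ 2 * t.re)) ≤ 1 := by
          rw [Real.exp_le_one_iff]
          have : 0 ≤ ‖k‖ ^ 2 * t.re :=
            mul_nonneg (by positivity) (re_pos_of_mem_timeDomain hα ht).le
          linarith
        exact (mul_le_of_le_one_left (norm_nonneg _) h2).trans (ha.bound k)
      have h3 := hV.norm_duhamel_nonlin_le hμ hβ hα hf ht k
      calc _ ≤ _ := norm_add_le _ _
        _ ≤ _ := add_le_add h1 h3
        _ = (n₀ + (nf / α + R * R * convConst μ / √α)) * wt μ β k := by ring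
        _ ≤ _ := by gcongr
    · rw [norm_zero]
      exact mul_nonneg hV.nonneg hw
  holo := by
    intro k
    have hd : DifferentiableOn ℂ (fun t : ℂ => Complex.exp (-(((‖k‖ ^ 2 : ℝ) : ℂ) * t)) • a k
        + duhamel (‖k‖ ^ 2) (fun s => nonlin fh (V s) k) t) (timeDomain α) := by
      refine DifferentiableOn.add (by fun_prop) fun t ht => ?_
      exact (hasDerivAt_duhamel hα (sq_nonneg _) (hV.differentiableOn_nonlin hμ hβ hα k)
        (fun s _ => hV.norm_nonlin_le hμ hβ hf s k) ht).differentiableAt.differentiableWithinAt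
    refine hd.congr fun t ht => ?_
    simp only [NSBorel.picardStep, if_pos ht]

/-- The linear part and the forcing cancel. The two bilinear terms left by `bil_self_sub` each carry
one factor |k|, which Duhamel turns into 1/√α. -/
lemma norm_picardStep_sub_le (hμ : 3 < μ) (hβ : 0 < β) (hα : 0 < α)
    (hV : TimeField μ β α R V) (hW : TimeField μ β α R W) (hf : Datum μ β nf fh) {d : ℝ}
    (hd : ∀ t k, ‖V t k - W t k‖ ≤ d * wt μ β k) (t : ℂ) (k : R3) :
    ‖picardStep α a fh V t k - picardStep α a fh W t k‖ ≤
      2 * R * convConst μ / √α * d * wt μ β k := by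
  have hw := (wt_pos μ β k).le
  have hd0 : 0 ≤ d := nonneg_of_mul_nonneg_left ((norm_nonneg _).trans (hd 0 0)) (wt_pos _ _ _)
  have hR := hV.nonneg
  have hC := convConst_nonneg μ
  unfold picardStep
  split_ifs with ht
  · rw [add_sub_add_left_eq_sub]
    have hinteg : ∀ {V : ℂ → R3 → C3}, TimeField μ β α R V → IntervalIntegrable
        (fun θ : ℝ => (t * Complex.exp (-(((‖k‖ ^ 2 : ℝ) : ℂ) * t * (1 - (θ : ℂ))))) •
          nonlin fh (V (θ * t)) k) volume 0 1 := by
      intro V hV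
      rw [intervalIntegrable_iff_integrableOn_Ioc_of_le zero_le_one]
      have hcont : ContinuousOn (fun θ : ℝ => nonlin fh (V (θ * t)) k) (Set.Ioc 0 1) := by
        refine (hV.differentiableOn_nonlin (fh := fh) hμ hβ hα k).continuousOn.comp
          (f := fun θ : ℝ => (θ : ℂ) * t) (by fun_prop) fun θ hθ => ?_
        exact smul_mem_timeDomain hα ht hθ.1 hθ.2
      have hbdd : IntegrableOn (fun θ : ℝ => nonlin fh (V (θ * t)) k) (Set.Ioc 0 1) := by
        refine Integrable.mono' (g := fun _ => nf * wt μ β k +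
          ‖k‖ * (R * R * convConst μ * wt μ β k)) (integrable_const _)
          (hcont.aestronglyMeasurable measurableSet_Ioc)
          (Eventually.of_forall fun θ => hV.norm_nonlin_le hμ hβ hf _ k)
      refine IntegrableOn.continuousOn_smul_of_subset ?_ hbdd isCompact_Icc measurableSet_Ioc
        Set.Ioc_subset_Icc_self
      fun_prop
    have heq : duhamel (‖k‖ ^ 2) (fun s => nonlin fh (V s) k) t -
        duhamel (‖k‖ ^ 2) (fun s => nonlin fh (W s) k) t =
        duhamel (‖k‖ ^ 2) (fun s => nonlin fh (V s) k - nonlin fh (W s) k) t := by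
      unfold duhamel
      rw [← intervalIntegral.integral_sub (hinteg hV) (hinteg hW)]
      simp only [smul_sub]
    rw [heq]
    have hdiff : ∀ s ∈ timeDomain α, ‖nonlin fh (V s) k - nonlin fh (W s) k‖ ≤
        0 + ‖k‖ * (2 * R * d * convConst μ * wt μ β k) := by
      intro s _
      have e : nonlin fh (V s) k - nonlin fh (W s) k =
          -(bil (V s - W s) (V s) k + bil (W s) (V s - W s) k) := by
        rw [← bil_self_sub (hV.tame hμ hβ s) (hW.tame hμ hβ s)]
        simp only [nonlin]
        abel
      have hm : StronglyMeasurable (V s - W s) := (hV.meas_at s).sub (hW.meas_at s)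
      have h1 := norm_bil_le hμ hβ.le hm (hV.meas_at s) hd0 hR (hd s) (hV.bound s) k
      have h2 := norm_bil_le hμ hβ.le (hW.meas_at s) hm hR hd0 (hW.bound s) (hd s) k
      rw [e, norm_neg]
      calc _ ≤ _ := norm_add_le _ _
        _ ≤ _ := add_le_add h1 h2
        _ = _ := by ring
    refine (norm_duhamel_le hα (norm_nonneg k) le_rfl (by positivity) hdiff ht).trans
      (le_of_eq ?_)
    ring
  · rw [sub_zero, norm_zero]
    positivity

/-- The Picard iterates. -/
def picard (α : ℝ) (a fh : R3 → C3) : ℕ → ℂ → R3 → C3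
  | 0 => fun _ _ => 0
  | n + 1 => picardStep α a fh (picard α a fh n)

/-- The iterates converge pointwise at a geometric rate proportional to the weight. For fixed k this
is uniform in t, so holomorphy passes to the limit, and the contraction estimate identifies the
limit as a fixed point. -/
lemma exists_fixedPoint (hμ : 3 < μ) (hβ : 0 < β) (hα : 0 < α) (hR0 : 0 ≤ R)
    (ha : Datum μ β n₀ a) (hf : Datum μ β nf fh)
    (hR : n₀ + (nf / α + R * R * convConst μ / √α) ≤ R)
    (hR2 : 2 * R * convConst μ / √α ≤ 1 / 2) :
    ∃ V, TimeField μ β α R V ∧ picardStep α a fh V = V := by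
  have hT : ∀ n, TimeField μ β α R (picard α a fh n) := by
    intro n
    induction n with
    | zero =>
      refine ⟨stronglyMeasurable_const, fun t k => ?_, fun k => differentiableOn_const _⟩
      simp only [picard, norm_zero]
      exact mul_nonneg hR0 (wt_pos _ _ _).le
    | succ n ih => exact ih.picardStep hμ hβ hα ha hf hR
  have hstep : ∀ n, ∀ t k, ‖picard α a fh n t k - picard α a fh (n + 1) t k‖ ≤
      R * (1 / 2) ^ n * wt μ β k := by
    intro n
    induction n with
    | zero =>
      intro t k
      have := (hT 1).bound t k
      simpa [picard] using this
    | succ n ih =>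
      intro t k
      refine (norm_picardStep_sub_le hμ hβ hα (hT n) (hT (n + 1)) hf ih t k).trans ?_
      have hw := (wt_pos μ β k).le
      calc 2 * R * convConst μ / √α * (R * (1 / 2) ^ n) * wt μ β k
          ≤ 1 / 2 * (R * (1 / 2) ^ n) * wt μ β k := by gcongr
        _ = _ := by ring
  have hdist : ∀ t k n, dist (picard α a fh n t k) (picard α a fh (n + 1) t k) ≤
      (R * wt μ β k) * (1 / 2) ^ n := by
    intro t k n
    rw [dist_eq_norm]
    exact (hstep n t k).trans (le_of_eq (by ring))
  have hcau : ∀ t k, CauchySeq fun n => picard α a fh n t k := fun t k =>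
    cauchySeq_of_le_geometric (1 / 2) (R * wt μ β k) (by norm_num) (hdist t k)
  choose V hV using fun t k => cauchySeq_tendsto_of_complete (hcau t k)
  have hrate : ∀ n t k, ‖picard α a fh n t k - V t k‖ ≤ (2 * R * (1 / 2) ^ n) * wt μ β k := by
    intro n t k
    have := dist_le_of_le_geometric_of_tendsto (1 / 2) (R * wt μ β k) (by norm_num)
      (hdist t k) (hV t k) n
    rw [dist_eq_norm] at this
    refine this.trans (le_of_eq ?_)
    ring
  have hlim0 : Tendsto (fun n : ℕ => 2 * R * (1 / 2 : ℝ) ^ n) atTop (𝓝 0) := by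
    have := (tendsto_pow_atTop_nhds_zero_of_lt_one (r := (1 / 2 : ℝ)) (by norm_num)
      (by norm_num)).const_mul (2 * R)
    simpa using this
  have hVT : TimeField μ β α R V := by
    refine ⟨?_, fun t k => ?_, fun k => ?_⟩
    · refine stronglyMeasurable_of_tendsto atTop (fun n => (hT n).meas) ?_
      rw [tendsto_pi_nhds]
      exact fun z => hV z.1 z.2
    · exact le_of_tendsto (hV t k).norm (Eventually.of_forall fun n => (hT n).bound t k)
    · have hunif : TendstoUniformlyOn (fun n t => picard α a fh n t k) (fun t => V t k) atTop
          (timeDomain α) := by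
        rw [Metric.tendstoUniformlyOn_iff]
        intro ε hε
        have h1 : Tendsto (fun n : ℕ => 2 * R * (1 / 2 : ℝ) ^ n * wt μ β k) atTop (𝓝 0) := by
          simpa using hlim0.mul_const (wt μ β k)
        filter_upwards [h1.eventually (gt_mem_nhds hε)] with n hn t _
        rw [dist_comm, dist_eq_norm]
        exact (hrate n t k).trans_lt hn
      exact hunif.tendstoLocallyUniformlyOn.differentiableOn
        (Eventually.of_forall fun n => (hT n).holo k) (isOpen_timeDomain hα)
  refine ⟨V, hVT, ?_⟩
  ext1 t
  ext1 k
  have h1 : Tendsto (fun n => picard α a fh (n + 1) t k) atTop (𝓝 (picardStep α a fh V t k)) := by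
    rw [tendsto_iff_norm_sub_tendsto_zero]
    refine squeeze_zero (fun n => norm_nonneg _) (fun n =>
      norm_picardStep_sub_le hμ hβ hα (hT n) hVT hf (hrate n) t k) ?_
    have := (hlim0.const_mul (2 * R * convConst μ / √α)).mul_const (wt μ β k)
    simpa using this
  exact tendsto_nhds_unique h1 ((hV t k).comp (tendsto_add_atTop_nat 1))

/-- The radius `R = n₀ + 1` works for all large `α`. -/
lemma exists_radius (μ n₀ nf : ℝ) : ∃ α : ℝ, 0 < α ∧
    n₀ + (nf / α + (n₀ + 1) * (n₀ + 1) * convConst μ / √α) ≤ n₀ + 1 ∧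
    2 * (n₀ + 1) * convConst μ / √α ≤ 1 / 2 := by
  have hC := convConst_nonneg μ
  have h1 : Tendsto (fun α : ℝ => nf / α + (n₀ + 1) * (n₀ + 1) * convConst μ / √α) atTop (𝓝 0) := by
    have := (tendsto_const_nhds (x := nf)).div_atTop tendsto_id |>.add
      ((tendsto_const_nhds (x := (n₀ + 1) * (n₀ + 1) * convConst μ)).div_atTop
        Real.tendsto_sqrt_atTop)
    simpa using this
  have h2 : Tendsto (fun α : ℝ => 2 * (n₀ + 1) * convConst μ / √α) atTop (𝓝 0) :=
    (tendsto_const_nhds (x := 2 * (n₀ + 1) * convConst μ)).div_atTop Real.tendsto_sqrt_atTop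
  obtain ⟨α, h3, h4, h5⟩ := ((h1.eventually (ge_mem_nhds one_pos)).and
    ((h2.eventually (ge_mem_nhds (show (0 : ℝ) < 1 / 2 by norm_num))).and
      (eventually_gt_atTop 0))).exists
  exact ⟨α, h5, by linarith, h4⟩

end Picard

/-- A solution in Fourier space: the data of the Navier-Stokes flow on the time domain. -/
structure FourierFlow (μ β α R : ℝ) (a fh : R3 → C3) (V : ℂ → R3 → C3) : Prop
    extends TimeField μ β α R V where
  deriv : ∀ k, ∀ t ∈ timeDomain α, HasDerivAt (fun t => V t k)
    (-((‖k‖ ^ 2 : ℝ) : ℂ) • V t k + nonlin fh (V t) k) t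
  initial : ∀ k, Tendsto (fun t => V t k) (𝓝[timeDomain α] 0) (𝓝 (a k))
  sol : (∀ k, kdot k (a k) = 0) → (∀ k, kdot k (fh k) = 0) → ∀ t k, kdot k (V t k) = 0

lemma kdot_integral (k : R3) {X : Type*} [MeasurableSpace X] {ν : Measure X} {F : X → C3}
    (hF : ∀ x, kdot k (F x) = 0) : kdot k (∫ x, F x ∂ν) = 0 := by
  by_cases hi : Integrable F ν
  · rw [← inner_toC3]
    have := (innerSL ℂ (toC3 k)).integral_comp_comm hi
    simp only [innerSL_apply_apply, inner_toC3, hF, integral_zero] at this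
    rw [inner_toC3]
    exact this.symm
  · rw [integral_undef hi]; simp [kdot]

/-- The equation and the initial value are read off from the fixed-point identity. The flow stays
solenoidal because the heat term, the forcing and the projected quadratic term all are. -/
theorem exists_fourierFlow {μ β n₀ nf : ℝ} (hμ : 3 < μ) (hβ : 0 < β) {a fh : R3 → C3}
    (ha : Datum μ β n₀ a) (hf : Datum μ β nf fh) :
    ∃ α : ℝ, 0 < α ∧ ∃ V, FourierFlow μ β α (n₀ + 1) a fh V := by
  obtain ⟨α, hα, h1, h2⟩ := exists_radius μ n₀ nf
  obtain ⟨V, hV, hfix⟩ := exists_fixedPoint hμ hβ hα (by linarith [ha.nonneg]) ha hf h1 h2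
  have hval : ∀ t ∈ timeDomain α, ∀ k, V t k = Complex.exp (-(((‖k‖ ^ 2 : ℝ) : ℂ) * t)) • a k
      + duhamel (‖k‖ ^ 2) (fun s => nonlin fh (V s) k) t := by
    intro t ht k
    conv_lhs => rw [← hfix]
    simp only [picardStep, if_pos ht]
  refine ⟨α, hα, V, hV, ?_, ?_, ?_⟩
  · intro k t ht
    have hd := hasDerivAt_duhamel hα (sq_nonneg ‖k‖)
      (hV.differentiableOn_nonlin (fh := fh) hμ hβ hα k)
      (fun s _ => hV.norm_nonlin_le hμ hβ hf s k) ht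
    have he : HasDerivAt (fun s : ℂ => Complex.exp (-(((‖k‖ ^ 2 : ℝ) : ℂ) * s)) • a k)
        ((Complex.exp (-(((‖k‖ ^ 2 : ℝ) : ℂ) * t)) * -(((‖k‖ ^ 2 : ℝ) : ℂ) * 1)) • a k) t :=
      (((hasDerivAt_id t).const_mul (((‖k‖ ^ 2 : ℝ) : ℂ))).neg.cexp).smul_const _
    refine ((he.add hd).congr_of_eventuallyEq ?_).congr_deriv ?_
    · filter_upwards [(isOpen_timeDomain hα).mem_nhds ht] with s hs using hval s hs k
    · rw [hval t ht k, smul_add, smul_smul, ← add_assoc]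
      congr 3
      ring
  · intro k
    have hb : ∀ t ∈ timeDomain α, ‖V t k - Complex.exp (-(((‖k‖ ^ 2 : ℝ) : ℂ) * t)) • a k‖ ≤
        ‖t‖ * (nf * wt μ β k + ‖k‖ * ((n₀ + 1) * (n₀ + 1) * convConst μ * wt μ β k)) := by
      intro t ht
      rw [hval t ht k, add_sub_cancel_left]
      have := intervalIntegral.norm_integral_le_of_norm_le_const (a := (0 : ℝ)) (b := 1)
        (f := fun θ : ℝ => (t * Complex.exp (-(((‖k‖ ^ 2 : ℝ) : ℂ) * t * (1 - (θ : ℂ))))) •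
          nonlin fh (V (θ * t)) k)
        (C := ‖t‖ * (nf * wt μ β k + ‖k‖ * ((n₀ + 1) * (n₀ + 1) * convConst μ * wt μ β k)))
        fun θ hθ => by
          rw [Set.uIoc_of_le zero_le_one] at hθ
          rw [norm_smul, norm_mul, Complex.norm_exp]
          have e : (-(((‖k‖ ^ 2 : ℝ) : ℂ) * t * (1 - (θ : ℂ)))).re ≤ 0 := by
            rw [Complex.neg_re, mul_assoc, Complex.re_ofReal_mul,
              show (1 - (θ : ℂ)) = ((1 - θ : ℝ) : ℂ) by push_cast; ring, Complex.re_mul_ofReal]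
            have : 0 ≤ ‖k‖ ^ 2 * (t.re * (1 - θ)) := mul_nonneg (by positivity)
              (mul_nonneg (re_pos_of_mem_timeDomain hα ht).le (by linarith [hθ.2]))
            linarith
          exact mul_le_mul (mul_le_of_le_one_right (norm_nonneg _) (Real.exp_le_one_iff.2 e))
            (hV.norm_nonlin_le hμ hβ hf _ k) (norm_nonneg _) (norm_nonneg _)
      simpa [duhamel] using this
    have hz : Tendsto (fun t : ℂ => V t k - Complex.exp (-(((‖k‖ ^ 2 : ℝ) : ℂ) * t)) • a k)
        (𝓝[timeDomain α] 0) (𝓝 0) := by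
      refine squeeze_zero_norm' (eventually_mem_nhdsWithin.mono hb) ?_
      have : Continuous fun t : ℂ => ‖t‖ * (nf * wt μ β k +
          ‖k‖ * ((n₀ + 1) * (n₀ + 1) * convConst μ * wt μ β k)) := by fun_prop
      have h3 := this.tendsto 0
      rw [norm_zero, zero_mul] at h3
      exact h3.mono_left nhdsWithin_le_nhds
    have he : Tendsto (fun t : ℂ => Complex.exp (-(((‖k‖ ^ 2 : ℝ) : ℂ) * t)) • a k)
        (𝓝[timeDomain α] 0) (𝓝 (a k)) := by
      have : Continuous fun t : ℂ => Complex.exp (-(((‖k‖ ^ 2 : ℝ) : ℂ) * t)) • a k := by fun_prop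
      have h3 := this.tendsto 0
      simp only [mul_zero, neg_zero, Complex.exp_zero, one_smul] at h3
      exact h3.mono_left nhdsWithin_le_nhds
    simpa using hz.add he
  · intro hak hfk t k
    by_cases ht : t ∈ timeDomain α
    · rw [hval t ht k, kdot_add, kdot_smul, hak, mul_zero, zero_add]
      unfold duhamel
      rw [intervalIntegral.integral_of_le zero_le_one]
      refine kdot_integral k fun θ => ?_
      have e : nonlin fh (V (θ * t)) k = fh k + -bil (V (θ * t)) (V (θ * t)) k := sub_eq_add_neg _ _
      rw [kdot_smul]
      beta_reduce
      rw [e, kdot_add, hfk, ← neg_one_smul ℂ (bil _ _ k), kdot_smul,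
        kdot_bil]
      simp
    · rw [← hfix]
      simp [picardStep, if_neg ht, kdot]

/-! ### The Navier-Stokes equation in physical space -/

lemma Datum.tame {μ β n : ℝ} (hμ : 3 < μ) (hβ : 0 < β) {g : R3 → C3} (hg : Datum μ β n g) :
    Tame g := tame_of_wt hμ hβ.le hg.meas hg.bound

lemma Datum.integrable_pow_mul {μ β n : ℝ} (hμ : 3 < μ) (hβ : 0 < β) {g : R3 → C3}
    (hg : Datum μ β n g) (m : ℕ) : Integrable fun k => ‖k‖ ^ m * ‖g k‖ :=
  integrable_pow_mul_of_wt hμ hβ hg.meas.aestronglyMeasurable hg.bound m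

lemma Datum.integrable_norm_mul {μ β n : ℝ} (hμ : 3 < μ) (hβ : 0 < β) {g : R3 → C3}
    (hg : Datum μ β n g) : Integrable fun k => ‖k‖ * ‖g k‖ := by
  simpa using hg.integrable_pow_mul hμ hβ 1

lemma Datum.tame_deriv {μ β n : ℝ} (hμ : 3 < μ) (hβ : 0 < β) {g : R3 → C3}
    (hg : Datum μ β n g) (j : Fin 3) : Tame fun k => (Complex.I * (k j : ℂ)) • g k := by
  have hm := hg.meas.measurable
  have hn := hg.nonneg
  refine tame_of_wt (b := β / 2) (A := n * (1 / (β - β / 2))) hμ (by positivity)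
    (Measurable.stronglyMeasurable (by fun_prop)) fun k => ?_
  rw [norm_smul, norm_mul, Complex.norm_I, one_mul, Complex.norm_real]
  have h1 := pow_mul_wt_le (μ := μ) (show β / 2 < β by linarith) 1 k
  simp only [pow_one, Nat.factorial_one, Nat.cast_one] at h1
  calc ‖k j‖ * ‖g k‖ ≤ ‖k‖ * (n * wt μ β k) :=
        mul_le_mul (PiLp.norm_apply_le k j) (hg.bound k) (norm_nonneg _) (norm_nonneg _)
    _ = n * (‖k‖ * wt μ β k) := by ring
    _ ≤ n * (1 / (β - β / 2) * wt μ (β / 2) k) := by gcongr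
    _ = _ := by ring

lemma Datum.integrable_bil {μ β n : ℝ} (hμ : 3 < μ) (hβ : 0 < β) {g : R3 → C3}
    (hg : Datum μ β n g) : Integrable (bil g g) := by
  refine ((integrable_pow_mul_wt hμ hβ 1).const_mul (n * n * convConst μ)).mono'
    (stronglyMeasurable_bil hg.meas hg.meas).aestronglyMeasurable (Eventually.of_forall fun k => ?_)
  refine (norm_bil_le hμ hβ.le hg.meas hg.meas hg.nonneg hg.nonneg hg.bound hg.bound k).trans
    (le_of_eq ?_)
  rw [pow_one]; ring

/-- The divergence form ∂_j(v_j v) equals v·∇v for solenoidal v. On the Fourier side, write k = k' +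
(k - k') under the convolution and use k'·g(k') = 0. -/
lemma sum_smul_fconv_eq {μ β n : ℝ} (hμ : 3 < μ) (hβ : 0 < β) {g : R3 → C3}
    (hg : Datum μ β n g) (hdiv : ∀ k, kdot k (g k) = 0) (k : R3) :
    ∑ j, (Complex.I * (k j : ℂ)) • fconv j g g k =
      ∑ j, fconv j g (fun k => (Complex.I * (k j : ℂ)) • g k) k := by
  have ht := hg.tame hμ hβ
  have h1 : ∀ j, Integrable fun k' => (Complex.I * (k j : ℂ)) • (g k' j • g (k - k')) := fun j =>
    (ht.integrable_conv ht j k).smul (Complex.I * (k j : ℂ))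
  have h2 := fun j => ht.integrable_conv (hg.tame_deriv hμ hβ j) j k
  rw [← sub_eq_zero]
  unfold fconv
  simp only [← integral_smul]
  rw [← integral_finsetSum _ fun j _ => h1 j, ← integral_finsetSum _ fun j _ => h2 j,
    ← integral_sub (integrable_finsetSum _ fun j _ => h1 j)
      (integrable_finsetSum _ fun j _ => h2 j)]
  refine integral_eq_zero_of_ae (Eventually.of_forall fun k' => ?_)
  beta_reduce
  rw [← Finset.sum_sub_distrib]
  have e : ∀ j, (Complex.I * (k j : ℂ)) • (g k' j • g (k - k')) -
      g k' j • (Complex.I * ((k - k') j : ℂ)) • g (k - k') =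
      (Complex.I * ((k' j : ℂ) * g k' j)) • g (k - k') := by
    intro j
    rw [smul_smul, smul_smul, ← sub_smul]
    congr 1
    simp only [PiLp.sub_apply, Complex.ofReal_sub]
    ring
  simp only [e, Pi.zero_apply]
  rw [← Finset.sum_smul, ← Finset.mul_sum]
  have := hdiv k'
  unfold kdot at this
  rw [this, mul_zero, zero_smul]

/-- The first conclusion is kept because uniqueness must identify an arbitrary transform of the
convective term with this one. -/
lemma isHodgeProjection_convect {μ β n : ℝ} (hμ : 3 < μ) (hβ : 0 < β) {g : R3 → C3}
    (hg : Datum μ β n g) (hdiv : ∀ k, kdot k (g k) = 0) :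
    IsFourierPair (convect (invF g)) (fun k => ∑ j, (Complex.I * (k j : ℂ)) • fconv j g g k) ∧
      IsHodgeProjection (convect (invF g)) (invF (bil g g)) := by
  have ht := hg.tame hμ hβ
  have hi : ∀ j, Integrable (fconv j g (fun k => (Complex.I * (k j : ℂ)) • g k)) := fun j =>
    integrable_fconv ht.int (hg.tame_deriv hμ hβ j).int j
  have hp : IsFourierPair (convect (invF g))
      (fun k => ∑ j, (Complex.I * (k j : ℂ)) • fconv j g g k) := by
    rw [isFourierPair_iff]
    simp only [sum_smul_fconv_eq hμ hβ hg hdiv]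
    refine ⟨integrable_finsetSum _ fun j _ => hi j, ?_⟩
    ext1 x
    rw [invF_sum _ fun j _ => hi j]
    unfold convect
    refine Finset.sum_congr rfl fun j _ => ?_
    rw [pderiv_invF ht.int (hg.integrable_norm_mul hμ hβ),
      invF_smul_invF ht.int (hg.tame_deriv hμ hβ j).int]
  refine ⟨hp, _, hp, ?_⟩
  rw [isFourierPair_iff]
  simp only [← bil_eq]
  exact ⟨hg.integrable_bil hμ hβ, trivial⟩

lemma TimeField.datum {μ β α R : ℝ} {V : ℂ → R3 → C3} (hV : TimeField μ β α R V) (t : ℂ) :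
    Datum μ β R (V t) := ⟨hV.meas_at t, hV.bound t⟩

lemma laplacian_invF_datum {μ β n : ℝ} (hμ : 3 < μ) (hβ : 0 < β) {g : R3 → C3}
    (hg : Datum μ β n g) (x : R3) :
    Laplacian.laplacian (invF g) x = invF (fun k => (-((‖k‖ ^ 2 : ℝ) : ℂ)) • g k) x :=
  laplacian_invF (fun n _ => hg.integrable_pow_mul hμ hβ n) hg.meas.aestronglyMeasurable x

lemma Datum.integrable_lap {μ β n : ℝ} (hμ : 3 < μ) (hβ : 0 < β) {g : R3 → C3}
    (hg : Datum μ β n g) : Integrable fun k : R3 => (-((‖k‖ ^ 2 : ℝ) : ℂ)) • g k := by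
  have hm := hg.meas.measurable
  refine (hg.integrable_pow_mul hμ hβ 2).mono'
    (Measurable.aestronglyMeasurable (by fun_prop)) (Eventually.of_forall fun k => ?_)
  rw [norm_smul, norm_neg, Complex.norm_real, Real.norm_of_nonneg (by positivity)]

/-- The exponential weight makes all needed powers of |k| integrable, and holomorphy in t permits
differentiation under the integral with no bound on V'. -/
theorem FourierFlow.isNSSolution {μ β α α' R nf : ℝ} (hμ : 3 < μ) (hβ : 0 < β) (hα : 0 < α)
    (hαα' : α ≤ α') {a fh : R3 → C3} {V : ℂ → R3 → C3} (hV : FourierFlow μ β α R a fh V)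
    (hf : Datum μ β nf fh) (hak : ∀ k, kdot k (a k) = 0)
    (hfk : ∀ k, kdot k (fh k) = 0) :
    IsNSSolution μ β (invF a) (invF fh) (timeDomain α') (fun t => invF (V t)) := by
  have hdiv := hV.sol hak hfk
  have hsub := timeDomain_anti hαα'
  have hT := hV.toTimeField
  refine ⟨⟨ENNReal.ofReal R, ENNReal.ofReal_lt_top, fun t ht => ⟨V t, ?_, ?_⟩⟩, fun t ht => ?_,
    fun t ht x => ?_, fun t ht => ?_, fun x => ?_⟩
  · exact isFourierPair_iff.2 ⟨((hT.datum t).tame hμ hβ).int, rfl⟩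
  · exact wnorm_le_of_norm_le (hV.bound t)
  · exact_mod_cast contDiff_invF (N := 2) fun n _ => (hT.datum t).integrable_pow_mul hμ hβ n
  · rw [sum_pderiv_invF ((hT.datum t).tame hμ hβ).int ((hT.datum t).integrable_norm_mul hμ hβ)]
    simp [hdiv, invF]
  · refine ⟨_, (isHodgeProjection_convect hμ hβ (hT.datum t) (hdiv t)).2, fun x => ?_⟩
    have hder := hasDerivAt_integral_of_holomorphic (isOpen_timeDomain hα)
      (F := fun t k => phase k x • V t k) (ν := volume) (bound := fun k => R * wt μ β k)
      (Eventually.of_forall fun k => (hT.holo k).fun_const_smul _)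
      (fun s _ => (integrable_phase_smul ((hT.datum s).tame hμ hβ).int x).aestronglyMeasurable)
      (Eventually.of_forall fun k s _ => by
        rw [norm_smul, norm_phase, one_mul]; exact hT.bound s k)
      ((integrable_wt hμ hβ.le).const_mul R) (hsub ht)
    refine HasDerivAt.hasDerivWithinAt (hder.congr_deriv ?_)
    rw [laplacian_invF_datum hμ hβ (hT.datum t), sub_add_eq_add_sub,
      ← invF_add ((hT.datum t).integrable_lap hμ hβ) (hf.tame hμ hβ).int,
      ← invF_sub (g := fun k => -((‖k‖ ^ 2 : ℝ) : ℂ) • V t k + fh k) (((hT.datum t).integrable_lap hμ hβ).add (hf.tame hμ hβ).int)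
        ((hT.datum t).integrable_bil hμ hβ)]
    unfold invF
    refine integral_congr_ae (Eventually.of_forall fun k => ?_)
    simp only
    rw [((hV.deriv k t (hsub ht)).fun_const_smul (phase k x)).deriv]
    congr 1
    simp only [nonlin]
    abel
  · refine tendsto_integral_filter_of_dominated_convergence (fun k => R * wt μ β k) ?_ ?_ ?_ ?_
    · exact Eventually.of_forall fun s =>
        (integrable_phase_smul ((hT.datum s).tame hμ hβ).int x).aestronglyMeasurable
    · refine Eventually.of_forall fun s => Eventually.of_forall fun k => ?_
      rw [norm_smul, norm_phase, one_mul]; exact hT.bound s k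
    · exact (integrable_wt hμ hβ.le).const_mul R
    · refine Eventually.of_forall fun k => ?_
      exact ((hV.initial k).mono_left (nhdsWithin_mono _ hsub)).const_smul _

/-- Fourier transforms of divergence free fields can be represented by measurable functions that
are bounded and solenoidal at every wave number. -/
lemma exists_datum {μ β M : ℝ} (hμ : 3 < μ) (hβ : 0 < β) (hM : 0 ≤ M) {v vhat : R3 → C3}
    (hv : IsFourierPair v vhat) (hb : ∀ k, ‖vhat k‖ ≤ M * wt μ β k) (hdiv : IsDivFree v) :
    ∃ g, Datum μ β M g ∧ v = invF g ∧ (∀ k, kdot k (g k) = 0) ∧ g =ᵐ[volume] vhat := by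
  obtain ⟨hi, rfl⟩ := isFourierPair_iff.1 hv
  have hi1 : Integrable fun k => ‖k‖ * ‖vhat k‖ := by
    simpa using integrable_pow_mul_of_wt hμ hβ hi.aestronglyMeasurable hb 1
  have hk := ae_kdot_eq_zero hi hi1 hdiv
  let g₀ := hi.aestronglyMeasurable.mk vhat
  have hg₀ : StronglyMeasurable g₀ := hi.aestronglyMeasurable.stronglyMeasurable_mk
  have hg₀e : vhat =ᵐ[volume] g₀ := hi.aestronglyMeasurable.ae_eq_mk
  -- The complement of S is a null set. Putting the value 0 there makes both properties hold at
  -- every wave number without changing the field.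
  let S : Set R3 := {k | ‖g₀ k‖ ≤ M * wt μ β k} ∩ {k | kdot k (g₀ k) = 0}
  have hm := hg₀.measurable
  have hS : MeasurableSet S := by
    refine MeasurableSet.inter ?_ ?_
    · exact measurableSet_le (by fun_prop) (by fun_prop)
    · refine measurableSet_eq_fun ?_ measurable_const
      unfold kdot
      fun_prop
  have he : S.indicator g₀ =ᵐ[volume] vhat := by
    filter_upwards [hg₀e, hk] with k h1 h2
    have : k ∈ S := ⟨by simpa [← h1] using hb k, by simpa [← h1] using h2⟩
    rw [Set.indicator_of_mem this, h1]
  refine ⟨S.indicator g₀, ⟨hg₀.indicator hS, fun k => ?_⟩, (invF_congr_ae he).symm, fun k => ?_, he⟩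
  · by_cases h : k ∈ S
    · rw [Set.indicator_of_mem h]; exact h.1
    · rw [Set.indicator_of_notMem h, norm_zero]
      exact mul_nonneg hM (wt_pos _ _ _).le
  · by_cases h : k ∈ S
    · rw [Set.indicator_of_mem h]; exact h.2
    · rw [Set.indicator_of_notMem h]; simp [kdot]

/-! ### Multiset coefficients -/

/-- The coefficient of `z^j` in `(1-z)^{-n}`, for `n ≥ 1`. -/
def mchoose (n j : ℕ) : ℕ := (n - 1 + j).choose j

/-- Compare coefficients in (1-z)^{-n} (1-z)^{-m} = (1-z)^{-(n+m)}. -/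
lemma sum_mchoose_mul {n m : ℕ} (hn : 0 < n) (hm : 0 < m) (J : ℕ) :
    ∑ p ∈ Finset.HasAntidiagonal.antidiagonal J, (mchoose n p.1 : ℝ) * mchoose m p.2 = mchoose (n + m) J := by
  have hc : ∀ d : ℕ, 0 < d → ∀ j,
      PowerSeries.coeff j (PowerSeries.invOneSubPow ℝ d).val = mchoose d j := by
    intro d hd j
    rw [PowerSeries.invOneSubPow_val_eq_mk_sub_one_add_choose_of_pos _ _ hd, PowerSeries.coeff_mk]
    unfold mchoose
    rw [Nat.choose_symm_add]
  have h : (PowerSeries.invOneSubPow ℝ (n + m)).val =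
      (PowerSeries.invOneSubPow ℝ n).val * (PowerSeries.invOneSubPow ℝ m).val := by
    rw [PowerSeries.invOneSubPow_add, Units.val_mul]
  have h2 := congrArg (PowerSeries.coeff J) h
  rw [PowerSeries.coeff_mul, hc _ (by omega)] at h2
  rw [h2]
  exact Finset.sum_congr rfl fun p _ => by rw [hc n hn, hc m hm]

lemma mchoose_one (j : ℕ) : mchoose 1 j = 1 := by simp [mchoose]

lemma mchoose_zero_right (n : ℕ) : mchoose n 0 = 1 := by simp [mchoose]

lemma sum_mchoose {m : ℕ} (hm : 0 < m) (J : ℕ) :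
    ∑ p ∈ Finset.HasAntidiagonal.antidiagonal J, (mchoose m p.2 : ℝ) = mchoose (m + 1) J := by
  rw [add_comm, ← sum_mchoose_mul one_pos hm]
  simp [mchoose_one]

/-- The derivative of (1-z)^{-n} is n (1-z)^{-(n+1)}. -/
lemma succ_mul_mchoose {n : ℕ} (hn : 0 < n) (j : ℕ) :
    ((j : ℝ) + 1) * mchoose n (j + 1) = n * mchoose (n + 1) j := by
  obtain ⟨m, rfl⟩ := Nat.exists_eq_add_of_lt hn
  have h1 := Nat.choose_succ_right_eq (m + j + 1) j
  have h2 : m + j + 1 - j = m + 1 := by omega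
  rw [h2] at h1
  have e1 : mchoose (0 + m + 1) (j + 1) = (m + j + 1).choose (j + 1) := by
    unfold mchoose; congr 1; omega
  have e2 : mchoose (0 + m + 1 + 1) j = (m + j + 1).choose j := by
    unfold mchoose; congr 1; omega
  rw [e1, e2]
  have h3 : (((m + j + 1).choose (j + 1) * (j + 1) : ℕ) : ℝ) =
    (((m + j + 1).choose j * (m + 1) : ℕ) : ℝ) := by rw [h1]
  push_cast at h3 ⊢
  linarith

lemma mchoose_le_succ (n j : ℕ) : mchoose n j ≤ mchoose (n + 1) j :=
  Nat.choose_le_choose j (by omega)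

/-! ### Moments -/

/-- The `j`-th scaled moment `∫ (σ|k|)^j / j! r(k) dk`. -/
def moment (σ : ℝ) (j : ℕ) (r : R3 → ℝ≥0∞) : ℝ≥0∞ :=
  ∫⁻ k, ENNReal.ofReal ((σ * ‖k‖) ^ j / j.factorial) * r k

lemma moment_zero (σ : ℝ) (r : R3 → ℝ≥0∞) : moment σ 0 r = ∫⁻ k, r k := by
  simp [moment]

lemma moment_mono {σ : ℝ} {j : ℕ} {r s : R3 → ℝ≥0∞} (h : ∀ᵐ k, r k ≤ s k) :
    moment σ j r ≤ moment σ j s :=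
  lintegral_mono_ae (h.mono fun _ hk => mul_le_mul_right hk _)

lemma moment_add {σ : ℝ} {j : ℕ} {r : R3 → ℝ≥0∞} (hr : Measurable r) (s : R3 → ℝ≥0∞) :
    moment σ j (fun k => r k + s k) = moment σ j r + moment σ j s := by
  unfold moment
  rw [← lintegral_add_left (by fun_prop)]
  simp only [mul_add]

lemma moment_sum {ι : Type*} (S : Finset ι) {σ : ℝ} {j : ℕ} {r : ι → R3 → ℝ≥0∞}
    (hr : ∀ i, Measurable (r i)) :
    moment σ j (fun k => ∑ i ∈ S, r i k) = ∑ i ∈ S, moment σ j (r i) := by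
  unfold moment
  rw [← lintegral_finsetSum _ fun i _ => by fun_prop]
  simp only [Finset.mul_sum]

lemma moment_const_mul {σ : ℝ} {j : ℕ} {r : R3 → ℝ≥0∞} (hr : Measurable r) (c : ℝ≥0∞) :
    moment σ j (fun k => c * r k) = c * moment σ j r := by
  unfold moment
  rw [← lintegral_const_mul _ (by fun_prop)]
  simp only [mul_left_comm]

/-- On the generating series of the moments, multiplication by |k| acts as σ⁻¹ d/dz. -/
lemma moment_norm_mul {σ : ℝ} (hσ : 0 < σ) (j : ℕ) {r : R3 → ℝ≥0∞} (hr : Measurable r) :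
    moment σ j (fun k => ‖k‖ₑ * r k) = ENNReal.ofReal ((j + 1) / σ) * moment σ (j + 1) r := by
  unfold moment
  rw [← lintegral_const_mul _ (by fun_prop)]
  refine lintegral_congr fun k => ?_
  rw [← mul_assoc, ← mul_assoc, ← ofReal_norm, ← ENNReal.ofReal_mul (by positivity),
    ← ENNReal.ofReal_mul (by positivity)]
  congr 2
  rw [Nat.factorial_succ, pow_succ]
  push_cast
  field_simp

/-- The normalisation by j! turns the binomial expansion of (σ|k'| + σ|k-k'|)^j into a sum of
products. Convolution thus becomes a Cauchy product of moment sequences. -/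
lemma moment_lconv_le {σ : ℝ} (hσ : 0 ≤ σ) (j : ℕ) {f g : R3 → ℝ≥0∞} (hf : Measurable f)
    (hg : Measurable g) :
    moment σ j (lconv f g) ≤ ∑ p ∈ Finset.HasAntidiagonal.antidiagonal j, moment σ p.1 f * moment σ p.2 g := by
  have hbin : ∀ k k' : R3, ENNReal.ofReal ((σ * ‖k‖) ^ j / j.factorial) ≤
      ∑ p ∈ Finset.HasAntidiagonal.antidiagonal j, ENNReal.ofReal ((σ * ‖k'‖) ^ p.1 / p.1.factorial) *
        ENNReal.ofReal ((σ * ‖k - k'‖) ^ p.2 / p.2.factorial) := by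
    intro k k'
    have h1 : ∀ p : ℕ × ℕ, ENNReal.ofReal ((σ * ‖k'‖) ^ p.1 / p.1.factorial) *
        ENNReal.ofReal ((σ * ‖k - k'‖) ^ p.2 / p.2.factorial) =
        ENNReal.ofReal ((σ * ‖k'‖) ^ p.1 / p.1.factorial *
          ((σ * ‖k - k'‖) ^ p.2 / p.2.factorial)) := fun p =>
      (ENNReal.ofReal_mul (by positivity)).symm
    simp only [h1]
    rw [← ENNReal.ofReal_sum_of_nonneg fun p _ => by positivity]
    refine ENNReal.ofReal_le_ofReal ?_
    have htri : σ * ‖k‖ ≤ σ * ‖k'‖ + σ * ‖k - k'‖ := by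
      rw [← mul_add]
      refine mul_le_mul_of_nonneg_left ?_ hσ
      simpa using norm_add_le k' (k - k')
    calc (σ * ‖k‖) ^ j / j.factorial ≤ (σ * ‖k'‖ + σ * ‖k - k'‖) ^ j / j.factorial := by
          gcongr
      _ = _ := by
          rw [Commute.add_pow' (Commute.all _ _), Finset.sum_div]
          refine Finset.sum_congr rfl fun p hp => ?_
          rw [Finset.HasAntidiagonal.mem_antidiagonal] at hp
          have hc : ((j.choose p.1 : ℕ) : ℝ) * p.1.factorial * p.2.factorial = j.factorial := by
            rw [← hp]
            rw [Nat.choose_symm_add]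
            exact_mod_cast Nat.add_choose_mul_factorial_mul_factorial p.1 p.2
          rw [nsmul_eq_mul, ← hc]
          have : (p.1.factorial : ℝ) ≠ 0 := by positivity
          have : (p.2.factorial : ℝ) ≠ 0 := by positivity
          have : ((j.choose p.1 : ℕ) : ℝ) ≠ 0 := by
            exact_mod_cast (Nat.choose_pos (by omega)).ne'
          field_simp
  calc moment σ j (lconv f g)
      = ∫⁻ k, ∫⁻ k', ENNReal.ofReal ((σ * ‖k‖) ^ j / j.factorial) * (f k' * g (k - k')) := by
        unfold moment lconv
        exact lintegral_congr fun k => by rw [lintegral_const_mul _ (by fun_prop)]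
    _ ≤ ∫⁻ k, ∫⁻ k', ∑ p ∈ Finset.HasAntidiagonal.antidiagonal j,
          (ENNReal.ofReal ((σ * ‖k'‖) ^ p.1 / p.1.factorial) * f k') *
            (ENNReal.ofReal ((σ * ‖k - k'‖) ^ p.2 / p.2.factorial) * g (k - k')) := by
        refine lintegral_mono fun k => lintegral_mono fun k' => ?_
        refine (mul_le_mul_left (hbin k k') _).trans (le_of_eq ?_)
        rw [Finset.sum_mul]
        exact Finset.sum_congr rfl fun p _ => by ring
    _ = ∑ p ∈ Finset.HasAntidiagonal.antidiagonal j, ∫⁻ k, ∫⁻ k',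
          (ENNReal.ofReal ((σ * ‖k'‖) ^ p.1 / p.1.factorial) * f k') *
            (ENNReal.ofReal ((σ * ‖k - k'‖) ^ p.2 / p.2.factorial) * g (k - k')) := by
        rw [← lintegral_finsetSum']
        · refine lintegral_congr fun k => ?_
          rw [lintegral_finsetSum _ fun p _ => by fun_prop]
        · intro p _
          refine (Measurable.lintegral_prod_right' (f := fun z : R3 × R3 =>
            (ENNReal.ofReal ((σ * ‖z.2‖) ^ p.1 / p.1.factorial) * f z.2) *
            (ENNReal.ofReal ((σ * ‖z.1 - z.2‖) ^ p.2 / p.2.factorial) * g (z.1 - z.2))) ?_).aemeasurable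
          fun_prop
    _ = _ := by
        refine Finset.sum_congr rfl fun p _ => ?_
        rw [lintegral_lintegral_swap (by
          refine Measurable.aemeasurable ?_
          unfold Function.uncurry
          fun_prop)]
        unfold moment
        rw [← lintegral_mul_const _ (by fun_prop)]
        refine lintegral_congr fun k' => ?_
        rw [lintegral_const_mul _ (by fun_prop)]
        congr 1
        exact lintegral_sub_right_eq_self
          (fun k => ENNReal.ofReal ((σ * ‖k‖) ^ p.2 / p.2.factorial) * g k) k'

/-! ### Gevrey bounds from the quadratic recursion -/

/-- The majorant of the moments in the Gevrey estimate. -/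
def gevreyMaj (P Q B : ℝ) : ℕ → ℕ → ℝ
  | 0, _ => P
  | N + 1, j => Q * B ^ N * N.factorial * mchoose (2 * N + 2) j

lemma gevreyMaj_nonneg {P Q B : ℝ} (hP : 0 ≤ P) (hQ : 0 ≤ Q) (hB : 0 < B) (N j : ℕ) :
    0 ≤ gevreyMaj P Q B N j := by
  cases N with
  | zero => exact hP
  | succ N => unfold gevreyMaj; positivity

/-- With M = l + q + 1, the exponents of the product add up to 2M + 2. The M terms each carry l! q!
≤ (M-1)!, so together they produce one M!, and one power of B is gained. -/
lemma sum_gevreyMaj_middle {P Q B : ℝ} (hB : 0 < B) (M J : ℕ) :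
    ∑ l ∈ Finset.range M, ∑ p ∈ Finset.HasAntidiagonal.antidiagonal J,
      gevreyMaj P Q B (l + 1) p.1 * gevreyMaj P Q B (M - l) p.2 ≤
        Q ^ 2 / B * B ^ M * M.factorial * mchoose (2 * M + 2) J := by
  have hterm : ∀ l ∈ Finset.range M, ∑ p ∈ Finset.HasAntidiagonal.antidiagonal J,
      gevreyMaj P Q B (l + 1) p.1 * gevreyMaj P Q B (M - l) p.2 ≤
        Q ^ 2 / B * B ^ M * (M - 1).factorial * mchoose (2 * M + 2) J := by
    intro l hl
    rw [Finset.mem_range] at hl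
    obtain ⟨q, rfl⟩ : ∃ q, M = l + q + 1 := ⟨M - l - 1, by omega⟩
    have e : l + q + 1 - l = q + 1 := by omega
    rw [e]
    have h1 : ∀ p : ℕ × ℕ, gevreyMaj P Q B (l + 1) p.1 * gevreyMaj P Q B (q + 1) p.2 =
        (Q ^ 2 * B ^ (l + q) * (l.factorial * q.factorial)) *
          (mchoose (2 * l + 2) p.1 * mchoose (2 * q + 2) p.2) := by
      intro p
      simp only [gevreyMaj]
      ring
    simp only [h1]
    rw [← Finset.mul_sum, sum_mchoose_mul (by omega) (by omega)]
    have e2 : 2 * l + 2 + (2 * q + 2) = 2 * (l + q + 1) + 2 := by ring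
    have e3 : Q ^ 2 / B * B ^ (l + q + 1) = Q ^ 2 * B ^ (l + q) := by
      rw [pow_succ (B) (l + q)]; field_simp
    rw [e2, e3, Nat.add_sub_cancel]
    have hf : (l.factorial : ℝ) * q.factorial ≤ (l + q).factorial := by
      exact_mod_cast Nat.le_of_dvd (Nat.factorial_pos _) (Nat.factorial_mul_factorial_dvd_factorial_add l q)
    gcongr
  refine (Finset.sum_le_sum hterm).trans ?_
  rw [Finset.sum_const, Finset.card_range, nsmul_eq_mul]
  cases M with
  | zero => simp; positivity
  | succ M =>
    rw [Nat.add_sub_cancel, Nat.factorial_succ]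
    push_cast
    exact le_of_eq (by ring)

/-- After division by B, the condition is compared with the left side term by term. For σ = 5b/6 the
comparison of the n₀ terms is an equality at M = 0, namely 12·3 = 18·2. -/
lemma gevrey_coeff_le {b n₀ n₁ B : ℝ} (hb : 0 < b) (hn₀ : 0 ≤ n₀) (hn₁ : 0 ≤ n₁) (hB : 0 < B)
    (hcond : 6 / b ^ 2 * B + 18 * Real.pi / b ^ 3 * n₀ * B + 2 * Real.pi / b ^ 3 * n₁ ≤ B ^ 2)
    (M : ℕ) :
    ((2 * M + 2) * (2 * M + 3) / (5 * b / 6) ^ 2 +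
      2 * (5 * (Real.pi / b ^ 2 * n₀)) * (2 * M + 3) / (5 * b / 6) +
      Real.pi / b ^ 2 * n₁ / B * (2 * M + 2) / (5 * b / 6) : ℝ) ≤ (M + 2) * (M + 1) * B := by
  have hpi := Real.pi_pos
  have hB2 : 6 / b ^ 2 + 18 * Real.pi / b ^ 3 * n₀ + 2 * Real.pi / b ^ 3 * n₁ / B ≤ B := by
    have : (6 / b ^ 2 + 18 * Real.pi / b ^ 3 * n₀ + 2 * Real.pi / b ^ 3 * n₁ / B) * B ≤ B * B := by
      calc _ = 6 / b ^ 2 * B + 18 * Real.pi / b ^ 3 * n₀ * B + 2 * Real.pi / b ^ 3 * n₁ := by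
            field_simp
        _ ≤ B * B := by rw [← sq]; exact hcond
    exact le_of_mul_le_mul_right this hB
  have hM : (0 : ℝ) ≤ M := Nat.cast_nonneg M
  have i1 : 0 ≤ 1 / b ^ 2 := by positivity
  have i2 : 0 ≤ Real.pi / b ^ 3 * n₀ := by positivity
  have i3 : 0 ≤ Real.pi / b ^ 3 * n₁ / B := by positivity
  have c1 : (2 * M + 2) * (2 * M + 3) * (36 / 25) ≤ (6 * ((M + 2) * (M + 1)) : ℝ) := by nlinarith
  have c2 : 12 * (2 * M + 3) ≤ (18 * ((M + 2) * (M + 1)) : ℝ) := by nlinarith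
  have c3 : 12 / 5 * (M + 1) ≤ (2 * ((M + 2) * (M + 1)) : ℝ) := by nlinarith
  have t1 := mul_le_mul_of_nonneg_right c1 i1
  have t2 := mul_le_mul_of_nonneg_right c2 i2
  have t3 := mul_le_mul_of_nonneg_right c3 i3
  calc _ = (2 * M + 2) * (2 * M + 3) * (36 / 25) * (1 / b ^ 2) +
        12 * (2 * M + 3) * (Real.pi / b ^ 3 * n₀) +
        12 / 5 * (M + 1) * (Real.pi / b ^ 3 * n₁ / B) := by field_simp; ring
    _ ≤ _ := add_le_add (add_le_add t1 t2) t3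
    _ = (M + 2) * (M + 1) *
      (6 / b ^ 2 + 18 * Real.pi / b ^ 3 * n₀ + 2 * Real.pi / b ^ 3 * n₁ / B) := by ring
    _ ≤ _ := by gcongr

/-- Read as generating series, the left side is two derivatives of x_{M+1} plus one derivative of ∑
x_l x_{M+1-l}. Two derivatives of (1-z)^{-(2M+2)} have exponent 2M+4. The terms l = 0 and l = M+1
have exponent 1 + (2M+2), which one derivative raises to 2M+4. The middle terms end at 2M+3, which
is enlarged to 2M+4. This is the exponent of x_{M+2}, so only the scalar factors of
`gevrey_coeff_le` remain to be compared. -/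
lemma gevreyMaj_rec {b n₀ n₁ B : ℝ} (hb : 0 < b) (hn₀ : 0 ≤ n₀) (hn₁ : 0 ≤ n₁) (hB : 0 < B)
    (hcond : 6 / b ^ 2 * B + 18 * Real.pi / b ^ 3 * n₀ * B + 2 * Real.pi / b ^ 3 * n₁ ≤ B ^ 2)
    (M j : ℕ) :
    let x := gevreyMaj (5 * (Real.pi / b ^ 2 * n₀)) (Real.pi / b ^ 2 * n₁) B
    let σ := 5 * b / 6
    ((j : ℝ) + 1) / σ * ((j + 2) / σ * x (M + 1) (j + 2)) + (j + 1) / σ *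
      ∑ l ∈ Finset.range (M + 2), ∑ p ∈ Finset.HasAntidiagonal.antidiagonal (j + 1), x l p.1 * x (M + 1 - l) p.2 ≤
      (M + 2) * x (M + 2) j := by
  intro x σ
  set P := 5 * (Real.pi / b ^ 2 * n₀) with hP
  set Q := Real.pi / b ^ 2 * n₁ with hQ
  have hpi := Real.pi_pos
  have hP0 : 0 ≤ P := by positivity
  have hQ0 : 0 ≤ Q := by positivity
  have hσ : 0 < σ := by positivity
  set Y := Q * B ^ M * M.factorial with hY
  have hY0 : 0 ≤ Y := by positivity
  set F : ℝ := ((mchoose (2 * M + 4) j : ℕ) : ℝ) with hF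
  have hF0 : 0 ≤ F := by positivity
  have hx1 : ∀ i, x (M + 1) i = Y * mchoose (2 * M + 2) i := fun i => rfl
  -- the linear term
  have hlin : ((j : ℝ) + 1) / σ * ((j + 2) / σ * x (M + 1) (j + 2)) =
      (2 * M + 2) * (2 * M + 3) / σ ^ 2 * (Y * F) := by
    have h1 := succ_mul_mchoose (n := 2 * M + 2) (by omega) (j + 1)
    have h2 := succ_mul_mchoose (n := 2 * M + 3) (by omega) j
    push_cast at h1 h2
    rw [hx1]
    calc _ = (Y / σ ^ 2) * ((j + 1) * ((j + 1 + 1) * mchoose (2 * M + 2) (j + 1 + 1))) := by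
          field_simp; ring
      _ = (Y / σ ^ 2) * ((2 * M + 2) * ((j + 1) * mchoose (2 * M + 3) (j + 1))) := by
          rw [h1]; ring
      _ = _ := by rw [h2, hF]; field_simp
  -- the terms with `l = 0` and `l = M + 1`
  have hend : ∑ p ∈ Finset.HasAntidiagonal.antidiagonal (j + 1), x 0 p.1 * x (M + 1) p.2 =
      P * Y * mchoose (2 * M + 3) (j + 1) := by
    rw [← sum_mchoose (by omega), Finset.mul_sum]
    refine Finset.sum_congr rfl fun p _ => ?_
    rw [hx1]
    change P * _ = _
    ring
  have hend' : ∑ p ∈ Finset.HasAntidiagonal.antidiagonal (j + 1), x (M + 1) p.1 * x 0 p.2 =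
      P * Y * mchoose (2 * M + 3) (j + 1) := by
    rw [← hend, ← Finset.Nat.sum_antidiagonal_swap]
    exact Finset.sum_congr rfl fun p _ => by simp [mul_comm]
  have hmid := sum_gevreyMaj_middle (P := P) (Q := Q) hB M (j + 1)
  have hsum : ∑ l ∈ Finset.range (M + 2), ∑ p ∈ Finset.HasAntidiagonal.antidiagonal (j + 1),
      x l p.1 * x (M + 1 - l) p.2 ≤
      2 * (P * Y * mchoose (2 * M + 3) (j + 1)) + Q / B * Y * mchoose (2 * M + 2) (j + 1) := by
    rw [Finset.sum_range_succ, Finset.sum_range_succ']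
    simp only [Nat.sub_zero, Nat.sub_self, Nat.add_sub_add_right]
    rw [hend, hend']
    have e : Q ^ 2 / B * B ^ M * M.factorial * (mchoose (2 * M + 2) (j + 1) : ℝ) =
        Q / B * Y * mchoose (2 * M + 2) (j + 1) := by rw [hY]; ring
    rw [e] at hmid
    linarith
  have h3 := succ_mul_mchoose (n := 2 * M + 3) (by omega) j
  have h4 := succ_mul_mchoose (n := 2 * M + 2) (by omega) j
  have h5 : (mchoose (2 * M + 3) j : ℝ) ≤ F := by
    rw [hF]
    exact_mod_cast mchoose_le_succ (2 * M + 3) j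
  push_cast at h3 h4
  have hquad : ((j : ℝ) + 1) / σ * ∑ l ∈ Finset.range (M + 2),
      ∑ p ∈ Finset.HasAntidiagonal.antidiagonal (j + 1), x l p.1 * x (M + 1 - l) p.2 ≤
      (2 * P * (2 * M + 3) / σ + Q / B * (2 * M + 2) / σ) * (Y * F) := by
    calc _ ≤ ((j : ℝ) + 1) / σ * (2 * (P * Y * mchoose (2 * M + 3) (j + 1)) +
          Q / B * Y * mchoose (2 * M + 2) (j + 1)) := by gcongr
      _ = 2 * P * Y / σ * ((j + 1) * mchoose (2 * M + 3) (j + 1)) +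
          Q / B * Y / σ * ((j + 1) * mchoose (2 * M + 2) (j + 1)) := by ring
      _ = 2 * P * Y / σ * ((2 * M + 3) * F) + Q / B * Y / σ * ((2 * M + 2) *
          mchoose (2 * M + 3) j) := by rw [h3, h4]
      _ ≤ 2 * P * Y / σ * ((2 * M + 3) * F) + Q / B * Y / σ * ((2 * M + 2) * F) := by gcongr
      _ = _ := by ring
  have hmain : (2 * M + 2) * (2 * M + 3) / σ ^ 2 + 2 * P * (2 * M + 3) / σ +
      Q / B * (2 * M + 2) / σ ≤ (M + 2) * (M + 1) * B := gevrey_coeff_le hb hn₀ hn₁ hB hcond M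
  have hxR : (M + 2) * x (M + 2) j = (M + 2) * (M + 1) * B * (Y * F) := by
    change (M + 2) * (Q * B ^ (M + 1) * (M + 1).factorial * mchoose (2 * (M + 1) + 2) j) = _
    have e : 2 * (M + 1) + 2 = 2 * M + 4 := by ring
    rw [e, Nat.factorial_succ, pow_succ]
    push_cast
    ring
  rw [hxR, hlin]
  calc _ ≤ (2 * M + 2) * (2 * M + 3) / σ ^ 2 * (Y * F) +
        (2 * P * (2 * M + 3) / σ + Q / B * (2 * M + 2) / σ) * (Y * F) := by linarith
    _ = ((2 * M + 2) * (2 * M + 3) / σ ^ 2 + 2 * P * (2 * M + 3) / σ +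
        Q / B * (2 * M + 2) / σ) * (Y * F) := by ring
    _ ≤ _ := by gcongr

/-- Bernoulli's inequality for (6/5)^j. This is the origin of the factor 5 in P: with σ = 5b/6, the
moments of the initial datum are bounded uniformly in j. -/
lemma succ_mul_pow_le (j : ℕ) : ((j : ℝ) + 1) * (5 / 6) ^ j ≤ 5 := by
  have h := one_add_mul_le_pow (a := (1 / 5 : ℝ)) (by norm_num) j
  have h2 : (5 / 6 : ℝ) ^ j * (1 + 1 / 5) ^ j = 1 := by
    rw [← mul_pow]; norm_num
  have h3 : 0 < (5 / 6 : ℝ) ^ j := by positivity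
  nlinarith

/-- Strong induction on N for all j at once, since the step to N consumes moments of orders up to j
+ 2. For N = 0 the bound is constant in j; for N = 1 the factor j + 1 is the coefficient of
(1-z)^{-2}. The recursion is required only as an inequality between nonnegative functions, so the
result serves both the coefficients and the weighted majorants. -/
theorem moment_le_gevreyMaj {μ b n₀ n₁ B : ℝ} (hμ : 3 < μ) (hb : 0 < b) (hn₀ : 0 ≤ n₀)
    (hn₁ : 0 ≤ n₁) (hB : 0 < B)
    (hcond : 6 / b ^ 2 * B + 18 * Real.pi / b ^ 3 * n₀ * B + 2 * Real.pi / b ^ 3 * n₁ ≤ B ^ 2)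
    {r : ℕ → R3 → ℝ≥0∞} (hr : ∀ N, Measurable (r N))
    (h0 : ∀ᵐ k, r 0 k ≤ ENNReal.ofReal (n₀ * wt μ b k))
    (h1 : ∀ᵐ k, r 1 k ≤ ENNReal.ofReal (n₁ * wt μ b k))
    (hrec : ∀ M : ℕ, ∀ᵐ k, ((M : ℝ≥0∞) + 2) * r (M + 2) k ≤ ‖k‖ₑ * (‖k‖ₑ * r (M + 1) k) +
      ‖k‖ₑ * ∑ l ∈ Finset.range (M + 2), lconv (r l) (r (M + 1 - l)) k) (N j : ℕ) :
    moment (5 * b / 6) j (r N) ≤ ENNReal.ofReal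
      (gevreyMaj (5 * (Real.pi / b ^ 2 * n₀)) (Real.pi / b ^ 2 * n₁) B N j) := by
  set P := 5 * (Real.pi / b ^ 2 * n₀) with hP
  set Q := Real.pi / b ^ 2 * n₁ with hQ
  have hpi := Real.pi_pos
  have hP0 : 0 ≤ P := by positivity
  have hQ0 : 0 ≤ Q := by positivity
  have hσ : 0 < 5 * b / 6 := by positivity
  have hx := gevreyMaj_nonneg hP0 hQ0 hB
  have hratio : 5 * b / 6 / b = 5 / 6 := by field_simp
  have hbase : ∀ (n : ℝ) (s : R3 → ℝ≥0∞), 0 ≤ n → (∀ᵐ k, s k ≤ ENNReal.ofReal (n * wt μ b k)) →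
      ∀ j, moment (5 * b / 6) j s ≤
        ENNReal.ofReal (n * (Real.pi / b ^ 2 * (j + 1) * (5 / 6) ^ j)) := by
    intro n s hn hs j
    refine (moment_mono hs).trans ?_
    have e : (fun k => ENNReal.ofReal (n * wt μ b k)) =
        fun k => ENNReal.ofReal n * ENNReal.ofReal (wt μ b k) := by
      ext k; rw [ENNReal.ofReal_mul hn]
    rw [e, moment_const_mul (by fun_prop), ENNReal.ofReal_mul hn, ← hratio]
    gcongr
    exact lintegral_moment_wt_le hμ hb hσ.le j
  induction N using Nat.strong_induction_on generalizing j with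
  | _ N ih =>
    match N with
    | 0 =>
      refine (hbase n₀ _ hn₀ h0 j).trans (ENNReal.ofReal_le_ofReal ?_)
      change _ ≤ P
      calc _ = (Real.pi / b ^ 2 * n₀) * ((j + 1) * (5 / 6) ^ j) := by ring
        _ ≤ (Real.pi / b ^ 2 * n₀) * 5 := by gcongr; exact succ_mul_pow_le j
        _ = P := by rw [hP]; ring
    | 1 =>
      refine (hbase n₁ _ hn₁ h1 j).trans (ENNReal.ofReal_le_ofReal ?_)
      change _ ≤ Q * B ^ 0 * (Nat.factorial 0) * mchoose 2 j
      have e : (mchoose 2 j : ℝ) = j + 1 := by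
        have : mchoose 2 j = j + 1 := by
          unfold mchoose
          rw [show 2 - 1 + j = j + 1 by omega, Nat.choose_succ_self_right]
        rw [this]; push_cast; ring
      rw [e]
      have h3 : (5 / 6 : ℝ) ^ j ≤ 1 := pow_le_one₀ (by norm_num) (by norm_num)
      simp only [pow_zero, Nat.factorial_zero, Nat.cast_one, mul_one]
      calc n₁ * (Real.pi / b ^ 2 * (j + 1) * (5 / 6) ^ j) ≤
            n₁ * (Real.pi / b ^ 2 * (j + 1) * 1) := by gcongr
        _ = _ := by rw [hQ]; ring
    | M + 2 =>
      have hc : ∀ l, Measurable (lconv (r l) (r (M + 1 - l))) := fun l =>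
        measurable_lconv (hr _) (hr _)
      have hmom : ((M : ℝ≥0∞) + 2) * moment (5 * b / 6) j (r (M + 2)) ≤
          ENNReal.ofReal ((j + 1) / (5 * b / 6)) * (ENNReal.ofReal ((j + 2) / (5 * b / 6)) *
            moment (5 * b / 6) (j + 2) (r (M + 1))) +
          ENNReal.ofReal ((j + 1) / (5 * b / 6)) * ∑ l ∈ Finset.range (M + 2),
            moment (5 * b / 6) (j + 1) (lconv (r l) (r (M + 1 - l))) := by
        have hr1 := hr (M + 1)
        have hcs : Measurable fun k => ∑ l ∈ Finset.range (M + 2),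
            lconv (r l) (r (M + 1 - l)) k := Finset.measurable_sum _ fun l _ => hc l
        rw [← moment_const_mul (hr _)]
        refine (moment_mono (hrec M)).trans (le_of_eq ?_)
        rw [moment_add (by fun_prop), moment_norm_mul hσ j (by fun_prop),
          moment_norm_mul hσ (j + 1) hr1, moment_norm_mul hσ j hcs, moment_sum _ hc]
        congr 4
        push_cast
        ring
      have hlin : moment (5 * b / 6) (j + 2) (r (M + 1)) ≤
          ENNReal.ofReal (gevreyMaj P Q B (M + 1) (j + 2)) := ih (M + 1) (by omega) _
      have hquad : ∑ l ∈ Finset.range (M + 2),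
            moment (5 * b / 6) (j + 1) (lconv (r l) (r (M + 1 - l))) ≤
          ENNReal.ofReal (∑ l ∈ Finset.range (M + 2), ∑ p ∈ Finset.HasAntidiagonal.antidiagonal (j + 1),
            gevreyMaj P Q B l p.1 * gevreyMaj P Q B (M + 1 - l) p.2) := by
        rw [ENNReal.ofReal_sum_of_nonneg fun l _ =>
          Finset.sum_nonneg fun p _ => mul_nonneg (hx _ _) (hx _ _)]
        refine Finset.sum_le_sum fun l hl => ?_
        rw [Finset.mem_range] at hl
        refine (moment_lconv_le hσ.le (j + 1) (hr _) (hr _)).trans ?_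
        rw [ENNReal.ofReal_sum_of_nonneg fun p _ => mul_nonneg (hx _ _) (hx _ _)]
        refine Finset.sum_le_sum fun p _ => ?_
        rw [ENNReal.ofReal_mul (hx _ _)]
        exact mul_le_mul' (ih l (by omega) _) (ih (M + 1 - l) (by omega) _)
      have hfin := gevreyMaj_rec hb hn₀ hn₁ hB hcond M j
      simp only at hfin
      rw [← hP, ← hQ] at hfin
      have hM2 : ((M : ℝ≥0∞) + 2) = ENNReal.ofReal ((M : ℝ) + 2) := by
        rw [ENNReal.ofReal_add (by positivity) (by norm_num), ENNReal.ofReal_natCast]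
        simp
      have hle : ((M : ℝ≥0∞) + 2) * moment (5 * b / 6) j (r (M + 2)) ≤
          ((M : ℝ≥0∞) + 2) * ENNReal.ofReal (gevreyMaj P Q B (M + 2) j) := by
        refine hmom.trans ?_
        rw [hM2, ← ENNReal.ofReal_mul (by positivity)]
        refine le_trans ?_ (ENNReal.ofReal_le_ofReal hfin)
        rw [ENNReal.ofReal_add, ENNReal.ofReal_mul (by positivity), ENNReal.ofReal_mul (by positivity),
          ENNReal.ofReal_mul (by positivity)]
        · gcongr
        · have := hx (M + 1) (j + 2)
          positivity
        · refine mul_nonneg (by positivity) (Finset.sum_nonneg fun l _ => Finset.sum_nonneg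
            fun p _ => mul_nonneg (hx _ _) (hx _ _))
      refine (ENNReal.mul_le_mul_iff_right ?_ ?_).1 hle
      · simp
      · rw [hM2]; exact ENNReal.ofReal_ne_top

theorem lintegral_le_gevrey {μ b n₀ n₁ B : ℝ} (hμ : 3 < μ) (hb : 0 < b) (hn₀ : 0 ≤ n₀)
    (hn₁ : 0 ≤ n₁) (hB : 0 < B)
    (hcond : 6 / b ^ 2 * B + 18 * Real.pi / b ^ 3 * n₀ * B + 2 * Real.pi / b ^ 3 * n₁ ≤ B ^ 2)
    {r : ℕ → R3 → ℝ≥0∞} (hr : ∀ N, Measurable (r N))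
    (h0 : ∀ᵐ k, r 0 k ≤ ENNReal.ofReal (n₀ * wt μ b k))
    (h1 : ∀ᵐ k, r 1 k ≤ ENNReal.ofReal (n₁ * wt μ b k))
    (hrec : ∀ M : ℕ, ∀ᵐ k, ((M : ℝ≥0∞) + 2) * r (M + 2) k ≤ ‖k‖ₑ * (‖k‖ₑ * r (M + 1) k) +
      ‖k‖ₑ * ∑ l ∈ Finset.range (M + 2), lconv (r l) (r (M + 1 - l)) k) (N : ℕ) :
    ∫⁻ k, r (N + 1) k ≤ ENNReal.ofReal (Real.pi / b ^ 2 * n₁ * B ^ N * N.factorial) := by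
  have := moment_le_gevreyMaj hμ hb hn₀ hn₁ hB hcond hr h0 h1 hrec (N + 1) 0
  rw [moment_zero] at this
  simpa [gevreyMaj, mchoose_zero_right] using this

/-! ### Fields decaying at every rate below `β` -/

/-- `g` is in the weighted space with weight `e^{-b|k|}`, for every `b < β`. -/
def Rapid (μ β : ℝ) (g : R3 → C3) : Prop := ∀ b, 0 < b → b < β → ∃ n, Datum μ b n g

section Rapid

variable {μ β : ℝ} {g h : R3 → C3}

lemma Datum.rapid {n : ℝ} (hg : Datum μ β n g) : Rapid μ β g := fun _ _ hb =>
  ⟨n, hg.meas, fun k => (hg.bound k).trans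
    (mul_le_mul_of_nonneg_left (wt_mono hb.le k) hg.nonneg)⟩

lemma Rapid.tame (hμ : 3 < μ) (hβ : 0 < β) (hg : Rapid μ β g) : Tame g := by
  obtain ⟨n, hn⟩ := hg (β / 2) (by linarith) (by linarith)
  exact hn.tame hμ (by linarith)

lemma Rapid.meas (hβ : 0 < β) (hg : Rapid μ β g) : StronglyMeasurable g := by
  obtain ⟨n, hn⟩ := hg (β / 2) (by linarith) (by linarith)
  exact hn.meas

lemma Rapid.zero : Rapid μ β (0 : R3 → C3) := fun _ _ _ =>
  ⟨0, stronglyMeasurable_zero, fun k => by simp⟩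

lemma Rapid.add (hg : Rapid μ β g) (hh : Rapid μ β h) : Rapid μ β (g + h) := by
  intro b h0 hb
  obtain ⟨n, hn⟩ := hg b h0 hb
  obtain ⟨m, hm⟩ := hh b h0 hb
  refine ⟨n + m, hn.meas.add hm.meas, fun k => ?_⟩
  rw [add_mul]
  exact (norm_add_le _ _).trans (add_le_add (hn.bound k) (hm.bound k))

lemma Rapid.const_smul (hg : Rapid μ β g) (c : ℂ) : Rapid μ β (c • g) := by
  intro b h0 hb
  obtain ⟨n, hn⟩ := hg b h0 hb
  refine ⟨‖c‖ * n, hn.meas.const_smul c, fun k => ?_⟩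
  rw [Pi.smul_apply, norm_smul, mul_assoc]
  exact mul_le_mul_of_nonneg_left (hn.bound k) (norm_nonneg c)

lemma Rapid.sub (hg : Rapid μ β g) (hh : Rapid μ β h) : Rapid μ β (g - h) := by
  have := hg.add (hh.const_smul (-1))
  rwa [neg_one_smul, ← sub_eq_add_neg] at this

lemma Rapid.sum {ι : Type*} (S : Finset ι) {G : ι → R3 → C3} (hG : ∀ i ∈ S, Rapid μ β (G i)) :
    Rapid μ β (∑ i ∈ S, G i) :=
  Finset.sum_induction _ _ (fun _ _ => Rapid.add) Rapid.zero hG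

/-- A bound at the rate halfway between b and β leaves room to absorb |k|^n. -/
lemma Rapid.of_pow_mul (hg : Rapid μ β g) (hh : StronglyMeasurable h) (n : ℕ)
    (hle : ∀ k, ‖h k‖ ≤ ‖k‖ ^ n * ‖g k‖) : Rapid μ β h := by
  intro b h0 hb
  obtain ⟨m, hm⟩ := hg ((b + β) / 2) (by linarith) (by linarith)
  have hbb : b < (b + β) / 2 := by linarith
  refine ⟨m * (n.factorial / ((b + β) / 2 - b) ^ n), hh, fun k => (hle k).trans ?_⟩
  calc ‖k‖ ^ n * ‖g k‖ ≤ ‖k‖ ^ n * (m * wt μ ((b + β) / 2) k) := by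
        gcongr; exact hm.bound k
    _ = m * (‖k‖ ^ n * wt μ ((b + β) / 2) k) := by ring
    _ ≤ m * (n.factorial / ((b + β) / 2 - b) ^ n * wt μ b k) :=
        mul_le_mul_of_nonneg_left (pow_mul_wt_le hbb n k) hm.nonneg
    _ = _ := by ring

lemma Rapid.lap (hβ : 0 < β) (hg : Rapid μ β g) :
    Rapid μ β fun k => (-((‖k‖ ^ 2 : ℝ) : ℂ)) • g k := by
  refine hg.of_pow_mul ?_ 2 fun k => ?_
  · exact StronglyMeasurable.smul
      (by fun_prop : Continuous fun k : R3 => (-((‖k‖ ^ 2 : ℝ) : ℂ))).stronglyMeasurable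
      (hg.meas hβ)
  · rw [norm_smul, norm_neg, Complex.norm_real, Real.norm_of_nonneg (by positivity)]

lemma Rapid.bil (hμ : 3 < μ) (hg : Rapid μ β g) (hh : Rapid μ β h) :
    Rapid μ β (bil g h) := by
  intro b h0 hb
  have hbb : b < (b + β) / 2 := by linarith
  obtain ⟨n, hn⟩ := hg ((b + β) / 2) (by linarith) (by linarith)
  obtain ⟨m, hm⟩ := hh ((b + β) / 2) (by linarith) (by linarith)
  have hc : 0 ≤ n * m * convConst μ :=
    mul_nonneg (mul_nonneg hn.nonneg hm.nonneg) (convConst_nonneg μ)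
  refine ⟨n * m * convConst μ * (Nat.factorial 1 / ((b + β) / 2 - b) ^ 1),
    stronglyMeasurable_bil hn.meas hm.meas, fun k => ?_⟩
  have h1 := norm_bil_le hμ (by linarith : 0 ≤ (b + β) / 2) hn.meas hm.meas hn.nonneg hm.nonneg
    hn.bound hm.bound k
  calc _ ≤ _ := h1
    _ = n * m * convConst μ * (‖k‖ ^ 1 * wt μ ((b + β) / 2) k) := by ring
    _ ≤ n * m * convConst μ * (Nat.factorial 1 / ((b + β) / 2 - b) ^ 1 * wt μ b k) :=
        mul_le_mul_of_nonneg_left (pow_mul_wt_le hbb 1 k) hc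
    _ = _ := by ring

end Rapid

lemma bil_sum_right {ι : Type*} {g : R3 → C3} (hg : Tame g) (S : Finset ι) {G : ι → R3 → C3}
    (hG : ∀ i, Tame (G i)) (k : R3) : bil g (∑ i ∈ S, G i) k = ∑ i ∈ S, bil g (G i) k := by
  classical
  have hz : ∀ k, bil g 0 k = 0 := fun k => by
    have := bil_smul_right 0 g 0 k
    simpa using this
  have ht : ∀ S : Finset ι, Tame (∑ i ∈ S, G i) := fun S =>
    Finset.sum_induction _ Tame (fun _ _ => Tame.add)
      ⟨stronglyMeasurable_zero, integrable_zero _ _ _, 0, fun k => by simp⟩ fun i _ => hG i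
  induction S using Finset.induction_on with
  | empty => simpa using hz k
  | insert i S hi ih =>
    rw [Finset.sum_insert hi, Finset.sum_insert hi, bil_add_right hg (hG i) (ht S), ih]

lemma bil_sum_left {ι : Type*} {h : R3 → C3} (hh : Tame h) (S : Finset ι) {G : ι → R3 → C3}
    (hG : ∀ i, Tame (G i)) (k : R3) : bil (∑ i ∈ S, G i) h k = ∑ i ∈ S, bil (G i) h k := by
  classical
  have hz : ∀ k, bil 0 h k = 0 := fun k => by
    have := bil_smul_left 0 0 h k
    simpa using this
  have ht : ∀ S : Finset ι, Tame (∑ i ∈ S, G i) := fun S =>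
    Finset.sum_induction _ Tame (fun _ _ => Tame.add)
      ⟨stronglyMeasurable_zero, integrable_zero _ _ _, 0, fun k => by simp⟩ fun i _ => hG i
  induction S using Finset.induction_on with
  | empty => simpa using hz k
  | insert i S hi ih =>
    rw [Finset.sum_insert hi, Finset.sum_insert hi, bil_add_left (hG i) (ht S) hh, ih]

/-! ### The formal power series solution -/

/-- The coefficients of the formal solution `∑ t^m V_m` in Fourier space. -/
def taylor (a fh : R3 → C3) : ℕ → R3 → C3
  | 0 => a
  | n + 1 => fun k => ((n : ℂ) + 1)⁻¹ • ((-((‖k‖ ^ 2 : ℝ) : ℂ)) • taylor a fh n k +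
      (if n = 0 then fh k else 0) -
      ∑ l : Fin (n + 1), bil (taylor a fh l) (taylor a fh (n - l)) k)
decreasing_by all_goals omega

lemma taylor_zero (a fh : R3 → C3) : taylor a fh 0 = a := by rw [taylor]

lemma succ_smul_taylor (a fh : R3 → C3) (n : ℕ) (k : R3) :
    ((n : ℂ) + 1) • taylor a fh (n + 1) k = (-((‖k‖ ^ 2 : ℝ) : ℂ)) • taylor a fh n k +
      (if n = 0 then fh k else 0) -
      ∑ l ∈ Finset.range (n + 1), bil (taylor a fh l) (taylor a fh (n - l)) k := by
  rw [taylor, smul_inv_smul₀ (by exact_mod_cast Nat.succ_ne_zero n),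
    Finset.sum_range (fun l => bil (taylor a fh l) (taylor a fh (n - l)) k)]

lemma taylor_one (a fh : R3 → C3) : taylor a fh 1 = v1hat a fh := by
  ext1 k
  have := succ_smul_taylor a fh 0 k
  simp only [Nat.cast_zero, zero_add, one_smul, Finset.range_one, Finset.sum_singleton,
    Nat.sub_zero, if_true, taylor_zero] at this
  rw [this]
  unfold v1hat bil
  abel

/-- Each recursion step multiplies by |k|² or |k|, which costs an arbitrarily small part of the
exponential rate. Every rate below β therefore survives at each order. -/
lemma rapid_taylor {μ β : ℝ} (hμ : 3 < μ) (hβ : 0 < β) {a fh : R3 → C3} (ha : Rapid μ β a)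
    (hf : Rapid μ β fh) (m : ℕ) : Rapid μ β (taylor a fh m) := by
  induction m using Nat.strong_induction_on with
  | _ m ih =>
    match m with
    | 0 => rwa [taylor_zero]
    | n + 1 =>
      have hif : Rapid μ β (fun k => if n = 0 then fh k else 0) := by
        split_ifs
        · exact hf
        · exact Rapid.zero
      have h := ((((ih n (by omega)).lap hβ).add hif).sub (Rapid.sum (Finset.range (n + 1))
        fun l hl => (ih l (by simpa using hl)).bil hμ (ih (n - l) (by omega)))).const_smul
        ((n : ℂ) + 1)⁻¹
      convert h using 1
      ext1 k
      simp only [Pi.smul_apply, Pi.sub_apply, Pi.add_apply, Finset.sum_apply]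
      rw [← succ_smul_taylor, inv_smul_smul₀ (by exact_mod_cast Nat.succ_ne_zero n)]

/-- Majorants of the coefficients and of the remainders of the formal solution. -/
def maj (μ β R nf : ℝ) : ℕ → R3 → ℝ≥0∞
  | 0 => fun k => ENNReal.ofReal (R * wt μ β k)
  | 1 => fun k => ENNReal.ofReal
      ((‖k‖ ^ 2 * R + nf + ‖k‖ * (R * R * convConst μ)) * wt μ β k)
  | n + 2 => fun k => ((n : ℝ≥0∞) + 2)⁻¹ * (‖k‖ₑ * (‖k‖ₑ * maj μ β R nf (n + 1) k) +
      ‖k‖ₑ * ∑ l : Fin (n + 2), lconv (maj μ β R nf l) (maj μ β R nf (n + 1 - l)) k)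
decreasing_by all_goals omega

lemma succ_mul_maj (μ β R nf : ℝ) (n : ℕ) (k : R3) :
    ((n : ℝ≥0∞) + 2) * maj μ β R nf (n + 2) k = ‖k‖ₑ * (‖k‖ₑ * maj μ β R nf (n + 1) k) +
      ‖k‖ₑ * ∑ l ∈ Finset.range (n + 2), lconv (maj μ β R nf l) (maj μ β R nf (n + 1 - l)) k := by
  rw [maj, ← mul_assoc, ENNReal.mul_inv_cancel (by simp) (by finiteness), one_mul,
    Finset.sum_range (fun l => lconv (maj μ β R nf l) (maj μ β R nf (n + 1 - l)) k)]

lemma measurable_maj (μ β R nf : ℝ) (N : ℕ) : Measurable (maj μ β R nf N) := by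
  induction N using Nat.strong_induction_on with
  | _ N ih =>
    match N with
    | 0 => rw [maj]; have := measurable_wt μ β; fun_prop
    | 1 => rw [maj]; have := measurable_wt μ β; fun_prop
    | n + 2 =>
      rw [maj]
      have h1 := ih (n + 1) (by omega)
      have h2 : Measurable fun k => ∑ l : Fin (n + 2),
          lconv (maj μ β R nf l) (maj μ β R nf (n + 1 - l)) k :=
        Finset.measurable_sum _ fun l _ =>
          measurable_lconv (ih l (by omega)) (ih (n + 1 - l) (by omega))
      fun_prop

/-! ### Domination of the formal coefficients by the recursive majorant -/

section Majorant

variable {μ β R n₀ nf : ℝ} {a fh : R3 → C3}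

/-- The recursive estimate for the coefficients. -/
lemma succ_mul_enorm_taylor_le (ht : ∀ m, Measurable (taylor a fh m)) (n : ℕ) (k : R3) :
    ((n : ℝ≥0∞) + 2) * ‖taylor a fh (n + 2) k‖ₑ ≤ ‖k‖ₑ * (‖k‖ₑ * ‖taylor a fh (n + 1) k‖ₑ) +
      ‖k‖ₑ * ∑ l ∈ Finset.range (n + 2),
        lconv (fun k => ‖taylor a fh l k‖ₑ) (fun k => ‖taylor a fh (n + 1 - l) k‖ₑ) k := by
  have h := succ_smul_taylor a fh (n + 1) k
  have e : ((n : ℝ≥0∞) + 2) * ‖taylor a fh (n + 2) k‖ₑ =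
      ‖(((n + 1 : ℕ) : ℂ) + 1) • taylor a fh (n + 1 + 1) k‖ₑ := by
    rw [enorm_smul]
    congr 1
    have : (((n + 1 : ℕ) : ℂ) + 1) = ((n + 2 : ℕ) : ℂ) := by push_cast; ring
    rw [this, ← ofReal_norm, Complex.norm_natCast, ENNReal.ofReal_natCast]
    push_cast; rfl
  rw [e, h, if_neg (Nat.succ_ne_zero n), add_zero, Finset.mul_sum]
  refine enorm_sub_le.trans (add_le_add (le_of_eq ?_) ((enorm_sum_le _ _).trans
    (Finset.sum_le_sum fun l _ => enorm_bil_le _ _ (ht _) (ht _) k)))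
  rw [enorm_smul, ← mul_assoc, ← ofReal_norm, ← ofReal_norm k, norm_neg, Complex.norm_real,
    Real.norm_of_nonneg (by positivity), sq, ENNReal.ofReal_mul (norm_nonneg k)]

/-- The majorant is built from R ≥ n₀ instead of n₀, so that it can also bound the remainders, in
which V itself is only known to be bounded by R. -/
lemma enorm_taylor_le_maj (hμ : 3 < μ) (hβ : 0 < β) (ha : Datum μ β n₀ a) (hf : Datum μ β nf fh)
    (hR : n₀ ≤ R) (m : ℕ) (k : R3) : ‖taylor a fh m k‖ₑ ≤ maj μ β R nf m k := by
  have hmeas : ∀ m, Measurable (taylor a fh m) := fun m =>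
    ((rapid_taylor hμ hβ ha.rapid hf.rapid m).meas hβ).measurable
  have ha' : ∀ k, ‖a k‖ ≤ R * wt μ β k := fun k =>
    (ha.bound k).trans (mul_le_mul_of_nonneg_right hR (wt_pos _ _ _).le)
  have hR0 : 0 ≤ R := ha.nonneg.trans hR
  induction m using Nat.strong_induction_on generalizing k with
  | _ m ih =>
    match m with
    | 0 =>
      rw [taylor_zero, maj, ← ofReal_norm]
      exact ENNReal.ofReal_le_ofReal (ha' k)
    | 1 =>
      rw [maj, ← ofReal_norm]
      refine ENNReal.ofReal_le_ofReal ?_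
      have h := succ_smul_taylor a fh 0 k
      simp only [Nat.cast_zero, zero_add, one_smul, Finset.range_one, Finset.sum_singleton,
        Nat.sub_zero, if_true, taylor_zero] at h
      rw [h]
      have hb := norm_bil_le hμ hβ.le ha.meas ha.meas hR0 hR0 ha' ha' k
      have hl : ‖(-((‖k‖ ^ 2 : ℝ) : ℂ)) • a k‖ ≤ ‖k‖ ^ 2 * (R * wt μ β k) := by
        rw [norm_smul, norm_neg, Complex.norm_real, Real.norm_of_nonneg (by positivity)]
        exact mul_le_mul_of_nonneg_left (ha' k) (by positivity)
      have h3 := norm_sub_le ((-((‖k‖ ^ 2 : ℝ) : ℂ)) • a k + fh k) (bil a a k)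
      have h4 := norm_add_le ((-((‖k‖ ^ 2 : ℝ) : ℂ)) • a k) (fh k)
      have h5 := hf.bound k
      linarith
    | n + 2 =>
      have h := succ_mul_enorm_taylor_le hmeas n k
      refine (ENNReal.mul_le_mul_iff_right (a := (n : ℝ≥0∞) + 2) (by simp) (by finiteness)).1 ?_
      rw [succ_mul_maj]
      refine h.trans ?_
      gcongr with l hl
      · exact ih (n + 1) (by omega) k
      · rw [Finset.mem_range] at hl
        exact lconv_mono (fun k => ih l hl k) (fun k => ih (n + 1 - l) (by omega) k) k

end Majorant

/-- Integration of a bound for the derivative along the ray from the boundary point `0`. -/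
lemma norm_le_of_deriv_le_pow {E : Type*} [NormedAddCommGroup E] [NormedSpace ℂ E] {α : ℝ}
    (hα : 0 < α) {g g' : ℂ → E} (hg : ∀ s ∈ timeDomain α, HasDerivAt g (g' s) s)
    (h0 : Tendsto g (𝓝[timeDomain α] 0) (𝓝 0)) {C : ℝ} {N : ℕ}
    (hC : ∀ s ∈ timeDomain α, ‖g' s‖ ≤ (N + 1) * C * ‖s‖ ^ N) {t : ℂ} (ht : t ∈ timeDomain α) :
    ‖g t‖ ≤ C * ‖t‖ ^ (N + 1) := by
  have hmem : ∀ θ : ℝ, 0 < θ → θ ≤ 1 → (θ : ℂ) * t ∈ timeDomain α := fun θ =>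
    smul_mem_timeDomain hα ht
  have hder : ∀ θ : ℝ, 0 < θ → θ ≤ 1 →
      HasDerivAt (fun θ : ℝ => g (θ * t)) (t • g' (θ * t)) θ := by
    intro θ h1 h2
    have hl : HasDerivAt (fun θ : ℝ => (θ : ℂ) * t) t θ := by
      simpa using (Complex.ofRealCLM.hasDerivAt (x := θ)).mul_const t
    exact (hg _ (hmem θ h1 h2)).scomp θ hl
  -- At 0 the function has only a limit within the domain, so the bound is integrated from εt to t
  -- and ε tends to 0 afterwards.
  have hbd : ∀ ε : ℝ, 0 < ε → ε < 1 → ‖g t - g (ε * t)‖ ≤ C * ‖t‖ ^ (N + 1) * (1 - ε ^ (N + 1)) := by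
    intro ε hε0 hε1
    have := image_norm_le_of_norm_deriv_right_le_deriv_boundary (a := ε) (b := 1)
      (f := fun θ : ℝ => g (θ * t) - g (ε * t)) (f' := fun θ => t • g' (θ * t))
      (B := fun θ : ℝ => C * ‖t‖ ^ (N + 1) * (θ ^ (N + 1) - ε ^ (N + 1)))
      (B' := fun θ : ℝ => C * ‖t‖ ^ (N + 1) * ((N + 1) * θ ^ N)) ?_ ?_ ?_ ?_ ?_
      (Set.right_mem_Icc.2 hε1.le)
    · simpa using this
    · intro θ hθ
      exact ((hder θ (hε0.trans_le hθ.1) hθ.2).sub_const _).continuousAt.continuousWithinAt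
    · intro θ hθ
      exact ((hder θ (hε0.trans_le hθ.1) hθ.2.le).sub_const _).hasDerivWithinAt
    · simp
    · intro θ
      have := ((hasDerivAt_pow (N + 1) θ).sub_const (ε ^ (N + 1))).const_mul (C * ‖t‖ ^ (N + 1))
      simpa using this
    · intro θ hθ
      have hθ0 : 0 < θ := hε0.trans_le hθ.1
      have h1 := hC _ (hmem θ hθ0 hθ.2.le)
      rw [norm_mul, Complex.norm_real, Real.norm_of_nonneg hθ0.le] at h1
      rw [norm_smul]
      calc ‖t‖ * ‖g' (θ * t)‖ ≤ ‖t‖ * ((N + 1) * C * (θ * ‖t‖) ^ N) := by gcongr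
        _ = _ := by rw [mul_pow, pow_succ]; ring
  have hlim1 : Tendsto (fun ε : ℝ => ‖g t - g (ε * t)‖) (𝓝[>] 0) (𝓝 ‖g t - 0‖) := by
    refine (tendsto_const_nhds.sub (h0.comp ?_)).norm
    refine tendsto_nhdsWithin_iff.2 ⟨?_, ?_⟩
    · have : Continuous fun ε : ℝ => (ε : ℂ) * t := by fun_prop
      have h := this.tendsto 0
      simp only [Complex.ofReal_zero, zero_mul] at h
      exact h.mono_left nhdsWithin_le_nhds
    · filter_upwards [Ioo_mem_nhdsGT (zero_lt_one' ℝ)] with ε hε using hmem ε hε.1 hε.2.le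
  have hlim2 : Tendsto (fun ε : ℝ => C * ‖t‖ ^ (N + 1) * (1 - ε ^ (N + 1))) (𝓝[>] 0)
      (𝓝 (C * ‖t‖ ^ (N + 1))) := by
    have : Continuous fun ε : ℝ => C * ‖t‖ ^ (N + 1) * (1 - ε ^ (N + 1)) := by fun_prop
    have h := this.tendsto 0
    simp only [ne_eq, Nat.succ_ne_zero, not_false_eq_true, zero_pow, sub_zero, mul_one] at h
    exact h.mono_left nhdsWithin_le_nhds
  rw [sub_zero] at hlim1
  refine le_of_tendsto_of_tendsto hlim1 hlim2 ?_
  filter_upwards [Ioo_mem_nhdsGT (zero_lt_one' ℝ)] with ε hε using hbd ε hε.1 hε.2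

/-- The remainder after `N` terms of the formal solution. -/
def flowRem (a fh : R3 → C3) (V : ℂ → R3 → C3) (N : ℕ) (t : ℂ) (k : R3) : C3 :=
  V t k - ∑ m ∈ Finset.range N, t ^ m • taylor a fh m k

lemma sum_range_triangle {E : Type*} [AddCommGroup E] [Module ℂ E] (x : ℕ → ℕ → E) (t : ℂ)
    (N : ℕ) : ∑ m ∈ Finset.range N, t ^ m • ∑ l ∈ Finset.range (m + 1), x l (m - l) =
      ∑ l ∈ Finset.range N, t ^ l • ∑ j ∈ Finset.range (N - l), t ^ j • x l j := by
  induction N with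
  | zero => simp
  | succ N ih =>
    have hstep : ∀ l ∈ Finset.range (N + 1),
        t ^ l • ∑ j ∈ Finset.range (N + 1 - l), t ^ j • x l j =
        t ^ l • ∑ j ∈ Finset.range (N - l), t ^ j • x l j + t ^ N • x l (N - l) := by
      intro l hl
      rw [Finset.mem_range] at hl
      rw [show N + 1 - l = N - l + 1 by omega, Finset.sum_range_succ, smul_add, smul_smul,
        ← pow_add, show l + (N - l) = N by omega]
    rw [Finset.sum_range_succ, ih, Finset.sum_congr rfl hstep, Finset.sum_add_distrib,
      Finset.sum_range_succ (fun l => t ^ l • ∑ j ∈ Finset.range (N - l), t ^ j • x l j) N,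
      Finset.smul_sum]
    simp

/-! ### Remainders of the formal expansion -/

section Remainder

variable {μ β α R n₀ nf : ℝ} {a fh : R3 → C3} {V : ℂ → R3 → C3}

lemma lconv_mul_const {f g : R3 → ℝ≥0∞} (hf : Measurable f) (hg : Measurable g) (c d : ℝ≥0∞)
    (k : R3) : lconv (fun k => f k * c) (fun k => g k * d) k = lconv f g k * (c * d) := by
  unfold lconv
  rw [← lintegral_mul_const _ (by fun_prop)]
  exact lintegral_congr fun k' => by ring

/-- Split V into partial sum and remainder in the left slot only. Against the term t^l V_l, the
truncated Cauchy product removes exactly the first N - l terms of V in the right slot, leaving the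
remainder of order N - l. Every contribution thus has total order N. -/
lemma bil_partial_sum (hμ : 3 < μ) (hβ : 0 < β) (hV : TimeField μ β α R V) (ha : Datum μ β n₀ a)
    (hf : Datum μ β nf fh) (N : ℕ) (t : ℂ) (k : R3) :
    bil (V t) (V t) k - ∑ m ∈ Finset.range N, t ^ m • ∑ l ∈ Finset.range (m + 1),
        bil (taylor a fh l) (taylor a fh (m - l)) k =
      bil (flowRem a fh V N t) (V t) k + ∑ l ∈ Finset.range N,
        t ^ l • bil (taylor a fh l) (flowRem a fh V (N - l) t) k := by
  have hT : ∀ m, Tame (taylor a fh m) := fun m =>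
    (rapid_taylor hμ hβ ha.rapid hf.rapid m).tame hμ hβ
  have hS : ∀ N, flowRem a fh V N t = V t - ∑ m ∈ Finset.range N, t ^ m • taylor a fh m := by
    intro N; ext1 k; simp [flowRem]
  have hTs : ∀ m, Tame (t ^ m • taylor a fh m) := fun m => (hT m).const_smul _
  have hsum : ∀ N, Tame (∑ m ∈ Finset.range N, t ^ m • taylor a fh m) := fun N =>
    Finset.sum_induction _ Tame (fun _ _ => Tame.add)
      ⟨stronglyMeasurable_zero, integrable_zero _ _ _, 0, fun k => by simp⟩ fun i _ => hTs i
  have hVt := hV.tame hμ hβ t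
  rw [sum_range_triangle (fun l j => bil (taylor a fh l) (taylor a fh j) k)]
  have h1 : ∀ l ∈ Finset.range N, t ^ l • bil (taylor a fh l) (flowRem a fh V (N - l) t) k =
      t ^ l • bil (taylor a fh l) (V t) k - t ^ l • ∑ j ∈ Finset.range (N - l),
        t ^ j • bil (taylor a fh l) (taylor a fh j) k := by
    intro l _
    rw [hS, bil_sub_right (hT l) hVt (hsum _), bil_sum_right (hT l) _ hTs, smul_sub]
    simp only [bil_smul_right]
  rw [Finset.sum_congr rfl h1, Finset.sum_sub_distrib, hS, bil_sub_left hVt (hsum _) hVt,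
    bil_sum_left hVt _ hTs]
  simp only [bil_smul_left]
  abel

/-- The recursion for the coefficients cancels all lower-order terms. The forcing cancels against
the coefficient of order one, hence N > 0. -/
lemma hasDerivAt_flowRem (hμ : 3 < μ) (hβ : 0 < β) (hV : FourierFlow μ β α R a fh V)
    (ha : Datum μ β n₀ a) (hf : Datum μ β nf fh) {N : ℕ} (hN : 0 < N) {t : ℂ}
    (ht : t ∈ timeDomain α) (k : R3) :
    HasDerivAt (fun t => flowRem a fh V (N + 1) t k)
      ((-((‖k‖ ^ 2 : ℝ) : ℂ)) • flowRem a fh V N t k - (bil (flowRem a fh V N t) (V t) k +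
        ∑ l ∈ Finset.range N, t ^ l • bil (taylor a fh l) (flowRem a fh V (N - l) t) k)) t := by
  have hp : ∀ m, HasDerivAt (fun t : ℂ => t ^ m • taylor a fh m k)
      (((m : ℂ) * t ^ (m - 1)) • taylor a fh m k) t := fun m =>
    (hasDerivAt_pow m t).smul_const _
  have hd := (hV.deriv k t ht).sub (HasDerivAt.fun_sum fun m (_ : m ∈ Finset.range (N + 1)) => hp m)
  refine hd.congr_deriv ?_
  rw [← bil_partial_sum hμ hβ hV.toTimeField ha hf]
  rw [Finset.sum_range_succ']
  have hterm : ∀ m : ℕ, (((m + 1 : ℕ) : ℂ) * t ^ (m + 1 - 1)) • taylor a fh (m + 1) k =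
      (-((‖k‖ ^ 2 : ℝ) : ℂ)) • (t ^ m • taylor a fh m k) +
      t ^ m • (if m = 0 then fh k else 0) -
      t ^ m • ∑ l ∈ Finset.range (m + 1), bil (taylor a fh l) (taylor a fh (m - l)) k := by
    intro m
    have h := succ_smul_taylor a fh m k
    rw [Nat.add_sub_cancel, mul_comm, mul_smul]
    rw [Nat.cast_succ, h, smul_sub, smul_add, smul_comm (t ^ m)]
  have hf0 : ∑ m ∈ Finset.range N, t ^ m • (if m = 0 then fh k else 0) = fh k := by
    rw [Finset.sum_eq_single 0]
    · simp
    · intro m _ hm; simp [hm]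
    · intro h; simp at h; omega
  simp only [hterm]
  rw [Finset.sum_sub_distrib, Finset.sum_add_distrib, hf0, ← Finset.smul_sum]
  unfold flowRem nonlin
  simp only [Nat.cast_zero, zero_mul, zero_smul, add_zero, smul_sub]
  abel

lemma tendsto_flowRem (hV : FourierFlow μ β α R a fh V) (N : ℕ) (k : R3) :
    Tendsto (fun t => flowRem a fh V (N + 1) t k) (𝓝[timeDomain α] 0) (𝓝 0) := by
  have h1 : Tendsto (fun t : ℂ => ∑ m ∈ Finset.range (N + 1), t ^ m • taylor a fh m k)
      (𝓝[timeDomain α] 0) (𝓝 (a k)) := by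
    have : Continuous fun t : ℂ => ∑ m ∈ Finset.range (N + 1), t ^ m • taylor a fh m k := by
      fun_prop
    have h := this.tendsto 0
    rw [Finset.sum_range_succ'] at h
    simp only [ne_eq, Nat.succ_ne_zero, not_false_eq_true, zero_pow, zero_smul,
      Finset.sum_const_zero, pow_zero, one_smul, zero_add, taylor_zero] at h
    exact h.mono_left nhdsWithin_le_nhds
  have := (hV.initial k).sub h1
  rwa [sub_self] at this

lemma measurable_flowRem (hμ : 3 < μ) (hβ : 0 < β) (hV : TimeField μ β α R V) (ha : Datum μ β n₀ a)
    (hf : Datum μ β nf fh) (N : ℕ) (t : ℂ) : Measurable (flowRem a fh V N t) := by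
  unfold flowRem
  refine (hV.meas_at t).measurable.sub (Finset.measurable_sum _ fun m _ => ?_)
  exact ((rapid_taylor hμ hβ ha.rapid hf.rapid m).meas hβ).measurable.const_smul (t ^ m)

/-- The derivative of a remainder is bounded through earlier remainders, and the remainder vanishes
at 0. Integrating along the ray divides by N, matching the recursion of the majorant. No smoothing
is used here: the factor |k|² is simply kept, since the moment estimate allows for it. -/
theorem enorm_flowRem_le_maj (hμ : 3 < μ) (hβ : 0 < β) (hα : 0 < α)
    (hV : FourierFlow μ β α R a fh V) (ha : Datum μ β n₀ a) (hf : Datum μ β nf fh) (hR : n₀ ≤ R)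
    (N : ℕ) {t : ℂ} (ht : t ∈ timeDomain α) (k : R3) :
    ‖flowRem a fh V N t k‖ₑ ≤ maj μ β R nf N k * ‖t‖ₑ ^ N := by
  have hVF := hV.toTimeField
  have hVb : ∀ t k, ‖V t k‖ₑ ≤ maj μ β R nf 0 k := by
    intro t k
    rw [maj, ← ofReal_norm]
    exact ENNReal.ofReal_le_ofReal (hVF.bound t k)
  have hTm : ∀ m k, ‖taylor a fh m k‖ₑ ≤ maj μ β R nf m k :=
    enorm_taylor_le_maj hμ hβ ha hf hR
  have hTmeas : ∀ m, Measurable (taylor a fh m) := fun m =>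
    ((rapid_taylor hμ hβ ha.rapid hf.rapid m).meas hβ).measurable
  induction N using Nat.strong_induction_on generalizing t k with
  | _ N ih =>
    match N with
    | 0 => simpa [flowRem] using hVb t k
    -- Order one is treated apart because the forcing enters only here; V is bounded directly by its
    -- norm.
    | 1 =>
      have hd : ∀ s ∈ timeDomain α, HasDerivAt (fun t => flowRem a fh V 1 t k)
          (-((‖k‖ ^ 2 : ℝ) : ℂ) • V s k + nonlin fh (V s) k) s := by
        intro s hs
        have := (hV.deriv k s hs).sub_const (a k)
        simpa [flowRem, taylor_zero] using this
      have h1 := norm_le_of_deriv_le_pow hα hd (tendsto_flowRem hV 0 k) (N := 0)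
        (C := (‖k‖ ^ 2 * R + nf + ‖k‖ * (R * R * convConst μ)) * wt μ β k) ?_ ht
      · rw [maj, ← ofReal_norm, ← ofReal_norm t, ← ENNReal.ofReal_pow (norm_nonneg t),
          ← ENNReal.ofReal_mul' (by positivity)]
        exact ENNReal.ofReal_le_ofReal h1
      · intro s hs
        have h2 := hVF.norm_nonlin_le hμ hβ hf s k
        have hl : ‖(-((‖k‖ ^ 2 : ℝ) : ℂ)) • V s k‖ ≤ ‖k‖ ^ 2 * (R * wt μ β k) := by
          rw [norm_smul, norm_neg, Complex.norm_real, Real.norm_of_nonneg (by positivity)]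
          exact mul_le_mul_of_nonneg_left (hVF.bound s k) (by positivity)
        refine (norm_add_le _ _).trans ?_
        simp only [Nat.cast_zero, zero_add, one_mul, pow_zero, mul_one]
        linarith
    | M + 2 =>
      have ht0 : ‖t‖ₑ ≠ 0 := by simpa using ne_zero_of_mem_timeDomain hα ht
      -- At a wave number where the majorant is infinite there is nothing to prove, because t ≠ 0.
      by_cases htop : maj μ β R nf (M + 2) k = ⊤
      · rw [htop, ENNReal.top_mul (pow_ne_zero _ ht0)]
        exact le_top
      have hbil : ∀ s ∈ timeDomain α, ∀ l ∈ Finset.range (M + 1),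
          ‖s ^ l • bil (taylor a fh l) (flowRem a fh V (M + 1 - l) s) k‖ₑ ≤
          ‖k‖ₑ * (lconv (maj μ β R nf l) (maj μ β R nf (M + 1 - l)) k * ‖s‖ₑ ^ (M + 1)) := by
        intro s hs l hl
        rw [Finset.mem_range] at hl
        rw [enorm_smul, enorm_pow]
        have h2 : lconv (fun k => ‖taylor a fh l k‖ₑ)
            (fun k => ‖flowRem a fh V (M + 1 - l) s k‖ₑ) k ≤
            lconv (fun k => maj μ β R nf l k * 1)
              (fun k => maj μ β R nf (M + 1 - l) k * ‖s‖ₑ ^ (M + 1 - l)) k := by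
          refine lconv_mono (fun k => ?_) (fun k => ?_) k
          · simpa using hTm l k
          · by_cases hl0 : l = 0
            · subst hl0
              exact ih (M + 1) (by omega) hs k
            · exact ih (M + 1 - l) (by omega) hs k
        rw [lconv_mul_const (measurable_maj ..) (measurable_maj ..), one_mul] at h2
        calc _ ≤ ‖s‖ₑ ^ l * (‖k‖ₑ * (lconv (maj μ β R nf l) (maj μ β R nf (M + 1 - l)) k *
              ‖s‖ₑ ^ (M + 1 - l))) := by
              gcongr
              refine (enorm_bil_le _ _ (hTmeas l)
                (measurable_flowRem hμ hβ hVF ha hf _ s) k).trans ?_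
              gcongr
          _ = ‖k‖ₑ * (lconv (maj μ β R nf l) (maj μ β R nf (M + 1 - l)) k *
              (‖s‖ₑ ^ l * ‖s‖ₑ ^ (M + 1 - l))) := by ring
          _ = _ := by rw [← pow_add, show l + (M + 1 - l) = M + 1 by omega]
      have hbil0 : ∀ s ∈ timeDomain α, ‖bil (flowRem a fh V (M + 1) s) (V s) k‖ₑ ≤
          ‖k‖ₑ * (lconv (maj μ β R nf (M + 1)) (maj μ β R nf (M + 1 - (M + 1))) k *
            ‖s‖ₑ ^ (M + 1)) := by
        intro s hs
        refine (enorm_bil_le _ _ (measurable_flowRem hμ hβ hVF ha hf _ s)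
          (hVF.meas_at s).measurable k).trans ?_
        gcongr
        rw [Nat.sub_self]
        have h2 : lconv (fun k => ‖flowRem a fh V (M + 1) s k‖ₑ) (fun k => ‖V s k‖ₑ) k ≤
            lconv (fun k => maj μ β R nf (M + 1) k * ‖s‖ₑ ^ (M + 1))
              (fun k => maj μ β R nf 0 k * 1) k := by
          refine lconv_mono (fun k => ih (M + 1) (by omega) hs k) (fun k => ?_) k
          simpa using hVb s k
        rwa [lconv_mul_const (measurable_maj ..) (measurable_maj ..), mul_one] at h2
      set C := (maj μ β R nf (M + 2) k).toReal with hC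
      have hCe : ENNReal.ofReal C = maj μ β R nf (M + 2) k := ENNReal.ofReal_toReal htop
      have h1 := norm_le_of_deriv_le_pow hα (N := M + 1) (C := C)
        (fun s hs => hasDerivAt_flowRem hμ hβ hV ha hf (Nat.succ_pos M) hs k)
        (tendsto_flowRem hV (M + 1) k) ?_ ht
      · rw [← hCe, ← ofReal_norm, ← ofReal_norm t, ← ENNReal.ofReal_pow (norm_nonneg t),
          ← ENNReal.ofReal_mul' (by positivity)]
        exact ENNReal.ofReal_le_ofReal h1
      · intro s hs
        have h2 : ‖(-((‖k‖ ^ 2 : ℝ) : ℂ)) • flowRem a fh V (M + 1) s k -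
            (bil (flowRem a fh V (M + 1) s) (V s) k + ∑ l ∈ Finset.range (M + 1),
              s ^ l • bil (taylor a fh l) (flowRem a fh V (M + 1 - l) s) k)‖ₑ ≤
            ((M : ℝ≥0∞) + 2) * maj μ β R nf (M + 2) k * ‖s‖ₑ ^ (M + 1) := by
          rw [succ_mul_maj, add_mul]
          refine enorm_sub_le.trans (add_le_add ?_ ?_)
          · rw [enorm_smul, ← mul_assoc, mul_assoc (‖k‖ₑ * ‖k‖ₑ)]
            have e : ‖(-((‖k‖ ^ 2 : ℝ) : ℂ))‖ₑ = ‖k‖ₑ * ‖k‖ₑ := by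
              rw [← ofReal_norm, ← ofReal_norm k, norm_neg, Complex.norm_real,
                Real.norm_of_nonneg (by positivity), sq, ENNReal.ofReal_mul (norm_nonneg k)]
            rw [e]
            gcongr
            exact ih (M + 1) (by omega) hs k
          -- The term with V itself in the right slot is matched with l = M + 1 in the majorant,
          -- since `maj` of index 0 bounds V.
          · rw [mul_assoc, Finset.sum_mul, Finset.mul_sum, Finset.sum_range_succ _ (M + 1), add_comm]
            exact (enorm_add_le _ _).trans (add_le_add
              ((enorm_sum_le _ _).trans (Finset.sum_le_sum (hbil s hs))) (hbil0 s hs))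
        rw [← ofReal_norm, ← hCe, ← ofReal_norm s, ← ENNReal.ofReal_pow (norm_nonneg s)] at h2
        have hM2 : ((M : ℝ≥0∞) + 2) = ENNReal.ofReal ((M : ℝ) + 2) := by
          rw [ENNReal.ofReal_add (by positivity) (by norm_num), ENNReal.ofReal_natCast]
          simp
        rw [hM2, ← ENNReal.ofReal_mul (by positivity), ← ENNReal.ofReal_mul (by positivity),
          ENNReal.ofReal_le_ofReal_iff (by positivity)] at h2
        rwa [show ((M + 1 : ℕ) : ℝ) + 1 = M + 2 by push_cast; ring]

end Remainder

/-! ### Gevrey bounds for the coefficients and the majorants -/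

section Gevrey

variable {μ β R n₀ nf : ℝ} {a fh : R3 → C3}

/-- The Gevrey estimate for the coefficients of the formal solution. -/
lemma lintegral_taylor_le {n₁ B : ℝ} (hμ : 3 < μ) (hβ : 0 < β) (ha : Datum μ β n₀ a)
    (hf : Rapid μ β fh) (hn₁ : 0 ≤ n₁) (hB : 0 < B)
    (h1 : ∀ᵐ k, ‖taylor a fh 1 k‖ ≤ n₁ * wt μ β k)
    (hcond : 6 / β ^ 2 * B + 18 * Real.pi / β ^ 3 * n₀ * B + 2 * Real.pi / β ^ 3 * n₁ ≤ B ^ 2)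
    (N : ℕ) : ∫⁻ k, ‖taylor a fh (N + 1) k‖ₑ ≤
      ENNReal.ofReal (Real.pi / β ^ 2 * n₁ * B ^ N * N.factorial) := by
  have hm : ∀ m, Measurable (taylor a fh m) := fun m =>
    ((rapid_taylor hμ hβ ha.rapid hf m).meas hβ).measurable
  refine lintegral_le_gevrey hμ hβ ha.nonneg hn₁ hB hcond (r := fun m k => ‖taylor a fh m k‖ₑ)
    (fun m => (hm m).enorm) ?_ ?_ ?_ N
  · refine Eventually.of_forall fun k => ?_
    rw [taylor_zero, ← ofReal_norm]
    exact ENNReal.ofReal_le_ofReal (ha.bound k)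
  · filter_upwards [h1] with k hk
    rw [← ofReal_norm]
    exact ENNReal.ofReal_le_ofReal hk
  · exact fun M => Eventually.of_forall fun k => succ_mul_enorm_taylor_le hm M k

/-- By the triangle inequality the exponential weight is submultiplicative. Hence e^{β'|k|} times
the majorant satisfies the same recursive inequality as the majorant. -/
lemma ofReal_exp_mul_lconv_le {b : ℝ} (hb : 0 ≤ b) {f g : R3 → ℝ≥0∞} (hf : Measurable f)
    (hg : Measurable g) (k : R3) : ENNReal.ofReal (Real.exp (b * ‖k‖)) * lconv f g k ≤
      lconv (fun k => ENNReal.ofReal (Real.exp (b * ‖k‖)) * f k)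
        (fun k => ENNReal.ofReal (Real.exp (b * ‖k‖)) * g k) k := by
  unfold lconv
  rw [← lintegral_const_mul _ (by fun_prop)]
  refine lintegral_mono fun k' => ?_
  have h : ENNReal.ofReal (Real.exp (b * ‖k‖)) ≤ ENNReal.ofReal (Real.exp (b * ‖k'‖)) *
      ENNReal.ofReal (Real.exp (b * ‖k - k'‖)) := by
    rw [← ENNReal.ofReal_mul (Real.exp_nonneg _), ← Real.exp_add, ← mul_add]
    refine ENNReal.ofReal_le_ofReal (Real.exp_le_exp.2 (mul_le_mul_of_nonneg_left ?_ hb))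
    simpa using norm_add_le k' (k - k')
  calc _ ≤ ENNReal.ofReal (Real.exp (b * ‖k'‖)) * ENNReal.ofReal (Real.exp (b * ‖k - k'‖)) *
        (f k' * g (k - k')) := by gcongr
    _ = _ := by ring

lemma quadratic_le_sq {x c d : ℝ} (hc : 0 ≤ c) (hd : 0 ≤ d) (hx : 1 + c + d ≤ x) :
    c * x + d ≤ x ^ 2 := by nlinarith [mul_nonneg hd (by linarith : 0 ≤ x - 1)]

/-- The Gevrey estimate for the majorants, with an exponential weight. -/
lemma exists_lintegral_maj_le {β' : ℝ} (hμ : 3 < μ) (hβ' : 0 < β') (hββ' : β' < β) (hR : 0 ≤ R)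
    (hnf : 0 ≤ nf) : ∃ K B : ℝ, 0 < K ∧ 0 < B ∧ ∀ N : ℕ,
      ∫⁻ k, ENNReal.ofReal (Real.exp (β' * ‖k‖)) * maj μ β R nf N k ≤
        ENNReal.ofReal (K * B ^ N * N.factorial) := by
  -- The weight e^{β'|k|} leaves the rate β - β'. Half of it absorbs the powers of |k| in the
  -- majorant of order one, and the other half is the rate b of the moment estimate.
  set b := (β - β') / 2 with hbdef
  have hb : 0 < b := by rw [hbdef]; linarith
  have hbb : b < β - β' := by rw [hbdef]; linarith
  have hpi := Real.pi_pos
  have hcC := convConst_nonneg μ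
  set n₁ := R * (Nat.factorial 2 / (β - β' - b) ^ 2) + nf +
    R * R * convConst μ * (Nat.factorial 1 / (β - β' - b) ^ 1) with hn₁def
  have hpos : 0 < β - β' - b := by linarith
  have hn₁ : 0 ≤ n₁ := by positivity
  -- Chosen so that `quadratic_le_sq` yields the condition of the moment estimate.
  set B := 1 + (6 / b ^ 2 + 18 * Real.pi / b ^ 3 * R) + 2 * Real.pi / b ^ 3 * n₁ with hBdef
  have hB : 0 < B := by positivity
  have hcond : 6 / b ^ 2 * B + 18 * Real.pi / b ^ 3 * R * B + 2 * Real.pi / b ^ 3 * n₁ ≤ B ^ 2 := by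
    have := quadratic_le_sq (x := B) (c := 6 / b ^ 2 + 18 * Real.pi / b ^ 3 * R)
      (d := 2 * Real.pi / b ^ 3 * n₁) (by positivity) (by positivity) le_rfl
    linarith
  set r : ℕ → R3 → ℝ≥0∞ := fun N k => ENNReal.ofReal (Real.exp (β' * ‖k‖)) * maj μ β R nf N k
    with hr
  have hmm : ∀ N, Measurable (maj μ β R nf N) := measurable_maj μ β R nf
  have hrm : ∀ N, Measurable (r N) := fun N => by
    have := hmm N
    simp only [hr]
    fun_prop
  have hr0 : ∀ k, r 0 k ≤ ENNReal.ofReal (R * wt μ b k) := by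
    intro k
    simp only [hr]
    rw [maj, ← ENNReal.ofReal_mul (Real.exp_nonneg _), mul_left_comm, exp_mul_wt]
    exact ENNReal.ofReal_le_ofReal (mul_le_mul_of_nonneg_left (wt_mono hbb.le k) hR)
  have hr1 : ∀ k, r 1 k ≤ ENNReal.ofReal (n₁ * wt μ b k) := by
    intro k
    simp only [hr]
    rw [maj, ← ENNReal.ofReal_mul (Real.exp_nonneg _), mul_left_comm, exp_mul_wt]
    refine ENNReal.ofReal_le_ofReal ?_
    have t2 := mul_le_mul_of_nonneg_left (pow_mul_wt_le (μ := μ) hbb 2 k) hR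
    have t1 := mul_le_mul_of_nonneg_left (pow_mul_wt_le (μ := μ) hbb 1 k)
      (by positivity : 0 ≤ R * R * convConst μ)
    have t0 := mul_le_mul_of_nonneg_left (wt_mono (μ := μ) hbb.le k) hnf
    rw [hn₁def]
    simp only [pow_one] at t1 ⊢
    linarith
  have hrec : ∀ M : ℕ, ∀ k, ((M : ℝ≥0∞) + 2) * r (M + 2) k ≤ ‖k‖ₑ * (‖k‖ₑ * r (M + 1) k) +
      ‖k‖ₑ * ∑ l ∈ Finset.range (M + 2), lconv (r l) (r (M + 1 - l)) k := by
    intro M k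
    simp only [hr]
    rw [mul_left_comm, succ_mul_maj, mul_add]
    refine add_le_add (le_of_eq (by ring)) ?_
    rw [mul_left_comm, Finset.mul_sum]
    gcongr with l _
    exact ofReal_exp_mul_lconv_le hβ'.le (hmm _) (hmm _) k
  have hmain := lintegral_le_gevrey hμ hb hR hn₁ hB hcond hrm (Eventually.of_forall hr0)
    (Eventually.of_forall hr1) fun M => Eventually.of_forall (hrec M)
  have hI0 : ∫⁻ k, r 0 k ≤ ENNReal.ofReal (R * ∫ k, wt μ b k) := by
    rw [← integral_const_mul, ofReal_integral_eq_lintegral_ofReal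
      ((integrable_wt hμ hb.le).const_mul R)
      (Eventually.of_forall fun k => mul_nonneg hR (wt_pos _ _ _).le)]
    exact lintegral_mono hr0
  have hI : 0 ≤ ∫ k, wt μ b k := integral_nonneg fun k => (wt_pos _ _ _).le
  refine ⟨1 + R * (∫ k, wt μ b k) + Real.pi / b ^ 2 * n₁ / B, B, by positivity, hB, fun N => ?_⟩
  cases N with
  | zero =>
    refine hI0.trans (ENNReal.ofReal_le_ofReal ?_)
    simp only [pow_zero, Nat.factorial_zero, Nat.cast_one, mul_one]
    have : 0 ≤ Real.pi / b ^ 2 * n₁ / B := by positivity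
    linarith
  | succ N =>
    refine (hmain N).trans (ENNReal.ofReal_le_ofReal ?_)
    have hfac : (N.factorial : ℝ) ≤ (N + 1).factorial := by
      exact_mod_cast Nat.factorial_le (Nat.le_succ N)
    calc Real.pi / b ^ 2 * n₁ * B ^ N * N.factorial
        = (Real.pi / b ^ 2 * n₁ / B) * B ^ (N + 1) * N.factorial := by
          rw [pow_succ B N]; field_simp
      _ ≤ (1 + R * (∫ k, wt μ b k) + Real.pi / b ^ 2 * n₁ / B) * B ^ (N + 1) *
          (N + 1).factorial := by
          gcongr
          have : 0 ≤ R * ∫ k, wt μ b k := by positivity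
          linarith

lemma C0_nonneg (hμ : 3 < μ) : 0 ≤ C0 μ := by
  unfold C0
  have h1 : 0 < μ - 1 := by linarith
  have h2 : 0 < μ - 2 := by linarith
  have h3 : 0 < μ - 3 := by linarith
  positivity

/-- With A₀ = 1 the first condition is a lower bound for B₀, and the other two have the form c B₀ +
d ≤ B₀². One B₀ exceeding 1 plus all the coefficients satisfies them together. -/
lemma exists_gevreyConstants {n₁ : ℝ} (hμ : 3 < μ) (hβ : 0 < β) (hn₀ : 0 ≤ n₀) (hn₁ : 0 ≤ n₁) :
    ∃ A₀ B₀ : ℝ, GevreyConstants μ β n₀ n₁ A₀ B₀ := by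
  have hpi := Real.pi_pos
  have hC := C0_nonneg hμ
  set x := 18 / β ^ 2 * n₁ * (1 + β * C0 μ * n₀) with hx
  set c := 3 / β ^ 2 + n₀ * (2 ^ μ * 36 * Real.pi / β ^ 2) with hc
  set d := C0 μ / β * n₁ ^ 2 with hd
  set c' := 6 / β ^ 2 + 2 ^ μ * (18 * Real.pi / β ^ 3) * n₀ with hc'
  set d' := 2 ^ μ * 18 * Real.pi / β ^ 3 * n₁ + 9 * 1 * 2 ^ μ / β ^ 3 with hd'
  have i1 : 0 ≤ x := by positivity
  have i2 : 0 ≤ c := by positivity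
  have i3 : 0 ≤ d := by positivity
  have i4 : 0 ≤ c' := by positivity
  have i5 : 0 ≤ d' := by positivity
  set B := 1 + x + c + d + c' + d' with hB
  have q1 := quadratic_le_sq (x := B) i2 i3 (by linarith)
  have q2 := quadratic_le_sq (x := B) i4 i5 (by linarith)
  refine ⟨1, B, one_pos, by linarith, by linarith, ?_, ?_⟩
  · calc _ = c * B + d := by rw [hc, hd]; ring
      _ ≤ _ := by linarith
  · calc _ = c' * B + d' := by rw [hc', hd']; ring
      _ ≤ _ := by linarith

/-- The conditions on the Gevrey constants imply the estimate of the coefficients. -/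
lemma GevreyConstants.lintegral_taylor_le {n₁ A₀ B₀ : ℝ} (h : GevreyConstants μ β n₀ n₁ A₀ B₀)
    (hμ : 3 < μ) (hβ : 0 < β) (ha : Datum μ β n₀ a) (hf : Rapid μ β fh) (hn₁ : 0 ≤ n₁)
    (h1 : ∀ᵐ k, ‖taylor a fh 1 k‖ ≤ n₁ * wt μ β k) {m : ℕ} (hm : 1 ≤ m) :
    ∫⁻ k, ‖taylor a fh m k‖ₑ ≤ ENNReal.ofReal (m.factorial * A₀ * B₀ ^ m) := by
  obtain ⟨N, rfl⟩ : ∃ N, m = N + 1 := ⟨m - 1, by omega⟩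
  have hpi := Real.pi_pos
  have hpi4 := Real.pi_le_four
  have hA := h.A_pos
  have hB := h.B_pos
  have hn₀ := ha.nonneg
  have h2 : (1 : ℝ) ≤ 2 ^ μ := Real.one_le_rpow (by norm_num) (by linarith)
  -- The third condition is stronger term by term, since 2^μ ≥ 1 and its A₀ term is nonnegative.
  have hcond : 6 / β ^ 2 * B₀ + 18 * Real.pi / β ^ 3 * n₀ * B₀ + 2 * Real.pi / β ^ 3 * n₁ ≤
      B₀ ^ 2 := by
    refine le_trans ?_ h.third
    have e1 : 18 * Real.pi / β ^ 3 * n₀ * B₀ ≤ 2 ^ μ * (18 * Real.pi / β ^ 3) * B₀ * n₀ := by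
      calc _ = 1 * ((18 * Real.pi / β ^ 3) * B₀ * n₀) := by ring
        _ ≤ 2 ^ μ * ((18 * Real.pi / β ^ 3) * B₀ * n₀) :=
          mul_le_mul_of_nonneg_right h2 (by positivity)
        _ = _ := by ring
    have e2 : 2 * Real.pi / β ^ 3 * n₁ ≤ 2 ^ μ * 18 * Real.pi / β ^ 3 * n₁ := by
      gcongr
      linarith
    have e3 : 0 ≤ 9 * A₀ * 2 ^ μ / β ^ 3 := by positivity
    linarith
  refine (NSBorel.lintegral_taylor_le hμ hβ ha hf hn₁ hB h1 hcond N).trans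
    (ENNReal.ofReal_le_ofReal ?_)
  have hAB : Real.pi / β ^ 2 * n₁ ≤ A₀ * B₀ := by
    refine le_trans ?_ h.first
    have hC := C0_nonneg hμ
    have e : 1 ≤ 1 + β * C0 μ * n₀ := by
      have : 0 ≤ β * C0 μ * n₀ := by positivity
      linarith
    calc Real.pi / β ^ 2 * n₁ ≤ 18 / β ^ 2 * n₁ := by gcongr; linarith
      _ ≤ 18 / β ^ 2 * n₁ * (1 + β * C0 μ * n₀) := le_mul_of_one_le_right (by positivity) e
  have hfac : (N.factorial : ℝ) ≤ (N + 1).factorial := by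
    exact_mod_cast Nat.factorial_le (Nat.le_succ N)
  calc Real.pi / β ^ 2 * n₁ * B₀ ^ N * N.factorial ≤ A₀ * B₀ * B₀ ^ N * (N + 1).factorial := by
        gcongr
    _ = _ := by rw [pow_succ]; ring

end Gevrey

/-! ### The circle `Re (1/t) = c` -/

/-- The point of the circle `Re (1/t) = c` with parameter `θ`. -/
abbrev rim (c : ℝ) (θ : ℝ) : ℂ := circleMap ((1 / (2 * c) : ℝ) : ℂ) (1 / (2 * c)) θ

lemma rim_re {c : ℝ} (hc : 0 < c) (θ : ℝ) : (rim c θ).re = c * ‖rim c θ‖ ^ 2 := by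
  have h1 : ‖rim c θ - ((1 / (2 * c) : ℝ) : ℂ)‖ ^ 2 = (1 / (2 * c)) ^ 2 := by
    have := circleMap_mem_sphere ((1 / (2 * c) : ℝ) : ℂ) (by positivity : 0 ≤ 1 / (2 * c)) θ
    rw [mem_sphere_iff_norm] at this
    rw [this]
  rw [← Complex.normSq_eq_norm_sq, Complex.normSq_apply, Complex.sub_re, Complex.sub_im,
    Complex.ofReal_re, Complex.ofReal_im] at h1
  rw [← Complex.normSq_eq_norm_sq, Complex.normSq_apply]
  field_simp at h1
  nlinarith

lemma inv_re_rim {c : ℝ} (hc : 0 < c) {θ : ℝ} (h : rim c θ ≠ 0) : ((rim c θ)⁻¹).re = c := by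
  rw [Complex.inv_re, rim_re hc, Complex.normSq_eq_norm_sq]
  have : ‖rim c θ‖ ≠ 0 := norm_ne_zero_iff.2 h
  field_simp

lemma rim_mem_timeDomain {α c : ℝ} (hα : 0 < α) (hc : α < c) {θ : ℝ} (h : rim c θ ≠ 0) :
    rim c θ ∈ timeDomain α := by
  unfold timeDomain
  rw [Set.mem_ofPred_eq, one_div, inv_re_rim (hα.trans hc) h]
  exact hc

lemma norm_rim_le {c : ℝ} (hc : 0 < c) (θ : ℝ) : ‖rim c θ‖ ≤ 1 / c := by
  have h := rim_re hc θ
  have h2 := Complex.re_le_norm (rim c θ)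
  rcases (norm_nonneg (rim c θ)).eq_or_lt with h0 | h0
  · rw [← h0]; positivity
  · rw [le_div_iff₀ hc]
    nlinarith

lemma norm_exp_div_rim_le {c : ℝ} (hc : 0 < c) {θ : ℝ} (h : rim c θ ≠ 0) (q : ℝ) :
    ‖Complex.exp (q / rim c θ)‖ = Real.exp (c * q) := by
  rw [Complex.norm_exp, div_eq_mul_inv, Complex.re_ofReal_mul, inv_re_rim hc h, mul_comm]

lemma continuous_rim (c : ℝ) : Continuous (rim c) := continuous_circleMap _ _

lemma circleMap_eq_zero_iff_of_mem {x : ℝ} (hx : 0 < x) {θ : ℝ} (hθ : θ ∈ Set.Ioc 0 (2 * Real.pi))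
    (h : circleMap (x : ℂ) x θ = 0) : θ = Real.pi := by
  have h1 : (circleMap (x : ℂ) x θ).re = 0 := by rw [h]; simp
  rw [circleMap] at h1
  rw [Complex.add_re, Complex.ofReal_re, Complex.re_ofReal_mul, Complex.exp_ofReal_mul_I_re] at h1
  have hcos : Real.cos (θ - Real.pi) = 1 := by
    rw [Real.cos_sub_pi]
    have : x * (1 + Real.cos θ) = 0 := by linarith
    rcases mul_eq_zero.1 this with h2 | h2 <;> linarith
  have hpi := Real.pi_pos
  have := (Real.cos_eq_one_iff_of_lt_of_lt (by linarith [hθ.1]) (by linarith [hθ.2])).1 hcos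
  linarith

lemma ae_rim_ne_zero {c : ℝ} (hc : 0 < c) :
    ∀ᵐ θ : ℝ, θ ∈ Set.uIoc 0 (2 * Real.pi) → rim c θ ≠ 0 := by
  have : ∀ᵐ θ : ℝ, θ ≠ Real.pi := by simp [ae_iff, measure_singleton]
  filter_upwards [this] with θ h1 h2 h3
  rw [Set.uIoc_of_le (by positivity)] at h2
  exact h1 (circleMap_eq_zero_iff_of_mem (by positivity) h2 h3)

/-- Expand the exponential and integrate term by term. Only the term 1/t contributes, with residue
q. -/
lemma circleIntegral_exp_div {z : ℂ} {R : ℝ} (hR : ‖z‖ < R) (q : ℂ) :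
    (∮ t in C(z, R), Complex.exp (q / t)) = 2 * Real.pi * Complex.I * q := by
  have hR0 : 0 < R := (norm_nonneg z).trans_lt hR
  have hlow : ∀ θ, R - ‖z‖ ≤ ‖circleMap z R θ‖ := by
    intro θ
    have h1 := circleMap_mem_sphere z hR0.le θ
    rw [mem_sphere_iff_norm] at h1
    have h2 := norm_sub_le (circleMap z R θ) z
    linarith
  have hne : ∀ θ, circleMap z R θ ≠ 0 := fun θ h => by
    have := hlow θ
    rw [h, norm_zero] at this
    linarith
  have hs : HasSum (fun n : ℕ => ∮ t in C(z, R), (q / t) ^ n / n.factorial)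
      (∮ t in C(z, R), Complex.exp (q / t)) := by
    refine intervalIntegral.hasSum_integral_of_dominated_convergence
      (fun n _ => R * ((‖q‖ / (R - ‖z‖)) ^ n / n.factorial)) ?_ ?_ ?_ ?_ ?_
    · intro n
      refine Continuous.aestronglyMeasurable ?_
      simp only [deriv_circleMap]
      have h1 : Continuous (circleMap z R) := continuous_circleMap _ _
      have h2 : Continuous fun θ => q / circleMap z R θ := continuous_const.div h1 hne
      have h3 : Continuous (circleMap 0 R) := continuous_circleMap _ _
      fun_prop
    · intro n
      refine Eventually.of_forall fun θ _ => ?_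
      simp only [deriv_circleMap]
      rw [norm_smul, norm_mul, norm_circleMap_zero, Complex.norm_I, mul_one, abs_of_pos hR0,
        norm_div, norm_pow, norm_div, Complex.norm_natCast]
      have : 0 < R - ‖z‖ := by linarith
      gcongr
      exact hlow θ
    · refine Eventually.of_forall fun θ _ => ?_
      exact (Real.summable_pow_div_factorial _).mul_left _
    · exact intervalIntegrable_const
    · refine Eventually.of_forall fun θ _ => ?_
      refine HasSum.const_smul _ ?_
      rw [Complex.exp_eq_exp_ℂ]
      exact NormedSpace.expSeries_div_hasSum_exp (q / circleMap z R θ)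
  have hterm : ∀ n : ℕ, (∮ t in C(z, R), (q / t) ^ n / n.factorial) =
      if n = 1 then 2 * Real.pi * Complex.I * q else 0 := by
    intro n
    have e : (∮ t in C(z, R), (q / t) ^ n / n.factorial) =
        (q ^ n / n.factorial) * ∮ t in C(z, R), (t - 0) ^ (-(n : ℤ)) := by
      rw [← circleIntegral.integral_const_mul]
      congr 1
      ext t
      rw [sub_zero, zpow_neg, zpow_natCast, div_pow]
      ring
    rw [e]
    split_ifs with hn
    · subst hn
      have := circleIntegral.integral_sub_inv_of_mem_ball (c := z) (w := 0) (R := R)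
        (by simpa [Metric.mem_ball, dist_eq_norm] using hR)
      simp only [Nat.cast_one, zpow_neg_one, pow_one, Nat.factorial_one, div_one]
      rw [this]; ring
    · rw [circleIntegral.integral_sub_zpow_of_ne (by omega), mul_zero]
  rw [← hs.tsum_eq]
  simp only [hterm]
  rw [tsum_ite_eq]

/-- The circle passes through the essential singularity at 0. It is approached by circles of radius
x + ε enclosing 0, for which the value is known, by dominated convergence. -/
lemma circleIntegral_exp_div_rim {c : ℝ} (hc : 0 < c) {q : ℝ} (hq : 0 ≤ q) :
    (∮ t in C(((1 / (2 * c) : ℝ) : ℂ), 1 / (2 * c)), Complex.exp (q / t)) =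
      2 * Real.pi * Complex.I * q := by
  set x : ℝ := 1 / (2 * c) with hx
  have hx0 : 0 < x := by positivity
  have hlim : Tendsto (fun ε : ℝ => ∮ t in C((x : ℂ), x + ε), Complex.exp (q / t)) (𝓝[>] 0)
      (𝓝 (∮ t in C((x : ℂ), x), Complex.exp (q / t))) := by
    refine intervalIntegral.tendsto_integral_filter_of_dominated_convergence
      (fun _ => (x + 1) * Real.exp (c * q)) ?_ ?_ intervalIntegrable_const ?_
    · refine Eventually.of_forall fun ε => Measurable.aestronglyMeasurable ?_
      simp only [deriv_circleMap]
      have h1 : Measurable (circleMap (x : ℂ) (x + ε)) := (continuous_circleMap _ _).measurable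
      have h3 : Measurable (circleMap 0 (x + ε)) := (continuous_circleMap _ _).measurable
      simp only [smul_eq_mul]
      fun_prop
    · filter_upwards [Ioo_mem_nhdsGT (zero_lt_one' ℝ)] with ε hε
      refine Eventually.of_forall fun θ _ => ?_
      simp only [deriv_circleMap]
      rw [norm_smul, norm_mul, norm_circleMap_zero, Complex.norm_I, mul_one,
        abs_of_pos (by linarith [hε.1]), Complex.norm_exp]
      have h1 := circleMap_mem_sphere (x : ℂ) (by linarith [hε.1] : 0 ≤ x + ε) θ
      rw [mem_sphere_iff_norm] at h1
      set s := circleMap (x : ℂ) (x + ε) θ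
      have h2 : 0 ≤ Complex.normSq s - 2 * x * s.re := by
        have h3 : ‖s - x‖ ^ 2 = (x + ε) ^ 2 := by rw [h1]
        rw [← Complex.normSq_eq_norm_sq, Complex.normSq_apply, Complex.sub_re, Complex.sub_im,
          Complex.ofReal_re, Complex.ofReal_im] at h3
        rw [Complex.normSq_apply]
        nlinarith [hε.1]
      have h3 : (s⁻¹).re ≤ c := by
        rw [Complex.inv_re]
        rcases (Complex.normSq_nonneg s).eq_or_lt with h0 | h0
        · rw [← h0, div_zero]; exact hc.le
        · rw [div_le_iff₀ h0]
          have : 2 * x * c = 1 := by rw [hx]; field_simp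
          nlinarith
      rw [div_eq_mul_inv, Complex.re_ofReal_mul]
      refine mul_le_mul (by linarith [hε.2]) (Real.exp_le_exp.2 ?_) (Real.exp_nonneg _)
        (by linarith)
      nlinarith
    · filter_upwards [ae_rim_ne_zero hc] with θ hθ hmem
      simp only [deriv_circleMap]
      have hcm : ∀ y : ℂ, Continuous fun ε : ℝ => circleMap y (x + ε) θ := fun y => by
        unfold circleMap; fun_prop
      have h1 : ContinuousAt (fun ε : ℝ => (circleMap 0 (x + ε) θ * Complex.I) •
          Complex.exp (q / circleMap (x : ℂ) (x + ε) θ)) 0 := by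
        have h2 : circleMap (x : ℂ) (x + 0) θ ≠ 0 := by rw [add_zero]; exact hθ hmem
        have h3 : ContinuousAt (fun ε : ℝ => (q : ℂ) / circleMap (x : ℂ) (x + ε) θ) 0 :=
          continuousAt_const.div (hcm _).continuousAt h2
        exact ((hcm 0).continuousAt.mul continuousAt_const).smul h3.cexp
      have h2 := h1.tendsto
      simp only [add_zero] at h2
      exact h2.mono_left nhdsWithin_le_nhds
  refine tendsto_nhds_unique hlim ?_
  refine tendsto_const_nhds.congr' ?_
  filter_upwards [self_mem_nhdsWithin] with ε hε
  rw [circleIntegral_exp_div]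
  rw [Complex.norm_real, Real.norm_of_nonneg hx0.le]
  linarith [Set.mem_Ioi.1 hε]

/-! ### The Borel transform as an inverse Laplace integral -/

variable {E : Type*} [NormedAddCommGroup E] [NormedSpace ℂ E]

/-- The remainder of the asymptotic expansion `∑ t^m a_m` of `F` after `N` terms. -/
def asympRem (F : ℂ → E) (a : ℕ → E) (N : ℕ) (t : ℂ) : E :=
  F t - ∑ m ∈ Finset.range N, t ^ m • a m

lemma asympRem_eq_succ (F : ℂ → E) (a : ℕ → E) (N : ℕ) (t : ℂ) :
    asympRem F a N t = t ^ N • a N + asympRem F a (N + 1) t := by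
  unfold asympRem
  rw [Finset.sum_range_succ]
  abel

/-- `F` is holomorphic for `Re (1/t) > α` with an asymptotic expansion whose coefficients and
remainders are controlled by `r`. -/
structure HasAsympExpansion (α : ℝ) (F : ℂ → E) (a : ℕ → E) (r : ℕ → ℝ) : Prop where
  meas : StronglyMeasurable F
  holo : DifferentiableOn ℂ F (timeDomain α)
  coeff : ∀ m, ‖a m‖ ≤ r m
  rem : ∀ N, ∀ t ∈ timeDomain α, ‖asympRem F a N t‖ ≤ r N * ‖t‖ ^ N

/-- The integral `(2πi)⁻¹ ∮ e^{q/t} t^{-j} R_N(t) dt` over the circle `Re (1/t) = c`. -/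
def rimIntegral (c : ℝ) (F : ℂ → E) (a : ℕ → E) (j N : ℕ) (q : ℝ) : E :=
  (2 * Real.pi * Complex.I : ℂ)⁻¹ • ∮ t in C(((1 / (2 * c) : ℝ) : ℂ), 1 / (2 * c)),
    (Complex.exp (q / t) * (t ^ j)⁻¹) • asympRem F a N t

/-- The derivatives on the positive half line of the Borel transform of `F`. -/
def borelCoeff (c : ℝ) (F : ℂ → E) (a : ℕ → E) (n : ℕ) (q : ℝ) : E :=
  a (n + 1) + rimIntegral c F a (n + 2) (n + 2) q

namespace HasAsympExpansion

variable {α c : ℝ} {F : ℂ → E} {a : ℕ → E} {r : ℕ → ℝ}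

lemma nonneg (h : HasAsympExpansion α F a r) (N : ℕ) : 0 ≤ r N :=
  (norm_nonneg _).trans (h.coeff N)

lemma stronglyMeasurable_rem (h : HasAsympExpansion α F a r) (N : ℕ) :
    StronglyMeasurable (asympRem F a N) := by
  unfold asympRem
  refine h.meas.sub (Finset.stronglyMeasurable_fun_sum _ fun m _ => Continuous.stronglyMeasurable ?_)
  fun_prop

/-- On the circle |e^{q/t}| = e^{cq}, and the order of the remainder compensates the pole. At t = 0
the kernel is 0, by the convention for inverses. -/
lemma norm_kernel_le (h : HasAsympExpansion α F a r) (hα : 0 < α) (hc : α < c) (j i : ℕ) (q θ : ℝ) :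
    ‖(Complex.exp (q / rim c θ) * (rim c θ ^ (j + 1))⁻¹) • asympRem F a (j + 1 + i) (rim c θ)‖ ≤
      Real.exp (c * q) * (r (j + 1 + i) * (1 / c) ^ i) := by
  have hc0 := hα.trans hc
  have hr := h.nonneg (j + 1 + i)
  by_cases hz : rim c θ = 0
  · rw [hz]
    simp only [ne_eq, Nat.succ_ne_zero, not_false_eq_true, zero_pow, inv_zero, mul_zero, zero_smul,
      norm_zero]
    positivity
  · have hpos : 0 < ‖rim c θ‖ := norm_pos_iff.2 hz
    rw [norm_smul, norm_mul, norm_exp_div_rim_le hc0 hz, norm_inv, norm_pow, mul_assoc]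
    refine mul_le_mul_of_nonneg_left ?_ (Real.exp_nonneg _)
    calc (‖rim c θ‖ ^ (j + 1))⁻¹ * ‖asympRem F a (j + 1 + i) (rim c θ)‖
        ≤ (‖rim c θ‖ ^ (j + 1))⁻¹ * (r (j + 1 + i) * ‖rim c θ‖ ^ (j + 1 + i)) := by
          gcongr
          exact h.rem _ _ (rim_mem_timeDomain hα hc hz)
      _ = r (j + 1 + i) * ‖rim c θ‖ ^ i := by
          rw [pow_add _ (j + 1) i]; field_simp
      _ ≤ r (j + 1 + i) * (1 / c) ^ i := by
          gcongr
          exact norm_rim_le hc0 θ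

lemma stronglyMeasurable_kernel (h : HasAsympExpansion α F a r) (j N : ℕ) (q : ℝ) :
    StronglyMeasurable fun θ : ℝ => deriv (circleMap ((1 / (2 * c) : ℝ) : ℂ) (1 / (2 * c))) θ •
      (Complex.exp (q / rim c θ) * (rim c θ ^ j)⁻¹) • asympRem F a N (rim c θ) := by
  have hrim : Measurable (rim c) := (continuous_rim c).measurable
  have h1 : StronglyMeasurable fun θ : ℝ => asympRem F a N (rim c θ) :=
    (h.stronglyMeasurable_rem N).comp_measurable hrim
  have h2 : Measurable fun θ : ℝ => Complex.exp (q / rim c θ) * (rim c θ ^ j)⁻¹ := by fun_prop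
  have h3 : Measurable fun θ : ℝ => deriv (circleMap ((1 / (2 * c) : ℝ) : ℂ) (1 / (2 * c))) θ := by
    simp only [deriv_circleMap]
    exact ((continuous_circleMap _ _).mul continuous_const).measurable
  exact h3.stronglyMeasurable.smul (h2.stronglyMeasurable.smul h1)

lemma norm_weighted_kernel_le (h : HasAsympExpansion α F a r) (hα : 0 < α) (hc : α < c) (j i : ℕ)
    (q θ : ℝ) :
    ‖deriv (circleMap ((1 / (2 * c) : ℝ) : ℂ) (1 / (2 * c))) θ •
      (Complex.exp (q / rim c θ) * (rim c θ ^ (j + 1))⁻¹) • asympRem F a (j + 1 + i) (rim c θ)‖ ≤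
      1 / (2 * c) * (Real.exp (c * q) * (r (j + 1 + i) * (1 / c) ^ i)) := by
  have hc0 := hα.trans hc
  rw [norm_smul, deriv_circleMap, norm_mul, norm_circleMap_zero, Complex.norm_I, mul_one,
    abs_of_pos (by positivity)]
  gcongr
  exact h.norm_kernel_le hα hc j i q θ

lemma circleIntegrable (h : HasAsympExpansion α F a r) (hα : 0 < α) (hc : α < c) (j i : ℕ) (q : ℝ) :
    CircleIntegrable (fun t : ℂ => (Complex.exp (q / t) * (t ^ (j + 1))⁻¹) •
      asympRem F a (j + 1 + i) t) ((1 / (2 * c) : ℝ) : ℂ) (1 / (2 * c)) := by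
  have hrim : Measurable (rim c) := (continuous_rim c).measurable
  have h1 : StronglyMeasurable fun θ : ℝ => asympRem F a (j + 1 + i) (rim c θ) :=
    (h.stronglyMeasurable_rem _).comp_measurable hrim
  have h2 : Measurable fun θ : ℝ => Complex.exp (q / rim c θ) * (rim c θ ^ (j + 1))⁻¹ := by fun_prop
  exact (intervalIntegrable_const (c := Real.exp (c * q) * (r (j + 1 + i) * (1 / c) ^ i))).mono_fun'
    (h2.stronglyMeasurable.smul h1).aestronglyMeasurable
    (Eventually.of_forall fun θ => h.norm_kernel_le hα hc j i q θ)

lemma norm_rimIntegral_le (h : HasAsympExpansion α F a r) (hα : 0 < α) (hc : α < c) (j i : ℕ)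
    (q : ℝ) : ‖rimIntegral c F a (j + 1) (j + 1 + i) q‖ ≤
      1 / (2 * c) * (Real.exp (c * q) * (r (j + 1 + i) * (1 / c) ^ i)) := by
  have hc0 := hα.trans hc
  unfold rimIntegral
  refine circleIntegral.norm_two_pi_i_inv_smul_integral_le_of_norm_le_const (by positivity) ?_
  intro t ht
  have ht' : t ∈ Set.range (rim c) := by
    rw [range_circleMap, abs_of_pos (by positivity : 0 < 1 / (2 * c))]
    exact ht
  obtain ⟨θ, rfl⟩ := ht'
  exact h.norm_kernel_le hα hc j i q θ

lemma norm_borelCoeff_le (h : HasAsympExpansion α F a r) (hα : 0 < α) (hc : α < c) (n : ℕ) {q : ℝ}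
    (hq : 0 ≤ q) :
    ‖borelCoeff c F a n q‖ ≤ (r (n + 1) + 1 / (2 * c) * r (n + 2)) * Real.exp (c * q) := by
  have hc0 := hα.trans hc
  have h1 := h.norm_rimIntegral_le hα hc (n + 1) 0 q
  have h2 : 1 ≤ Real.exp (c * q) := Real.one_le_exp (by positivity)
  have h3 := h.coeff (n + 1)
  have h4 := le_mul_of_one_le_right (h.nonneg (n + 1)) h2
  unfold borelCoeff
  refine (norm_add_le _ _).trans ?_
  simp only [pow_zero, mul_one, add_zero] at h1
  calc _ ≤ r (n + 1) * Real.exp (c * q) + 1 / (2 * c) * (Real.exp (c * q) * r (n + 2)) :=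
        add_le_add (h3.trans h4) h1
    _ = _ := by ring

/-- The remainder is taken one order higher than the pole. The extra factor 1/t produced by d/dq
then still leaves a bounded kernel near 0. -/
lemma hasDerivAt_rimIntegral (h : HasAsympExpansion α F a r) (hα : 0 < α) (hc : α < c) (n : ℕ)
    (q : ℝ) : HasDerivAt (rimIntegral c F a (n + 2) (n + 3))
      (rimIntegral c F a (n + 3) (n + 3) q) q := by
  have hc0 := hα.trans hc
  unfold rimIntegral
  refine HasDerivAt.fun_const_smul _ ?_
  have hr := h.nonneg (n + 3)
  refine (intervalIntegral.hasDerivAt_integral_of_dominated_loc_of_deriv_le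
    (F := fun (q θ : ℝ) => deriv (circleMap ((1 / (2 * c) : ℝ) : ℂ) (1 / (2 * c))) θ •
      (Complex.exp (q / rim c θ) * (rim c θ ^ (n + 2))⁻¹) • asympRem F a (n + 3) (rim c θ))
    (F' := fun (q θ : ℝ) => deriv (circleMap ((1 / (2 * c) : ℝ) : ℂ) (1 / (2 * c))) θ •
      (Complex.exp (q / rim c θ) * (rim c θ ^ (n + 3))⁻¹) • asympRem F a (n + 3) (rim c θ))
    (bound := fun _ => 1 / (2 * c) * (Real.exp (c * (q + 1)) * r (n + 3)))
    (Metric.ball_mem_nhds q one_pos) ?_ ?_ ?_ ?_ intervalIntegrable_const ?_).2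
  · exact Eventually.of_forall fun q => (h.stronglyMeasurable_kernel _ _ q).aestronglyMeasurable
  · exact (intervalIntegrable_const).mono_fun'
      (h.stronglyMeasurable_kernel _ _ q).aestronglyMeasurable
      (Eventually.of_forall fun θ => h.norm_weighted_kernel_le hα hc (n + 1) 1 q θ)
  · exact (h.stronglyMeasurable_kernel _ _ q).aestronglyMeasurable
  · refine Eventually.of_forall fun θ _ y hy => ?_
    have := h.norm_weighted_kernel_le hα hc (n + 2) 0 y θ
    simp only [pow_zero, mul_one, add_zero] at this
    refine this.trans ?_
    have hy' : y ≤ q + 1 := by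
      have := (abs_lt.1 (Metric.mem_ball.1 hy)).2
      linarith
    gcongr
  · refine Eventually.of_forall fun θ _ y _ => ?_
    refine HasDerivAt.fun_const_smul _ ?_
    have h1 : HasDerivAt (fun y : ℝ => Complex.exp ((y : ℂ) / rim c θ))
        (Complex.exp (y / rim c θ) * (1 / rim c θ)) y :=
      ((Complex.ofRealCLM.hasDerivAt (x := y)).div_const (rim c θ)).cexp
    refine ((h1.mul_const ((rim c θ ^ (n + 2))⁻¹)).smul_const _).congr_deriv ?_
    congr 1
    rw [pow_succ (rim c θ) (n + 2), mul_inv]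
    ring

variable [CompleteSpace E]

/-- Passing to the next remainder releases the term t^{n+2} a_{n+2}, whose kernel is e^{q/t} a_{n+2}
with integral 2πi q a_{n+2}. In this form the integral can be differentiated in q, giving the next
`borelCoeff`. -/
lemma borelCoeff_eq (h : HasAsympExpansion α F a r) (hα : 0 < α) (hc : α < c) (n : ℕ) {q : ℝ}
    (hq : 0 ≤ q) : borelCoeff c F a n q =
      a (n + 1) + (q : ℂ) • a (n + 2) + rimIntegral c F a (n + 2) (n + 3) q := by
  have hc0 := hα.trans hc
  unfold borelCoeff
  rw [add_assoc]
  congr 1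
  have hpi : (2 * Real.pi * Complex.I : ℂ) ≠ 0 := by simp [Real.pi_ne_zero]
  have hd : (∮ t in C(((1 / (2 * c) : ℝ) : ℂ), 1 / (2 * c)),
      (Complex.exp (q / t) * (t ^ (n + 2))⁻¹) • asympRem F a (n + 2) t -
      (Complex.exp (q / t) * (t ^ (n + 2))⁻¹) • asympRem F a (n + 3) t) =
      (2 * Real.pi * Complex.I * q : ℂ) • a (n + 2) := by
    rw [← circleIntegral_exp_div_rim hc0 hq, ← circleIntegral.integral_smul_const]
    refine intervalIntegral.integral_congr_ae ?_
    filter_upwards [ae_rim_ne_zero hc0] with θ hθ hmem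
    have hz := hθ hmem
    congr 1
    rw [asympRem_eq_succ F a (n + 2), smul_add, add_sub_cancel_right, smul_smul, mul_assoc,
      inv_mul_cancel₀ (pow_ne_zero _ hz), mul_one]
  rw [circleIntegral.integral_sub (h.circleIntegrable hα hc (n + 1) 0 q)
    (h.circleIntegrable hα hc (n + 1) 1 q), sub_eq_iff_eq_add] at hd
  unfold rimIntegral
  rw [hd, smul_add, smul_smul, ← mul_assoc, inv_mul_cancel₀ hpi, one_mul]

lemma hasDerivWithinAt_borelCoeff (h : HasAsympExpansion α F a r) (hα : 0 < α) (hc : α < c) (n : ℕ)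
    {q : ℝ} (hq : 0 ≤ q) :
    HasDerivWithinAt (borelCoeff c F a n) (borelCoeff c F a (n + 1) q) (Set.Ici 0) q := by
  have h1 : HasDerivAt (fun q : ℝ => a (n + 1) + (q : ℂ) • a (n + 2) +
      rimIntegral c F a (n + 2) (n + 3) q) (borelCoeff c F a (n + 1) q) q := by
    have h2 : HasDerivAt (fun q : ℝ => a (n + 1) + (q : ℂ) • a (n + 2)) (a (n + 2)) q := by
      simpa using ((Complex.ofRealCLM.hasDerivAt (x := q)).smul_const (a (n + 2))).const_add
        (a (n + 1))
    exact h2.add (h.hasDerivAt_rimIntegral hα hc n q)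
  exact h1.hasDerivWithinAt.congr (fun y hy => h.borelCoeff_eq hα hc n hy)
    (h.borelCoeff_eq hα hc n hq)

/-- The Laplace transform of the Borel transform recovers `F`. -/
theorem laplace_borelCoeff (h : HasAsympExpansion α F a r) (hα : 0 < α) (hc : α < c) {t : ℂ}
    (ht : t ∈ timeDomain c) :
    ∫ p in Set.Ioi (0 : ℝ), Complex.exp (-(p : ℂ) / t) • borelCoeff c F a 0 p = F t - a 0 := by
  have hc0 := hα.trans hc
  have ht0 : t ≠ 0 := ne_zero_of_mem_timeDomain hc0 ht
  have htc : c < (t⁻¹).re := by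
    have : t ∈ timeDomain c := ht
    unfold timeDomain at this
    rwa [Set.mem_ofPred_eq, one_div] at this
  set η := (t⁻¹).re - c with hη
  have hη0 : 0 < η := by linarith
  have hnorm : ∀ p : ℝ, ‖Complex.exp (-(p : ℂ) / t)‖ = Real.exp (-(η + c) * p) := by
    intro p
    rw [Complex.norm_exp, div_eq_mul_inv, neg_mul, Complex.neg_re, Complex.re_ofReal_mul, hη]
    congr 1
    ring
  have hexp : ∀ w : ℂ, 0 < w.re → ∫ p in Set.Ioi (0 : ℝ), Complex.exp (-(w * p)) = 1 / w := by
    intro w hw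
    have h1 := integral_exp_mul_complex_Ioi (a := -w) (by simpa using hw) 0
    simp only [neg_mul, Complex.ofReal_zero, mul_zero, Complex.exp_zero] at h1
    rw [h1]; field_simp
  have hexpi : ∀ w : ℂ, 0 < w.re →
      IntegrableOn (fun p : ℝ => Complex.exp (-(w * p))) (Set.Ioi (0 : ℝ)) := by
    intro w hw
    have h1 := integrableOn_exp_mul_complex_Ioi (a := -w) (by simpa using hw) 0
    simpa only [neg_mul] using h1
  have hti : 0 < (t⁻¹).re := by linarith
  have hdiv : ∀ p : ℝ, -(p : ℂ) / t = -(t⁻¹ * p) := fun p => by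
    rw [neg_div, div_eq_inv_mul]
  -- the kernel of the double integral
  set K : ℝ → ℝ → E := fun p θ => Complex.exp (-(p : ℂ) / t) •
    (deriv (circleMap ((1 / (2 * c) : ℝ) : ℂ) (1 / (2 * c))) θ •
      (Complex.exp (p / rim c θ) * (rim c θ ^ 2)⁻¹) • asympRem F a 2 (rim c θ)) with hK
  -- The growth e^{cp} on the circle is beaten by e^{-p/t}, with margin η = Re(1/t) - c. This gives
  -- absolute convergence for Fubini.
  have hKb : ∀ p θ, ‖K p θ‖ ≤ Real.exp (-η * p) * (1 / (2 * c) * r 2) := by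
    intro p θ
    have h1 := h.norm_weighted_kernel_le hα hc 1 0 p θ
    simp only [pow_zero, mul_one, add_zero] at h1
    rw [hK, norm_smul, hnorm]
    calc _ ≤ Real.exp (-(η + c) * p) * (1 / (2 * c) * (Real.exp (c * p) * r 2)) := by gcongr
      _ = (Real.exp (-(η + c) * p) * Real.exp (c * p)) * (1 / (2 * c) * r 2) := by ring
      _ = _ := by rw [← Real.exp_add]; congr 2; ring
  have hKm : StronglyMeasurable (Function.uncurry K) := by
    have hrim : Measurable (rim c) := (continuous_rim c).measurable
    have h1 : StronglyMeasurable fun z : ℝ × ℝ => asympRem F a 2 (rim c z.2) :=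
      (h.stronglyMeasurable_rem 2).comp_measurable (hrim.comp measurable_snd)
    have h2 : Measurable fun z : ℝ × ℝ =>
        Complex.exp ((z.1 : ℂ) / rim c z.2) * (rim c z.2 ^ 2)⁻¹ := by fun_prop
    have h3 : Measurable fun z : ℝ × ℝ =>
        deriv (circleMap ((1 / (2 * c) : ℝ) : ℂ) (1 / (2 * c))) z.2 := by
      simp only [deriv_circleMap]
      exact (((continuous_circleMap _ _).comp continuous_snd).mul continuous_const).measurable
    have h4 : Measurable fun z : ℝ × ℝ => Complex.exp (-(z.1 : ℂ) / t) := by fun_prop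
    exact h4.stronglyMeasurable.smul
      (h3.stronglyMeasurable.smul (h2.stronglyMeasurable.smul h1))
  have hexpη : IntegrableOn (fun p : ℝ => Real.exp (-η * p)) (Set.Ioi (0 : ℝ)) :=
    exp_neg_integrableOn_Ioi 0 hη0
  have hfin : IsFiniteMeasure (volume.restrict (Set.uIoc 0 (2 * Real.pi))) :=
    ⟨by rw [Measure.restrict_apply_univ, Set.uIoc_of_le (by positivity)]; exact measure_Ioc_lt_top⟩
  have hKi : Integrable (Function.uncurry K)
      ((volume.restrict (Set.Ioi (0 : ℝ))).prod (volume.restrict (Set.uIoc 0 (2 * Real.pi)))) := by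
    have hb : Integrable (fun z : ℝ × ℝ => Real.exp (-η * z.1) * (1 / (2 * c) * r 2))
        ((volume.restrict (Set.Ioi (0 : ℝ))).prod (volume.restrict (Set.uIoc 0 (2 * Real.pi)))) :=
      Integrable.mul_prod hexpη (integrable_const _)
    exact hb.mono' hKm.aestronglyMeasurable (Eventually.of_forall fun z => hKb z.1 z.2)
  have hle : (0 : ℝ) ≤ 2 * Real.pi := by positivity
  have hinner : ∀ p : ℝ, Complex.exp (-(p : ℂ) / t) • rimIntegral c F a 2 2 p =
      (2 * Real.pi * Complex.I : ℂ)⁻¹ • ∫ θ in Set.uIoc 0 (2 * Real.pi), K p θ := by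
    intro p
    unfold rimIntegral circleIntegral
    rw [smul_comm, intervalIntegral.integral_of_le hle, Set.uIoc_of_le hle, ← integral_smul]
  have hIrim : IntegrableOn (fun p : ℝ => Complex.exp (-(p : ℂ) / t) • rimIntegral c F a 2 2 p)
      (Set.Ioi (0 : ℝ)) := by
    simp only [hinner]
    exact hKi.integral_prod_left.smul _
  have hfub : ∫ p in Set.Ioi (0 : ℝ), Complex.exp (-(p : ℂ) / t) • rimIntegral c F a 2 2 p =
      (2 * Real.pi * Complex.I : ℂ)⁻¹ • ∫ θ in Set.uIoc 0 (2 * Real.pi),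
        ∫ p in Set.Ioi (0 : ℝ), K p θ := by
    simp only [hinner]
    rw [integral_smul, integral_integral_swap hKi]
  -- For s on the circle, ∫ e^{-p(1/t - 1/s)} dp = ts/(s-t). The Laplace integral therefore becomes
  -- the Cauchy kernel, and the pole s⁻² drops to s⁻¹.
  have hK2 : ∀ θ, rim c θ ≠ 0 → ∫ p in Set.Ioi (0 : ℝ), K p θ =
      deriv (circleMap ((1 / (2 * c) : ℝ) : ℂ) (1 / (2 * c))) θ • (rim c θ - t)⁻¹ •
        t • ((rim c θ)⁻¹ • asympRem F a 2 (rim c θ)) := by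
    intro θ hz
    have hre : 0 < (t⁻¹ - (rim c θ)⁻¹).re := by
      rw [Complex.sub_re, inv_re_rim hc0 hz]; linarith
    have e : ∀ p : ℝ, K p θ = Complex.exp (-((t⁻¹ - (rim c θ)⁻¹) * p)) •
        (deriv (circleMap ((1 / (2 * c) : ℝ) : ℂ) (1 / (2 * c))) θ •
          (rim c θ ^ 2)⁻¹ • asympRem F a 2 (rim c θ)) := by
      intro p
      simp only [hK, smul_smul]
      congr 1
      have : Complex.exp (-((t⁻¹ - (rim c θ)⁻¹) * p)) =
          Complex.exp (-(p : ℂ) / t) * Complex.exp (p / rim c θ) := by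
        rw [← Complex.exp_add]; congr 1; ring
      rw [this]; ring
    simp only [e]
    rw [integral_smul_const, hexp _ hre]
    simp only [smul_smul]
    congr 1
    have hne : rim c θ - t ≠ 0 := by
      intro h0
      rw [sub_eq_zero.1 h0, sub_self, Complex.zero_re] at hre
      exact lt_irrefl _ hre
    have : t⁻¹ - (rim c θ)⁻¹ ≠ 0 := fun h0 => by
      rw [h0, Complex.zero_re] at hre; exact lt_irrefl _ hre
    have e3 : 1 / (t⁻¹ - (rim c θ)⁻¹) = t * rim c θ / (rim c θ - t) := by
      rw [div_eq_div_iff this hne]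
      field_simp
    rw [e3]
    field_simp
  -- Cauchy's formula
  have hcauchy : (2 * Real.pi * Complex.I : ℂ)⁻¹ • ∫ θ in Set.uIoc 0 (2 * Real.pi),
      ∫ p in Set.Ioi (0 : ℝ), K p θ = asympRem F a 2 t := by
    set G : ℂ → E := fun s => t • (s⁻¹ • asympRem F a 2 s) with hG
    have hsub : ∀ s ∈ Metric.closedBall ((1 / (2 * c) : ℝ) : ℂ) (1 / (2 * c)), s ≠ 0 →
        s ∈ timeDomain α := by
      intro s hs hs0
      rw [mem_timeDomain_iff hα]
      have h1 : ‖s - ((1 / (2 * c) : ℝ) : ℂ)‖ ^ 2 ≤ (1 / (2 * c)) ^ 2 :=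
        pow_le_pow_left₀ (norm_nonneg _) (mem_closedBall_iff_norm.1 hs) 2
      rw [← Complex.normSq_eq_norm_sq, Complex.normSq_apply, Complex.sub_re, Complex.sub_im,
        Complex.ofReal_re, Complex.ofReal_im] at h1
      have h2 : 0 < s.re * s.re + s.im * s.im := by
        rw [← Complex.normSq_apply]; exact Complex.normSq_pos.2 hs0
      rw [← Complex.normSq_eq_norm_sq, Complex.normSq_apply]
      have h3 : c * (s.re * s.re + s.im * s.im) ≤ s.re := by
        have e : (s.re - 1 / (2 * c)) * (s.re - 1 / (2 * c)) + (s.im - 0) * (s.im - 0) -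
          (1 / (2 * c)) ^ 2 = (s.re * s.re + s.im * s.im) - s.re / c := by field_simp; ring
        have h4 : (s.re * s.re + s.im * s.im) ≤ s.re / c := by linarith
        rw [le_div_iff₀ hc0] at h4
        linarith
      nlinarith
    have hremd : DifferentiableOn ℂ (asympRem F a 2) (timeDomain α) := by
      unfold asympRem
      exact h.holo.sub (by fun_prop)
    have hGd : ∀ s ∈ timeDomain α, DifferentiableAt ℂ G s := by
      intro s hs
      have h1 := hremd.differentiableAt ((isOpen_timeDomain hα).mem_nhds hs)
      exact ((differentiableAt_inv (ne_zero_of_mem_timeDomain hα hs)).smul h1).const_smul t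
    -- The closed disc meets the complement of the domain of holomorphy only at 0. There G takes the
    -- value 0 and is continuous, since the second remainder is O(|s|²).
    have hGc : DiffContOnCl ℂ G (Metric.ball ((1 / (2 * c) : ℝ) : ℂ) (1 / (2 * c))) := by
      refine ⟨?_, ?_⟩
      · intro s hs
        rw [← timeDomain_eq_ball hc0] at hs
        exact (hGd s (timeDomain_anti hc.le hs)).differentiableWithinAt
      · rw [closure_ball _ (by positivity)]
        intro s hs
        by_cases hs0 : s = 0
        · subst hs0
          rw [ContinuousWithinAt]
          have hG0 : G 0 = 0 := by simp [hG]
          rw [hG0]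
          refine squeeze_zero_norm' (a := fun s => ‖t‖ * (r 2 * ‖s‖)) ?_ ?_
          · filter_upwards [self_mem_nhdsWithin] with s hs
            by_cases hs0 : s = 0
            · subst hs0; rw [hG0]; simp
            · have h1 := h.rem 2 s (hsub s hs hs0)
              have hpos : 0 < ‖s‖ := norm_pos_iff.2 hs0
              rw [hG, norm_smul, norm_smul, norm_inv]
              refine mul_le_mul_of_nonneg_left ?_ (norm_nonneg t)
              calc ‖s‖⁻¹ * ‖asympRem F a 2 s‖ ≤ ‖s‖⁻¹ * (r 2 * ‖s‖ ^ 2) := by gcongr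
                _ = _ := by rw [sq]; field_simp
          · have : Continuous fun s : ℂ => ‖t‖ * (r 2 * ‖s‖) := by fun_prop
            have h2 := this.tendsto 0
            simp only [norm_zero, mul_zero] at h2
            exact h2.mono_left nhdsWithin_le_nhds
        · exact (hGd s (hsub s hs hs0)).continuousAt.continuousWithinAt
    have htb : t ∈ Metric.ball ((1 / (2 * c) : ℝ) : ℂ) (1 / (2 * c)) := by
      rw [← timeDomain_eq_ball hc0]; exact ht
    have hform := hGc.two_pi_i_inv_smul_circleIntegral_sub_inv_smul htb
    have hGt : G t = asympRem F a 2 t := by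
      simp only [hG]
      rw [smul_inv_smul₀ ht0]
    rw [hGt] at hform
    rw [← hform]
    congr 1
    unfold circleIntegral
    rw [intervalIntegral.integral_of_le hle, Set.uIoc_of_le hle]
    refine integral_congr_ae ?_
    rw [EventuallyEq, ae_restrict_iff' measurableSet_Ioc]
    filter_upwards [ae_rim_ne_zero hc0] with θ hθ hmem
    rw [Set.uIoc_of_le hle] at hθ
    exact hK2 θ (hθ hmem)
  have hIa : IntegrableOn (fun p : ℝ => Complex.exp (-(p : ℂ) / t) • a 1) (Set.Ioi (0 : ℝ)) := by
    simp only [hdiv]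
    exact (hexpi _ hti).smul_const (a 1)
  unfold borelCoeff
  simp only [smul_add, zero_add]
  rw [integral_add hIa hIrim, hfub, hcauchy]
  simp only [hdiv]
  rw [integral_smul_const, hexp _ hti]
  unfold asympRem
  rw [Finset.sum_range_succ, Finset.sum_range_one]
  simp only [one_div, inv_inv, pow_zero, one_smul, pow_one]
  abel

end HasAsympExpansion

/-! ### Continuation of a function off the positive half line -/

/-- The base point max(Re p, 0) is the point of the half line nearest to p. Choosing it makes the
continuation independent of δ, so one function serves all strips. -/
lemma norm_sub_max_le (p : ℂ) {q : ℝ} (hq : 0 ≤ q) : ‖p - (max p.re 0 : ℝ)‖ ≤ ‖p - (q : ℝ)‖ := by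
  rw [← sq_le_sq₀ (norm_nonneg _) (norm_nonneg _), ← Complex.normSq_eq_norm_sq,
    ← Complex.normSq_eq_norm_sq, Complex.normSq_apply, Complex.normSq_apply]
  simp only [Complex.sub_re, Complex.sub_im, Complex.ofReal_re, Complex.ofReal_im]
  rcases le_total p.re 0 with h | h
  · rw [max_eq_right h]; nlinarith
  · rw [max_eq_left h]; nlinarith [sq_nonneg (p.re - q)]

lemma mem_halfLineNhd_iff {δ : ℝ} {p : ℂ} :
    p ∈ halfLineNhd δ ↔ ‖p - (max p.re 0 : ℝ)‖ < δ := by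
  unfold halfLineNhd
  rw [Metric.mem_thickening_iff]
  constructor
  · rintro ⟨z, ⟨q, hq, rfl⟩, hz⟩
    rw [dist_eq_norm] at hz
    exact (norm_sub_max_le p hq).trans_lt hz
  · intro h
    exact ⟨_, ⟨_, Set.mem_Ici.2 (le_max_right p.re 0), rfl⟩, by rwa [dist_eq_norm]⟩

lemma isOpen_halfLineNhd (δ : ℝ) : IsOpen (halfLineNhd δ) := Metric.isOpen_thickening

variable {E : Type*} [NormedAddCommGroup E] [NormedSpace ℂ E]

/-- The Taylor series about `q ≥ 0` of a function with derivatives `u n` on the half line. -/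
def jetSum (u : ℕ → ℝ → E) (p : ℂ) (q : ℝ) : E :=
  ∑' n : ℕ, ((p - q) ^ n / (n.factorial : ℂ)) • u n q

/-- The continuation to a neighbourhood of the half line. -/
def jetExtend (u : ℕ → ℝ → E) (p : ℂ) : E := jetSum u p (max p.re 0)

/-- `u (n+1)` is the derivative of `u n` on the half line, with bounds that make the Taylor series
and its derivative converge with radius `δ`. -/
structure HalfLineJet (c δ : ℝ) (u : ℕ → ℝ → E) (ρ : ℕ → ℝ) : Prop where
  deriv : ∀ n q, 0 ≤ q → HasDerivWithinAt (u n) (u (n + 1) q) (Set.Ici 0) q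
  bound : ∀ n q, 0 ≤ q → ‖u n q‖ ≤ ρ n * Real.exp (c * q)
  summable : Summable fun n : ℕ => ρ (n + 1) * (δ ^ n / n.factorial)

namespace HalfLineJet

variable {c δ : ℝ} {u : ℕ → ℝ → E} {ρ : ℕ → ℝ}

lemma nonneg (h : HalfLineJet c δ u ρ) (n : ℕ) : 0 ≤ ρ n :=
  nonneg_of_mul_nonneg_left ((norm_nonneg _).trans (h.bound n 0 le_rfl)) (Real.exp_pos _)

lemma summable_zero (h : HalfLineJet c δ u ρ) (hδ : 0 < δ) :
    Summable fun n : ℕ => ρ n * (δ ^ n / n.factorial) := by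
  rw [← summable_nat_add_iff 1]
  refine Summable.of_nonneg_of_le (fun n => ?_) (fun n => ?_) (h.summable.mul_left δ)
  · have := h.nonneg (n + 1); positivity
  · have := h.nonneg (n + 1)
    rw [pow_succ]
    have hfac : (n.factorial : ℝ) ≤ (n + 1).factorial := by
      exact_mod_cast Nat.factorial_le (Nat.le_succ n)
    calc ρ (n + 1) * (δ ^ n * δ / (n + 1).factorial) ≤ ρ (n + 1) * (δ ^ n * δ / n.factorial) := by
          gcongr
      _ = _ := by ring

lemma norm_term_le (h : HalfLineJet c δ u ρ) {p : ℂ} {q : ℝ} (hq : 0 ≤ q) (hp : ‖p - q‖ ≤ δ)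
    (n : ℕ) : ‖((p - q) ^ n / (n.factorial : ℂ)) • u n q‖ ≤
      ρ n * (δ ^ n / n.factorial) * Real.exp (c * q) := by
  rw [norm_smul, norm_div, norm_pow, Complex.norm_natCast]
  calc _ ≤ δ ^ n / n.factorial * (ρ n * Real.exp (c * q)) := by
        have hδ : 0 ≤ δ := (norm_nonneg _).trans hp
        gcongr
        exact h.bound n q hq
    _ = _ := by ring

lemma hasSum [CompleteSpace E] (h : HalfLineJet c δ u ρ) (hδ : 0 < δ) {p : ℂ} {q : ℝ} (hq : 0 ≤ q)
    (hp : ‖p - q‖ ≤ δ) :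
    HasSum (fun n : ℕ => ((p - q) ^ n / (n.factorial : ℂ)) • u n q) (jetSum u p q) :=
  (Summable.of_norm_bounded ((h.summable_zero hδ).mul_right _) (h.norm_term_le hq hp)).hasSum

lemma norm_jetSum_le (h : HalfLineJet c δ u ρ) (hδ : 0 < δ) {p : ℂ} {q : ℝ} (hq : 0 ≤ q)
    (hp : ‖p - q‖ ≤ δ) :
    ‖jetSum u p q‖ ≤ (∑' n : ℕ, ρ n * (δ ^ n / n.factorial)) * Real.exp (c * q) := by
  refine tsum_of_norm_bounded ?_ (h.norm_term_le hq hp)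
  exact (h.summable_zero hδ).hasSum.mul_right _

/-- Differentiating a Taylor polynomial in its base point telescopes to a single top-order term. -/
lemma shift_hasDerivWithinAt (h : HalfLineJet c δ u ρ) (p : ℂ) (N : ℕ) {q : ℝ} (hq : 0 ≤ q) :
    HasDerivWithinAt
      (fun q : ℝ => ∑ n ∈ Finset.range (N + 1), ((p - q) ^ n / (n.factorial : ℂ)) • u n q)
      (((p - q) ^ N / (N.factorial : ℂ)) • u (N + 1) q) (Set.Ici 0) q := by
  have hlin : HasDerivWithinAt (fun q : ℝ => p - (q : ℂ)) (-1) (Set.Ici 0) q := by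
    simpa using ((Complex.ofRealCLM.hasDerivAt (x := q)).const_sub p).hasDerivWithinAt
  induction N with
  | zero =>
    simpa using h.deriv 0 q hq
  | succ N ih =>
    have h1 := (((hlin.fun_pow (N + 1)).div_const ((N + 1).factorial : ℂ)).smul (h.deriv (N + 1) q hq))
    have h2 := ih.add h1
    refine (h2.congr_of_mem (fun y _ => ?_) (Set.mem_Ici.2 hq)).congr_deriv ?_
    · rw [Finset.sum_range_succ _ (N + 1)]
      rfl
    · rw [add_comm, add_assoc]
      have e : ((((N + 1 : ℕ) : ℂ) * (p - (q : ℂ)) ^ (N + 1 - 1) * -1) / ((N + 1).factorial : ℂ)) =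
          -((p - q) ^ N / (N.factorial : ℂ)) := by
        have h3 : (N.factorial : ℂ) ≠ 0 := by exact_mod_cast N.factorial_ne_zero
        have h4 : ((N : ℂ) + 1) ≠ 0 := by exact_mod_cast Nat.succ_ne_zero N
        rw [Nat.factorial_succ, Nat.add_sub_cancel]
        push_cast
        field_simp
      rw [e, neg_smul, neg_add_cancel, add_zero]

/-- The base-point derivative of the N-th partial sum tends to 0 uniformly on the segment from q to
q', because its bounds are terms of a convergent series. The sum therefore does not depend on the
base point. -/
lemma jetSum_eq [CompleteSpace E] (h : HalfLineJet c δ u ρ) (hc : 0 ≤ c) (hδ : 0 < δ) {p : ℂ} {q q' : ℝ} (hq : 0 ≤ q)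
    (hq' : 0 ≤ q') (hp : ‖p - q‖ ≤ δ) (hp' : ‖p - q'‖ ≤ δ) : jetSum u p q = jetSum u p q' := by
  have hseg : ∀ y ∈ Set.uIcc q q', 0 ≤ y ∧ y ≤ max q q' ∧ ‖p - y‖ ≤ δ := by
    intro y hy
    refine ⟨(le_min hq hq').trans hy.1, hy.2, ?_⟩
    have hconv : Convex ℝ {y : ℝ | ‖p - y‖ ≤ δ} := by
      have : {y : ℝ | ‖p - y‖ ≤ δ} = Complex.ofRealCLM ⁻¹' (Metric.closedBall p δ) := by
        ext y
        simp [Metric.mem_closedBall, dist_eq_norm, norm_sub_rev]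
      rw [this]
      exact (convex_closedBall p δ).linear_preimage Complex.ofRealCLM.toLinearMap
    exact hconv.ordConnected.uIcc_subset hp hp' hy
  set S : ℕ → ℝ → E := fun N y =>
    ∑ n ∈ Finset.range (N + 1), ((p - y) ^ n / (n.factorial : ℂ)) • u n y with hS
  have hdiff : ∀ N, ‖S N q' - S N q‖ ≤
      (ρ (N + 1) * (δ ^ N / N.factorial)) * Real.exp (c * max q q') * ‖q' - q‖ := by
    intro N
    refine (convex_uIcc q q').norm_image_sub_le_of_norm_hasDerivWithin_le
      (f' := fun y : ℝ => ((p - y) ^ N / (N.factorial : ℂ)) • u (N + 1) y) ?_ ?_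
      Set.left_mem_uIcc Set.right_mem_uIcc
    · intro y hy
      exact (h.shift_hasDerivWithinAt p N (hseg y hy).1).mono fun z hz => (hseg z hz).1
    · intro y hy
      obtain ⟨h0, h1, h2⟩ := hseg y hy
      have hρ := h.nonneg (N + 1)
      rw [norm_smul, norm_div, norm_pow, Complex.norm_natCast]
      calc _ ≤ δ ^ N / N.factorial * (ρ (N + 1) * Real.exp (c * max q q')) := by
            gcongr
            exact (h.bound _ y h0).trans (by gcongr)
        _ = _ := by ring
  have hlim : Tendsto (fun N => S N q' - S N q) atTop (𝓝 (jetSum u p q' - jetSum u p q)) := by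
    have h1 := (h.hasSum hδ hq' hp').tendsto_sum_nat.comp (tendsto_add_atTop_nat 1)
    have h2 := (h.hasSum hδ hq hp).tendsto_sum_nat.comp (tendsto_add_atTop_nat 1)
    exact h1.sub h2
  have hzero : Tendsto (fun N => S N q' - S N q) atTop (𝓝 0) := by
    refine squeeze_zero_norm hdiff ?_
    have := (h.summable.tendsto_atTop_zero.mul_const (Real.exp (c * max q q'))).mul_const ‖q' - q‖
    simpa using this
  exact (sub_eq_zero.1 (tendsto_nhds_unique hlim hzero)).symm

lemma hasDerivAt_jetSum [CompleteSpace E] (h : HalfLineJet c δ u ρ) (hδ : 0 < δ) {p : ℂ} {q : ℝ} (hq : 0 ≤ q)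
    (hp : ‖p - q‖ < δ) :
    HasDerivAt (fun p => jetSum u p q) (jetSum (fun n => u (n + 1)) p q) p := by
  set g' : ℕ → ℂ → E := fun n y => (((n : ℂ) * (y - q) ^ (n - 1)) / (n.factorial : ℂ)) • u n q
    with hg'
  have hg'succ : ∀ n y, g' (n + 1) y = ((y - q) ^ n / (n.factorial : ℂ)) • u (n + 1) q := by
    intro n y
    simp only [hg', Nat.add_sub_cancel]
    congr 1
    have h3 : (n.factorial : ℂ) ≠ 0 := by exact_mod_cast n.factorial_ne_zero
    have h4 : ((n : ℂ) + 1) ≠ 0 := by exact_mod_cast Nat.succ_ne_zero n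
    rw [Nat.factorial_succ]
    push_cast
    field_simp
  set b : ℕ → ℝ := fun n => n.casesOn 0 fun m => ρ (m + 1) * (δ ^ m / m.factorial) * Real.exp (c * q)
    with hb
  have hbs : Summable b := by
    rw [← summable_nat_add_iff 1]
    exact h.summable.mul_right _
  have hpb : p ∈ Metric.ball (q : ℂ) δ := by rwa [Metric.mem_ball, dist_eq_norm]
  have hgb : ∀ n, ∀ y ∈ Metric.ball (q : ℂ) δ, ‖g' n y‖ ≤ b n := by
    intro n y hy
    rw [Metric.mem_ball, dist_eq_norm] at hy
    cases n with
    | zero => simp [hg', hb]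
    | succ n =>
      rw [hg'succ, norm_smul, norm_div, norm_pow, Complex.norm_natCast]
      have hρ := h.nonneg (n + 1)
      calc _ ≤ δ ^ n / n.factorial * (ρ (n + 1) * Real.exp (c * q)) := by
            gcongr
            exact h.bound _ q hq
        _ = b (n + 1) := by simp only [hb]; ring
  have hd := hasDerivAt_tsum_of_isPreconnected hbs Metric.isOpen_ball
    (convex_ball (q : ℂ) δ).isPreconnected
    (g := fun n y => ((y - q) ^ n / (n.factorial : ℂ)) • u n q) (g' := g') (fun n y _ => ?_) hgb hpb
    (h.hasSum hδ hq hp.le).summable hpb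
  · refine hd.congr_deriv ?_
    have hsum : Summable fun n => g' n p := Summable.of_norm_bounded hbs fun n => hgb n p hpb
    rw [hsum.tsum_eq_zero_add]
    have h0 : g' 0 p = 0 := by simp [hg']
    rw [h0, zero_add]
    exact tsum_congr fun n => hg'succ n p
  · have h1 : HasDerivAt (fun y : ℂ => (y - q) ^ n) ((n : ℂ) * (y - q) ^ (n - 1)) y := by
      simpa using ((hasDerivAt_id y).sub_const (q : ℂ)).fun_pow n
    exact (h1.div_const _).smul_const _

/-- Near p the moving base point can be frozen, so the continuation is locally a convergent power
series. -/
lemma hasDerivAt_jetExtend [CompleteSpace E] (h : HalfLineJet c δ u ρ) (hc : 0 ≤ c) (hδ : 0 < δ) {p : ℂ}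
    (hp : p ∈ halfLineNhd δ) :
    HasDerivAt (jetExtend u) (jetExtend (fun n => u (n + 1)) p) p := by
  have hp' := mem_halfLineNhd_iff.1 hp
  have hq : 0 ≤ max p.re 0 := le_max_right _ _
  refine (h.hasDerivAt_jetSum hδ hq hp').congr_of_eventuallyEq ?_
  have hcont : ContinuousAt (fun s : ℂ => ‖s - (max p.re 0 : ℝ)‖) p := by fun_prop
  filter_upwards [hcont.eventually_lt continuousAt_const hp'] with s hs
  exact h.jetSum_eq hc hδ (le_max_right _ _) hq ((norm_sub_max_le s hq).trans hs.le) hs.le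

lemma norm_jetExtend_le (h : HalfLineJet c δ u ρ) (hc : 0 ≤ c) (hδ : 0 < δ) {p : ℂ}
    (hp : p ∈ halfLineNhd δ) :
    ‖jetExtend u p‖ ≤ (∑' n : ℕ, ρ n * (δ ^ n / n.factorial)) * Real.exp (c * ‖p‖) := by
  refine (h.norm_jetSum_le hδ (le_max_right _ _) (mem_halfLineNhd_iff.1 hp).le).trans ?_
  have hS : 0 ≤ ∑' n : ℕ, ρ n * (δ ^ n / n.factorial) :=
    tsum_nonneg fun n => mul_nonneg (h.nonneg n) (by positivity)
  gcongr
  exact max_le (Complex.re_le_norm p) (norm_nonneg p)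

/-- The bound for the derivative of the continuation. -/
lemma norm_jetExtend_succ_le (h : HalfLineJet c δ u ρ) (hc : 0 ≤ c) (hδ : 0 < δ) {p : ℂ}
    (hp : p ∈ halfLineNhd δ) : ‖jetExtend (fun n => u (n + 1)) p‖ ≤
      (∑' n : ℕ, ρ (n + 1) * (δ ^ n / n.factorial)) * Real.exp (c * ‖p‖) := by
  have hq : 0 ≤ max p.re 0 := le_max_right _ _
  have hp' := (mem_halfLineNhd_iff.1 hp).le
  have hS : 0 ≤ ∑' n : ℕ, ρ (n + 1) * (δ ^ n / n.factorial) :=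
    tsum_nonneg fun n => mul_nonneg (h.nonneg (n + 1)) (by positivity)
  have h1 : ‖jetExtend (fun n => u (n + 1)) p‖ ≤
      (∑' n : ℕ, ρ (n + 1) * (δ ^ n / n.factorial)) * Real.exp (c * max p.re 0) := by
    refine tsum_of_norm_bounded (h.summable.hasSum.mul_right _) fun n => ?_
    rw [norm_smul, norm_div, norm_pow, Complex.norm_natCast]
    calc _ ≤ δ ^ n / n.factorial * (ρ (n + 1) * Real.exp (c * max p.re 0)) := by
          gcongr
          exact h.bound _ _ hq
      _ = _ := by ring
  refine h1.trans ?_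
  gcongr
  exact max_le (Complex.re_le_norm p) (norm_nonneg p)

lemma hasSum_succ [CompleteSpace E] (h : HalfLineJet c δ u ρ) {p : ℂ} {q : ℝ} (hq : 0 ≤ q)
    (hp : ‖p - q‖ ≤ δ) : HasSum (fun n : ℕ => ((p - q) ^ n / (n.factorial : ℂ)) • u (n + 1) q)
      (jetSum (fun n => u (n + 1)) p q) := by
  refine (Summable.of_norm_bounded (h.summable.mul_right (Real.exp (c * q))) fun n => ?_).hasSum
  rw [norm_smul, norm_div, norm_pow, Complex.norm_natCast]
  calc _ ≤ δ ^ n / n.factorial * (ρ (n + 1) * Real.exp (c * q)) := by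
        have hδ : 0 ≤ δ := (norm_nonneg _).trans hp
        gcongr
        exact h.bound _ _ hq
    _ = _ := by ring

end HalfLineJet

lemma jetExtend_ofReal (u : ℕ → ℝ → E) {p : ℝ} (hp : 0 ≤ p) : jetExtend u (p : ℂ) = u 0 p := by
  unfold jetExtend jetSum
  rw [Complex.ofReal_re, max_eq_left hp, tsum_eq_single 0]
  · simp
  · intro n hn
    simp [hn]

/-! ### Summed majorants -/

/-- `∑ₙ e^{b|k|} maj_{n+j}(k) δⁿ / n!`. -/
def majSum (μ β R nf b δ : ℝ) (j : ℕ) (k : R3) : ℝ≥0∞ :=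
  ∑' n : ℕ, ENNReal.ofReal (Real.exp (b * ‖k‖)) * maj μ β R nf (n + j) k *
    ENNReal.ofReal (δ ^ n / n.factorial)

lemma measurable_majSum (μ β R nf b δ : ℝ) (j : ℕ) : Measurable (majSum μ β R nf b δ j) := by
  unfold majSum
  refine Measurable.tsum fun n => ?_
  have := measurable_maj μ β R nf (n + j)
  fun_prop

section MajSum

variable {μ β R nf b δ : ℝ}

lemma exists_lintegral_majSum_lt_top (hμ : 3 < μ) (hb : 0 < b) (hbβ : b < β) (hR : 0 ≤ R)
    (hnf : 0 ≤ nf) : ∃ δ : ℝ, 0 < δ ∧ ∀ j, ∫⁻ k, majSum μ β R nf b δ j k ≠ ⊤ := by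
  obtain ⟨K, B, hK, hB, hbound⟩ := exists_lintegral_maj_le hμ hb hbβ hR hnf
  -- With Bδ = 1/2 the n-th term is a constant times binom(n+j, j) 2^{-n}. It is summable for every
  -- shift j with the same δ.
  refine ⟨1 / (2 * B), by positivity, fun j => ?_⟩
  set δ := 1 / (2 * B) with hδ
  have hδ0 : 0 < δ := by positivity
  have hBδ : B * δ = 1 / 2 := by rw [hδ]; field_simp
  have hm : ∀ n, Measurable fun k => ENNReal.ofReal (Real.exp (b * ‖k‖)) *
      maj μ β R nf (n + j) k := fun n => by
    have := measurable_maj μ β R nf (n + j)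
    fun_prop
  have hterm : ∀ n : ℕ, K * B ^ (n + j) * (n + j).factorial * (δ ^ n / n.factorial) =
      K * B ^ j * j.factorial * (((n + j).choose j : ℕ) * (1 / 2 : ℝ) ^ n) := by
    intro n
    have h1 : (((n + j).choose j : ℕ) : ℝ) * n.factorial * j.factorial = (n + j).factorial := by
      exact_mod_cast Nat.add_choose_mul_factorial_mul_factorial n j
    rw [← h1, ← hBδ, mul_pow, pow_add]
    have : (n.factorial : ℝ) ≠ 0 := by positivity
    field_simp
  have hsum : Summable fun n : ℕ => K * B ^ (n + j) * (n + j).factorial * (δ ^ n / n.factorial) := by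
    simp only [hterm]
    have h1 : ‖(1 / 2 : ℝ)‖ < 1 := by norm_num
    exact (summable_choose_mul_geometric_of_norm_lt_one (R := ℝ) j h1).mul_left
      (K * B ^ j * j.factorial)
  unfold majSum
  rw [lintegral_tsum fun n => ((hm n).mul_const _).aemeasurable]
  refine ne_top_of_le_ne_top (b := ENNReal.ofReal (∑' n : ℕ,
    K * B ^ (n + j) * (n + j).factorial * (δ ^ n / n.factorial))) ENNReal.ofReal_ne_top ?_
  rw [ENNReal.ofReal_tsum_of_nonneg (fun n => by positivity) hsum]
  refine ENNReal.tsum_le_tsum fun n => ?_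
  rw [lintegral_mul_const _ (hm n), ENNReal.ofReal_mul (by positivity)]
  gcongr
  exact hbound (n + j)

lemma maj_ne_top_of_majSum_ne_top (hδ : 0 < δ) {j : ℕ} {k : R3}
    (h : majSum μ β R nf b δ j k ≠ ⊤) (n : ℕ) : maj μ β R nf (n + j) k ≠ ⊤ := by
  have h1 := ENNReal.ne_top_of_tsum_ne_top h n
  intro htop
  rw [htop, ENNReal.mul_top (by simp [Real.exp_pos]), ENNReal.top_mul] at h1
  · exact h1 rfl
  · simp only [ne_eq, ENNReal.ofReal_eq_zero, not_le]
    positivity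

lemma summable_maj (hδ : 0 < δ) {j : ℕ} {k : R3} (h : majSum μ β R nf b δ j k ≠ ⊤) :
    Summable (fun n : ℕ => (maj μ β R nf (n + j) k).toReal * (δ ^ n / n.factorial)) ∧
    Real.exp (b * ‖k‖) * ∑' n : ℕ, (maj μ β R nf (n + j) k).toReal * (δ ^ n / n.factorial) =
      (majSum μ β R nf b δ j k).toReal := by
  have e : ∀ n : ℕ, (ENNReal.ofReal (Real.exp (b * ‖k‖)) * maj μ β R nf (n + j) k *
      ENNReal.ofReal (δ ^ n / n.factorial)).toReal =
      Real.exp (b * ‖k‖) * ((maj μ β R nf (n + j) k).toReal * (δ ^ n / n.factorial)) := by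
    intro n
    rw [ENNReal.toReal_mul, ENNReal.toReal_mul, ENNReal.toReal_ofReal (Real.exp_nonneg _),
      ENNReal.toReal_ofReal (by positivity), mul_assoc]
  have hs := ENNReal.summable_toReal h
  simp only [e] at hs
  refine ⟨(summable_mul_left_iff (Real.exp_ne_zero _)).1 hs, ?_⟩
  unfold majSum
  rw [ENNReal.tsum_toReal_eq (ENNReal.ne_top_of_tsum_ne_top h), ← tsum_mul_left]
  exact (tsum_congr e).symm

end MajSum

/-! ### The Borel transform of the flow -/

section Transform

variable {μ β α R n₀ nf c : ℝ} {a fh : R3 → C3} {V : ℂ → R3 → C3}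

/-- The derivatives of the Borel transform, for each wave number. -/
def flowCoeff (c : ℝ) (a fh : R3 → C3) (V : ℂ → R3 → C3) (k : R3) (n : ℕ) (q : ℝ) : C3 :=
  borelCoeff c (fun t => V t k) (fun m => taylor a fh m k) n q

/-- The majorant of the derivatives of the Borel transform. -/
def coeffMaj (μ β R nf c : ℝ) (k : R3) (n : ℕ) : ℝ :=
  (maj μ β R nf (n + 1) k).toReal + 1 / (2 * c) * (maj μ β R nf (n + 2) k).toReal

lemma hasAsympExpansion_flow (hμ : 3 < μ) (hβ : 0 < β) (hα : 0 < α)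
    (hV : FourierFlow μ β α R a fh V) (ha : Datum μ β n₀ a) (hf : Datum μ β nf fh) (hR : n₀ ≤ R)
    {k : R3} (hk : ∀ N, maj μ β R nf N k ≠ ⊤) :
    HasAsympExpansion α (fun t => V t k) (fun m => taylor a fh m k)
      (fun N => (maj μ β R nf N k).toReal) where
  meas := hV.meas.comp_measurable measurable_prodMk_right
  holo := hV.holo k
  coeff m := by
    have := enorm_taylor_le_maj hμ hβ ha hf hR m k
    rw [← ofReal_norm] at this
    exact (ENNReal.ofReal_le_iff_le_toReal (hk m)).1 this
  rem N t ht := by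
    have := enorm_flowRem_le_maj hμ hβ hα hV ha hf hR N ht k
    rw [← ofReal_norm, ← ofReal_norm t, ← ENNReal.ofReal_pow (norm_nonneg t),
      ← ENNReal.ofReal_toReal (hk N), ← ENNReal.ofReal_mul ENNReal.toReal_nonneg,
      ENNReal.ofReal_le_ofReal_iff (by positivity)] at this
    exact this

lemma maj_ne_top {b δ : ℝ} (hδ : 0 < δ) {k : R3} (h : majSum μ β R nf b δ 1 k ≠ ⊤) (N : ℕ) :
    maj μ β R nf N k ≠ ⊤ := by
  cases N with
  | zero => rw [maj]; exact ENNReal.ofReal_ne_top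
  | succ N => exact maj_ne_top_of_majSum_ne_top hδ h N

/-- The bound for the derivative of order n + 1 involves the majorants of orders n + 2 and n + 3,
hence the summed majorants with shifts 2 and 3. -/
lemma halfLineJet_flow {b δ : ℝ} (hμ : 3 < μ) (hβ : 0 < β) (hα : 0 < α) (hc : α < c)
    (hV : FourierFlow μ β α R a fh V) (ha : Datum μ β n₀ a) (hf : Datum μ β nf fh) (hR : n₀ ≤ R)
    (hδ : 0 < δ) {k : R3} (h : ∀ j, majSum μ β R nf b δ j k ≠ ⊤) :
    HalfLineJet c δ (flowCoeff c a fh V k) (coeffMaj μ β R nf c k) := by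
  have hA := hasAsympExpansion_flow hμ hβ hα hV ha hf hR (maj_ne_top hδ (h 1))
  refine ⟨fun n q hq => hA.hasDerivWithinAt_borelCoeff hα hc n hq,
    fun n q hq => hA.norm_borelCoeff_le hα hc n hq, ?_⟩
  have h2 := (summable_maj hδ (h 2)).1
  have h3 := (summable_maj hδ (h 3)).1.mul_left (1 / (2 * c))
  refine (h2.add h3).congr fun n => ?_
  unfold coeffMaj
  ring

/-- The measurable kernel of the circle integral. -/
lemma stronglyMeasurable_flowCoeff (hμ : 3 < μ) (hβ : 0 < β) (hV : TimeField μ β α R V)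
    (ha : Datum μ β n₀ a) (hf : Datum μ β nf fh) (n : ℕ) :
    StronglyMeasurable fun z : R3 × ℝ => flowCoeff c a fh V z.1 n z.2 := by
  have hT : ∀ m, StronglyMeasurable (taylor a fh m) := fun m =>
    (rapid_taylor hμ hβ ha.rapid hf.rapid m).meas hβ
  unfold flowCoeff borelCoeff rimIntegral circleIntegral
  refine ((hT (n + 1)).comp_measurable measurable_fst).add (StronglyMeasurable.fun_const_smul ?_ _)
  simp only [intervalIntegral.integral_of_le (by positivity : (0 : ℝ) ≤ 2 * Real.pi)]
  refine StronglyMeasurable.integral_prod_right (f := fun (z : R3 × ℝ) (θ : ℝ) =>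
    deriv (circleMap ((1 / (2 * c) : ℝ) : ℂ) (1 / (2 * c))) θ •
      (Complex.exp (z.2 / rim c θ) * (rim c θ ^ (n + 2))⁻¹) •
        asympRem (fun t => V t z.1) (fun m => taylor a fh m z.1) (n + 2) (rim c θ)) ?_
  have hrim : Measurable (rim c) := (continuous_rim c).measurable
  have h1 : StronglyMeasurable fun w : (R3 × ℝ) × ℝ =>
      asympRem (fun t => V t w.1.1) (fun m => taylor a fh m w.1.1) (n + 2) (rim c w.2) := by
    unfold asympRem
    refine StronglyMeasurable.sub ?_ (Finset.stronglyMeasurable_fun_sum _ fun m _ => ?_)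
    · exact hV.meas.comp_measurable
        ((hrim.comp measurable_snd).prodMk (measurable_fst.comp measurable_fst))
    · have hp : Measurable fun w : (R3 × ℝ) × ℝ => rim c w.2 ^ m := by fun_prop
      exact hp.stronglyMeasurable.smul
        ((hT m).comp_measurable (measurable_fst.comp measurable_fst))
  have h2 : Measurable fun w : (R3 × ℝ) × ℝ =>
      Complex.exp ((w.1.2 : ℂ) / rim c w.2) * (rim c w.2 ^ (n + 2))⁻¹ := by fun_prop
  have h3 : Measurable fun w : (R3 × ℝ) × ℝ =>
      deriv (circleMap ((1 / (2 * c) : ℝ) : ℂ) (1 / (2 * c))) w.2 := by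
    simp only [deriv_circleMap]
    exact (((continuous_circleMap _ _).comp continuous_snd).mul continuous_const).measurable
  exact h3.stronglyMeasurable.smul (h2.stronglyMeasurable.smul h1)

/-- The Borel transform of the solution at complex positions. -/
def borelU (c : ℝ) (a fh : R3 → C3) (V : ℂ → R3 → C3) (x : C3) (p : ℂ) : C3 :=
  ∫ k, Complex.exp (Complex.I * kdot k x) • jetExtend (flowCoeff c a fh V k) p

lemma kdot_im (k : R3) (x : C3) : (kdot k x).im = inner ℝ k (imC3 x) := by
  unfold kdot imC3
  rw [Complex.im_sum, PiLp.inner_apply]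
  refine Finset.sum_congr rfl fun j _ => ?_
  simp [mul_comm]

lemma norm_exp_kdot_le (k : R3) (x : C3) :
    ‖Complex.exp (Complex.I * kdot k x)‖ ≤ Real.exp (‖imC3 x‖ * ‖k‖) := by
  rw [Complex.norm_exp, Complex.I_mul_re, kdot_im]
  refine Real.exp_le_exp.2 ?_
  have := abs_real_inner_le_norm k (imC3 x)
  rw [mul_comm]
  linarith [neg_abs_le (inner ℝ k (imC3 x) : ℝ)]

lemma continuous_imC3 : Continuous imC3 := by
  unfold imC3
  exact (PiLp.continuous_toLp 2 _).comp (by fun_prop)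

lemma one_add_mul_exp_le {b b' x : ℝ} (h : b' < b) (hx : 0 ≤ x) :
    (1 + x) * Real.exp (b' * x) ≤ (1 + 1 / (b - b')) * Real.exp (b * x) := by
  have hd : 0 < b - b' := by linarith
  have h1 : (b - b') * x + 1 ≤ Real.exp ((b - b') * x) := Real.add_one_le_exp _
  have h2 : 1 ≤ Real.exp ((b - b') * x) := Real.one_le_exp (by positivity)
  have h3 : x ≤ 1 / (b - b') * Real.exp ((b - b') * x) := by
    rw [div_mul_eq_mul_div, one_mul, le_div_iff₀ hd]
    linarith
  have h4 : 1 + x ≤ (1 + 1 / (b - b')) * Real.exp ((b - b') * x) := by linarith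
  calc _ ≤ (1 + 1 / (b - b')) * Real.exp ((b - b') * x) * Real.exp (b' * x) := by gcongr
    _ = _ := by rw [mul_assoc, ← Real.exp_add]; congr 2; ring

/-- The integrable bound of the Borel transform and of its derivative. -/
lemma exists_dominating {β' : ℝ} (hμ : 3 < μ) (hα : 0 < α) (hc : α < c)
    (hV : FourierFlow μ β α R a fh V) (ha : Datum μ β n₀ a) (hf : Datum μ β nf fh) (hR : n₀ ≤ R)
    (hβ' : 0 < β') (hββ' : β' < β) : ∃ δ : ℝ, 0 < δ ∧ ∃ G : R3 → ℝ, Integrable G ∧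
      ∀ᵐ k, HalfLineJet c δ (flowCoeff c a fh V k) (coeffMaj μ β R nf c k) ∧ 0 ≤ G k ∧
        ∀ p ∈ halfLineNhd δ,
          (1 + ‖k‖) * Real.exp (β' * ‖k‖) * ‖jetExtend (flowCoeff c a fh V k) p‖ ≤
            G k * Real.exp (c * ‖p‖) ∧
          Real.exp (β' * ‖k‖) * ‖jetExtend (fun n => flowCoeff c a fh V k (n + 1)) p‖ ≤
            G k * Real.exp (c * ‖p‖) := by
  have hβ : 0 < β := hβ'.trans hββ'
  have hc0 : 0 < c := hα.trans hc
  -- A rate strictly between β' and β: the gap b - β' pays for the factor 1 + |k| needed when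
  -- differentiating in x.
  set b := (β' + β) / 2 with hb
  have hb' : β' < b := by rw [hb]; linarith
  obtain ⟨δ, hδ, hfin⟩ := exists_lintegral_majSum_lt_top (μ := μ) (R := R) (nf := nf) hμ
    (hβ'.trans hb') (by rw [hb]; linarith : b < β) (ha.nonneg.trans hR) hf.nonneg
  set C := 1 + 1 / (b - β') with hC
  have hd : 0 < b - β' := by linarith
  have hC0 : 0 ≤ C := by positivity
  set T : ℕ → R3 → ℝ := fun j k => (majSum μ β R nf b δ j k).toReal with hT
  have hTi : ∀ j, Integrable (T j) := fun j =>
    integrable_toReal_of_lintegral_ne_top (measurable_majSum ..).aemeasurable (hfin j)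
  have hT0 : ∀ j k, 0 ≤ T j k := fun j k => ENNReal.toReal_nonneg
  refine ⟨δ, hδ, fun k => C * ((T 1 k + 1 / (2 * c) * T 2 k) + (T 2 k + 1 / (2 * c) * T 3 k)),
    ?_, ?_⟩
  · exact (((hTi 1).add ((hTi 2).const_mul _)).add ((hTi 2).add ((hTi 3).const_mul _))).const_mul C
  have hae : ∀ᵐ k, ∀ j, majSum μ β R nf b δ j k ≠ ⊤ := by
    rw [ae_all_iff]
    exact fun j => (ae_lt_top (measurable_majSum ..) (hfin j)).mono fun k hk => hk.ne
  filter_upwards [hae] with k hk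
  have hJ := halfLineJet_flow hμ hβ hα hc hV ha hf hR hδ hk
  have hx : ∀ j, 0 ≤ T j k := fun j => hT0 j k
  have x1 := hx 1
  have x2 := hx 2
  have x3 := hx 3
  refine ⟨hJ, by positivity, fun p hp => ?_⟩
  have hs : ∀ j, Real.exp (b * ‖k‖) * ∑' n : ℕ, coeffMaj μ β R nf c k (n + j) *
      (δ ^ n / n.factorial) = T (j + 1) k + 1 / (2 * c) * T (j + 2) k := by
    intro j
    obtain ⟨s1, e1⟩ := summable_maj hδ (hk (j + 1))
    obtain ⟨s2, e2⟩ := summable_maj hδ (hk (j + 2))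
    simp only [hT]
    rw [← e1, ← e2, mul_left_comm, ← mul_add, ← tsum_mul_left (a := 1 / (2 * c)),
      ← s1.tsum_add (s2.mul_left _)]
    congr 1
    refine tsum_congr fun n => ?_
    unfold coeffMaj
    ring_nf
  have hmono : (1 + ‖k‖) * Real.exp (β' * ‖k‖) ≤ C * Real.exp (b * ‖k‖) :=
    one_add_mul_exp_le hb' (norm_nonneg k)
  have hmono' : Real.exp (β' * ‖k‖) ≤ C * Real.exp (b * ‖k‖) := by
    refine le_trans ?_ hmono
    exact le_mul_of_one_le_left (Real.exp_nonneg _) (by linarith [norm_nonneg k])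
  have hnn : ∀ j, 0 ≤ ∑' n : ℕ, coeffMaj μ β R nf c k (n + j) * (δ ^ n / n.factorial) := fun j =>
    tsum_nonneg fun n => mul_nonneg (hJ.nonneg _) (by positivity)
  constructor
  · have h0 := hs 0
    simp only [add_zero, zero_add] at h0
    calc _ ≤ C * Real.exp (b * ‖k‖) * ((∑' n : ℕ, coeffMaj μ β R nf c k n *
          (δ ^ n / n.factorial)) * Real.exp (c * ‖p‖)) := by
          gcongr
          exact hJ.norm_jetExtend_le hc0.le hδ hp
      _ = C * (Real.exp (b * ‖k‖) * ∑' n : ℕ, coeffMaj μ β R nf c k n *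
          (δ ^ n / n.factorial)) * Real.exp (c * ‖p‖) := by ring
      _ = C * (T 1 k + 1 / (2 * c) * T 2 k) * Real.exp (c * ‖p‖) := by rw [h0]
      _ ≤ _ := by
          refine mul_le_mul_of_nonneg_right (mul_le_mul_of_nonneg_left ?_ hC0) (Real.exp_nonneg _)
          exact le_add_of_nonneg_right (by positivity)
  · have h0 := hs 1
    calc _ ≤ C * Real.exp (b * ‖k‖) * ((∑' n : ℕ, coeffMaj μ β R nf c k (n + 1) *
          (δ ^ n / n.factorial)) * Real.exp (c * ‖p‖)) := by
          gcongr
          exact hJ.norm_jetExtend_succ_le hc0.le hδ hp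
      _ = C * (Real.exp (b * ‖k‖) * ∑' n : ℕ, coeffMaj μ β R nf c k (n + 1) *
          (δ ^ n / n.factorial)) * Real.exp (c * ‖p‖) := by ring
      _ = C * (T 2 k + 1 / (2 * c) * T 3 k) * Real.exp (c * ‖p‖) := by rw [h0]
      _ ≤ _ := by
          refine mul_le_mul_of_nonneg_right (mul_le_mul_of_nonneg_left ?_ hC0) (Real.exp_nonneg _)
          exact le_add_of_nonneg_left (by positivity)

end Transform

/-! ### Analyticity in position and Borel variable, and Laplace inversion -/

section Transform

variable {μ β α R n₀ nf c : ℝ} {a fh : R3 → C3} {V : ℂ → R3 → C3}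

lemma stronglyMeasurable_flowCoeff_at (hμ : 3 < μ) (hβ : 0 < β) (hV : TimeField μ β α R V)
    (ha : Datum μ β n₀ a) (hf : Datum μ β nf fh) (n : ℕ) (q : ℝ) :
    StronglyMeasurable fun k : R3 => flowCoeff c a fh V k n q :=
  (stronglyMeasurable_flowCoeff hμ hβ hV ha hf n).comp_measurable measurable_prodMk_right

lemma aestronglyMeasurable_jetExtend {δ : ℝ} (hμ : 3 < μ) (hβ : 0 < β) (hV : TimeField μ β α R V)
    (ha : Datum μ β n₀ a) (hf : Datum μ β nf fh) (hδ : 0 < δ)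
    (hJ : ∀ᵐ k, HalfLineJet c δ (flowCoeff c a fh V k) (coeffMaj μ β R nf c k)) {p : ℂ}
    (hp : p ∈ halfLineNhd δ) :
    AEStronglyMeasurable (fun k => jetExtend (flowCoeff c a fh V k) p) ∧
    AEStronglyMeasurable (fun k => jetExtend (fun n => flowCoeff c a fh V k (n + 1)) p) := by
  have hp' := (mem_halfLineNhd_iff.1 hp).le
  have hm : ∀ n, StronglyMeasurable fun k => flowCoeff c a fh V k n (max p.re 0) := fun n =>
    stronglyMeasurable_flowCoeff_at hμ hβ hV ha hf n _
  constructor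
  · refine aestronglyMeasurable_of_tendsto_ae atTop (f := fun N k => ∑ n ∈ Finset.range N,
      ((p - (max p.re 0 : ℝ)) ^ n / (n.factorial : ℂ)) • flowCoeff c a fh V k n (max p.re 0))
      (fun N => ?_) ?_
    · exact (Finset.stronglyMeasurable_fun_sum _ fun n _ =>
        (hm n).fun_const_smul _).aestronglyMeasurable
    · filter_upwards [hJ] with k hk
      exact (hk.hasSum hδ (le_max_right _ _) hp').tendsto_sum_nat
  · refine aestronglyMeasurable_of_tendsto_ae atTop (f := fun N k => ∑ n ∈ Finset.range N,
      ((p - (max p.re 0 : ℝ)) ^ n / (n.factorial : ℂ)) • flowCoeff c a fh V k (n + 1) (max p.re 0))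
      (fun N => ?_) ?_
    · exact (Finset.stronglyMeasurable_fun_sum _ fun n _ =>
        (hm (n + 1)).fun_const_smul _).aestronglyMeasurable
    · filter_upwards [hJ] with k hk
      exact (hk.hasSum_succ (le_max_right _ _) hp').tendsto_sum_nat

lemma continuous_exp_kdot (x : C3) : Continuous fun k : R3 => Complex.exp (Complex.I * kdot k x) := by
  unfold kdot
  fun_prop

lemma hasFDerivAt_exp_kdot (k : R3) (x : C3) :
    HasFDerivAt (fun x : C3 => Complex.exp (Complex.I * kdot k x))
      (Complex.exp (Complex.I * kdot k x) • (Complex.I • innerSL ℂ (toC3 k))) x := by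
  have h1 : HasFDerivAt (fun x : C3 => Complex.I * kdot k x) (Complex.I • innerSL ℂ (toC3 k)) x := by
    have h2 := (Complex.I • innerSL ℂ (toC3 k)).hasFDerivAt (x := x)
    refine h2.congr_of_eventuallyEq (Eventually.of_forall fun y => ?_)
    simp [innerSL_apply_apply, inner_toC3]
  exact h1.cexp

/-- The derivative of `(x, p) ↦ e^{i k·x} W(p)`, where `w = W(p)` and `w' = W'(p)`. -/
def planeDeriv (k : R3) (x : C3) (w w' : C3) : C3 × ℂ →L[ℂ] C3 :=
  Complex.exp (Complex.I * kdot k x) • (ContinuousLinearMap.snd ℂ C3 ℂ).smulRight w' +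
    ((Complex.exp (Complex.I * kdot k x) • (Complex.I • innerSL ℂ (toC3 k))).comp
      (ContinuousLinearMap.fst ℂ C3 ℂ)).smulRight w

lemma planeDeriv_apply (k : R3) (x w w' : C3) (z : C3 × ℂ) : planeDeriv k x w w' z =
    Complex.exp (Complex.I * kdot k x) • z.2 • w' +
      (Complex.exp (Complex.I * kdot k x) * (Complex.I * kdot k z.1)) • w := by
  simp [planeDeriv, inner_toC3]

lemma continuous_planeDeriv (x : C3) :
    Continuous fun z : R3 × C3 × C3 => planeDeriv z.1 x z.2.1 z.2.2 := by
  have h1 : Continuous fun z : R3 × C3 × C3 => Complex.exp (Complex.I * kdot z.1 x) :=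
    (continuous_exp_kdot x).comp continuous_fst
  have h2 : Continuous fun z : R3 × C3 × C3 => innerSL ℂ (toC3 z.1) :=
    (innerSL ℂ).continuous.comp (continuous_toC3.comp continuous_fst)
  have hs := (ContinuousLinearMap.smulRightL ℂ (C3 × ℂ) C3).continuous₂
  have h3 : Continuous fun z : R3 × C3 × C3 => z.2.1 := by fun_prop
  have h4 : Continuous fun z : R3 × C3 × C3 => z.2.2 := by fun_prop
  exact (h1.smul (hs.comp (continuous_const.prodMk h4))).add
    (hs.comp (((h1.smul (h2.const_smul Complex.I)).clm_comp continuous_const).prodMk h3))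

lemma aestronglyMeasurable_planeDeriv {W W' : R3 → C3} (hW : AEStronglyMeasurable W)
    (hW' : AEStronglyMeasurable W') (x : C3) :
    AEStronglyMeasurable (fun k : R3 => planeDeriv k x (W k) (W' k)) volume := by
  have h0 : AEStronglyMeasurable (fun k : R3 => k) volume := continuous_id.aestronglyMeasurable
  have := (continuous_planeDeriv x).comp_aestronglyMeasurable (h0.prodMk (hW.prodMk hW'))
  exact this

lemma norm_planeDeriv_le (k : R3) (x w w' : C3) : ‖planeDeriv k x w w'‖ ≤
    ‖Complex.exp (Complex.I * kdot k x)‖ * (‖w'‖ + ‖k‖ * ‖w‖) := by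
  refine ContinuousLinearMap.opNorm_le_bound _ (by positivity) fun z => ?_
  rw [planeDeriv_apply]
  have h1 : ‖z.2‖ ≤ ‖z‖ := norm_snd_le z
  have h2 : ‖kdot k z.1‖ ≤ ‖k‖ * ‖z‖ :=
    (norm_kdot_le k z.1).trans (by gcongr; exact norm_fst_le z)
  refine (norm_add_le _ _).trans ?_
  rw [norm_smul, norm_smul, norm_smul, norm_mul, norm_mul, Complex.norm_I, one_mul]
  calc _ ≤ ‖Complex.exp (Complex.I * kdot k x)‖ * (‖z‖ * ‖w'‖) +
        ‖Complex.exp (Complex.I * kdot k x)‖ * (‖k‖ * ‖z‖) * ‖w‖ := by gcongr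
    _ = _ := by ring

lemma hasFDerivAt_planeDeriv (k : R3) {W : ℂ → C3} {w' : C3} {z : C3 × ℂ}
    (hW : HasDerivAt W w' z.2) :
    HasFDerivAt (fun z : C3 × ℂ => Complex.exp (Complex.I * kdot k z.1) • W z.2)
      (planeDeriv k z.1 (W z.2) w') z := by
  have h1 : HasFDerivAt (fun z : C3 × ℂ => Complex.exp (Complex.I * kdot k z.1))
      ((Complex.exp (Complex.I * kdot k z.1) • (Complex.I • innerSL ℂ (toC3 k))).comp
        (ContinuousLinearMap.fst ℂ C3 ℂ)) z :=
    (hasFDerivAt_exp_kdot k z.1).comp z hasFDerivAt_fst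
  have h2 : HasFDerivAt (fun z : C3 × ℂ => W z.2)
      ((ContinuousLinearMap.snd ℂ C3 ℂ).smulRight w') z := by
    have h3 := hW.hasFDerivAt.comp z (hasFDerivAt_snd (𝕜 := ℂ) (E := C3) (F := ℂ))
    refine h3.congr_fderiv ?_
    ext w <;> simp
  exact h1.smul h2

/-- Differentiation under the k-integral. Shifting x into the strip costs at most e^{β'|k|} and an
x-derivative costs a further |k|; both are covered by `exists_dominating`. Only δ and the bound
depend on β', not the function. -/
lemma differentiableOn_borelU {β' : ℝ} (hμ : 3 < μ) (hα : 0 < α) (hc : α < c)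
    (hV : FourierFlow μ β α R a fh V) (ha : Datum μ β n₀ a) (hf : Datum μ β nf fh) (hR : n₀ ≤ R)
    (hβ' : 0 < β') (hββ' : β' < β) : ∃ δ : ℝ, 0 < δ ∧
      DifferentiableOn ℂ (fun z : C3 × ℂ => borelU c a fh V z.1 z.2)
        ({x | ‖imC3 x‖ < β'} ×ˢ halfLineNhd δ) ∧
      ∃ C : ℝ, ∀ x : C3, ‖imC3 x‖ < β' → ∀ p ∈ halfLineNhd δ,
        ‖borelU c a fh V x p‖ ≤ C * Real.exp (c * ‖p‖) := by
  have hβ : 0 < β := hβ'.trans hββ'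
  have hc0 : 0 < c := hα.trans hc
  obtain ⟨δ, hδ, G, hG, hdom⟩ := exists_dominating hμ hα hc hV ha hf hR hβ' hββ'
  have hVF := hV.toTimeField
  have hmeas : ∀ p ∈ halfLineNhd δ, _ := fun p hp =>
    aestronglyMeasurable_jetExtend hμ hβ hVF ha hf hδ (hdom.mono fun k hk => hk.1) hp
  have hexp : ∀ x : C3, ‖imC3 x‖ < β' → ∀ k,
      ‖Complex.exp (Complex.I * kdot k x)‖ ≤ Real.exp (β' * ‖k‖) := fun x hx k =>
    (norm_exp_kdot_le k x).trans (Real.exp_le_exp.2 (by gcongr))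
  have hFb : ∀ x : C3, ‖imC3 x‖ < β' → ∀ p ∈ halfLineNhd δ, ∀ᵐ k,
      ‖Complex.exp (Complex.I * kdot k x) • jetExtend (flowCoeff c a fh V k) p‖ ≤
        G k * Real.exp (c * ‖p‖) := by
    intro x hx p hp
    filter_upwards [hdom] with k hk
    rw [norm_smul]
    refine le_trans ?_ (hk.2.2 p hp).1
    have h1 : Real.exp (β' * ‖k‖) ≤ (1 + ‖k‖) * Real.exp (β' * ‖k‖) :=
      le_mul_of_one_le_left (Real.exp_nonneg _) (by linarith [norm_nonneg k])
    gcongr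
    exact (hexp x hx k).trans h1
  have hFm : ∀ x : C3, ∀ p ∈ halfLineNhd δ, AEStronglyMeasurable
      (fun k => Complex.exp (Complex.I * kdot k x) • jetExtend (flowCoeff c a fh V k) p) :=
    fun x p hp => (continuous_exp_kdot x).aestronglyMeasurable.smul (hmeas p hp).1
  refine ⟨δ, hδ, ?_, ∫ k, G k, ?_⟩
  · rintro ⟨x₀, p₀⟩ ⟨hx₀, hp₀⟩
    refine DifferentiableAt.differentiableWithinAt ?_
    -- Bounding |p| locally makes the factor e^{c|p|} a constant in the dominating function.
    set D : Set (C3 × ℂ) := ({x | ‖imC3 x‖ < β'} ×ˢ halfLineNhd δ) ∩ {z | ‖z.2‖ < ‖p₀‖ + 1} with hD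
    have hDo : IsOpen D := by
      refine IsOpen.inter (IsOpen.prod ?_ (isOpen_halfLineNhd δ)) ?_
      · exact isOpen_lt continuous_imC3.norm continuous_const
      · exact isOpen_lt continuous_snd.norm continuous_const
    have hDm : D ∈ 𝓝 (x₀, p₀) := hDo.mem_nhds ⟨⟨hx₀, hp₀⟩, by
      change ‖p₀‖ < ‖p₀‖ + 1
      linarith⟩
    have hd := hasFDerivAt_integral_of_dominated_of_fderiv_le (μ := volume) (𝕜 := ℂ)
      (F := fun (z : C3 × ℂ) k =>
        Complex.exp (Complex.I * kdot k z.1) • jetExtend (flowCoeff c a fh V k) z.2)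
      (F' := fun z k => planeDeriv k z.1 (jetExtend (flowCoeff c a fh V k) z.2)
        (jetExtend (fun n => flowCoeff c a fh V k (n + 1)) z.2))
      (bound := fun k => 2 * Real.exp (c * (‖p₀‖ + 1)) * G k) hDm ?_ ?_ ?_ ?_
      (hG.const_mul _) ?_
    · exact hd.differentiableAt
    · filter_upwards [hDm] with z hz using hFm z.1 z.2 hz.1.2
    · exact (hG.mul_const _).mono' (hFm x₀ p₀ hp₀) (hFb x₀ hx₀ p₀ hp₀)
    · exact aestronglyMeasurable_planeDeriv (hmeas p₀ hp₀).1 (hmeas p₀ hp₀).2 x₀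
    · filter_upwards [hdom] with k hk z hz
      obtain ⟨⟨hzx, hzp⟩, hz2⟩ := hz
      obtain ⟨hb1, hb2⟩ := hk.2.2 z.2 hzp
      have hexpp : G k * Real.exp (c * ‖z.2‖) ≤ G k * Real.exp (c * (‖p₀‖ + 1)) := by
        have hG0 := hk.2.1
        have : ‖z.2‖ ≤ ‖p₀‖ + 1 := le_of_lt hz2
        gcongr
      set w := ‖jetExtend (flowCoeff c a fh V k) z.2‖
      set w' := ‖jetExtend (fun n => flowCoeff c a fh V k (n + 1)) z.2‖
      have hw : 0 ≤ w := norm_nonneg _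
      have hw' : 0 ≤ w' := norm_nonneg _
      have he := Real.exp_pos (β' * ‖k‖)
      calc _ ≤ _ := norm_planeDeriv_le _ _ _ _
        _ ≤ Real.exp (β' * ‖k‖) * (w' + ‖k‖ * w) :=
          mul_le_mul_of_nonneg_right (hexp z.1 hzx k) (by positivity)
        _ ≤ Real.exp (β' * ‖k‖) * w' + (1 + ‖k‖) * Real.exp (β' * ‖k‖) * w := by
          have : 0 ≤ Real.exp (β' * ‖k‖) * w := by positivity
          linarith
        _ ≤ _ := by linarith
    · filter_upwards [hdom] with k hk z hz
      exact hasFDerivAt_planeDeriv k (hk.1.hasDerivAt_jetExtend hc0.le hδ hz.1.2)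
  · intro x hx p hp
    unfold borelU
    refine (norm_integral_le_of_norm_le (hG.mul_const _) (hFb x hx p hp)).trans ?_
    rw [integral_mul_const]

lemma kdot_ofReal (k x : R3) : kdot k (toC3 x) = ((inner ℝ k x : ℝ) : ℂ) := by
  unfold kdot toC3
  rw [PiLp.inner_apply]
  push_cast
  refine Finset.sum_congr rfl fun j _ => ?_
  simp [mul_comm]

/-- The solution is the Laplace transform of `borelU`. -/
lemma laplace_borelU (hμ : 3 < μ) (hβ : 0 < β) (hα : 0 < α) (hc : α < c)
    (hV : FourierFlow μ β α R a fh V) (ha : Datum μ β n₀ a) (hf : Datum μ β nf fh) (hR : n₀ ≤ R)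
    {t : ℂ} (ht : t ∈ timeDomain c) (x : R3) :
    invF (V t) x = invF a x + ∫ p in Set.Ioi (0 : ℝ),
      Complex.exp (-(p : ℂ) / t) • borelU c a fh V (toC3 x) (p : ℂ) := by
  have hc0 : 0 < c := hα.trans hc
  have hVF := hV.toTimeField
  obtain ⟨δ, hδ, G, hG, hdom⟩ := exists_dominating hμ hα hc hV ha hf hR
    (half_pos hβ) (half_lt_self hβ)
  have htc : c < (t⁻¹).re := by
    have : t ∈ timeDomain c := ht
    unfold timeDomain at this
    rwa [Set.mem_ofPred_eq, one_div] at this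
  set η := (t⁻¹).re - c with hη
  have hη0 : 0 < η := by linarith
  have hnorm : ∀ p : ℝ, ‖Complex.exp (-(p : ℂ) / t)‖ = Real.exp (-(η + c) * p) := by
    intro p
    rw [Complex.norm_exp, div_eq_mul_inv, neg_mul, Complex.neg_re, Complex.re_ofReal_mul, hη]
    congr 1
    ring
  set K : ℝ → R3 → C3 := fun p k => Complex.exp (-(p : ℂ) / t) • phase k x •
    flowCoeff c a fh V k 0 p with hK
  have hKm : StronglyMeasurable (Function.uncurry K) := by
    have h1 : StronglyMeasurable fun z : ℝ × R3 => flowCoeff c a fh V z.2 0 z.1 :=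
      (stronglyMeasurable_flowCoeff hμ hβ hVF ha hf 0).comp_measurable measurable_swap
    have h2 : Measurable fun z : ℝ × R3 => Complex.exp (-(z.1 : ℂ) / t) := by fun_prop
    have h3 : Measurable fun z : ℝ × R3 => phase z.2 x :=
      ((continuous_phase_left x).comp continuous_snd).measurable
    exact h2.stronglyMeasurable.smul (h3.stronglyMeasurable.smul h1)
  have hmem : ∀ p : ℝ, 0 ≤ p → (p : ℂ) ∈ halfLineNhd δ := by
    intro p hp
    rw [mem_halfLineNhd_iff, Complex.ofReal_re, max_eq_left hp, sub_self, norm_zero]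
    exact hδ
  have hbd : ∀ᵐ k, ∀ p : ℝ, 0 ≤ p → ‖K p k‖ ≤ Real.exp (-η * p) * G k := by
    filter_upwards [hdom] with k hk p hp
    have h1 := (hk.2.2 p (hmem p hp)).1
    rw [jetExtend_ofReal _ hp, Complex.norm_real, Real.norm_of_nonneg hp] at h1
    have h2 : ‖flowCoeff c a fh V k 0 p‖ ≤
        (1 + ‖k‖) * Real.exp (β / 2 * ‖k‖) * ‖flowCoeff c a fh V k 0 p‖ := by
      refine le_mul_of_one_le_left (norm_nonneg _) ?_
      have e1 : 1 ≤ Real.exp (β / 2 * ‖k‖) := Real.one_le_exp (by positivity)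
      have e2 : 1 ≤ 1 + ‖k‖ := by linarith [norm_nonneg k]
      exact one_le_mul_of_one_le_of_one_le e2 e1
    rw [hK, norm_smul, norm_smul, norm_phase, one_mul, hnorm]
    calc _ ≤ Real.exp (-(η + c) * p) * (G k * Real.exp (c * p)) := by
          gcongr
          exact h2.trans h1
      _ = (Real.exp (-(η + c) * p) * Real.exp (c * p)) * G k := by ring
      _ = _ := by rw [← Real.exp_add]; congr 2; ring
  have hexpη : IntegrableOn (fun p : ℝ => Real.exp (-η * p)) (Set.Ioi (0 : ℝ)) :=
    exp_neg_integrableOn_Ioi 0 hη0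
  have hKi : Integrable (Function.uncurry K)
      ((volume.restrict (Set.Ioi (0 : ℝ))).prod (volume : Measure R3)) := by
    refine (Integrable.mul_prod hexpη hG).mono' hKm.aestronglyMeasurable ?_
    have h1 : ∀ᵐ z ∂((volume.restrict (Set.Ioi (0 : ℝ))).prod (volume : Measure R3)),
        ∀ p : ℝ, 0 ≤ p → ‖K p z.2‖ ≤ Real.exp (-η * p) * G z.2 :=
      Measure.quasiMeasurePreserving_snd.ae hbd
    have h2 : ∀ᵐ z ∂((volume.restrict (Set.Ioi (0 : ℝ))).prod (volume : Measure R3)),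
        z.1 ∈ Set.Ioi (0 : ℝ) :=
      Measure.quasiMeasurePreserving_fst.ae (ae_restrict_mem measurableSet_Ioi)
    filter_upwards [h1, h2] with z hz hz2
    exact hz z.1 (le_of_lt hz2)
  have hU : ∫ p in Set.Ioi (0 : ℝ), Complex.exp (-(p : ℂ) / t) • borelU c a fh V (toC3 x) (p : ℂ) =
      ∫ p in Set.Ioi (0 : ℝ), ∫ k, K p k := by
    refine setIntegral_congr_fun measurableSet_Ioi fun p hp => ?_
    beta_reduce
    unfold borelU
    rw [← integral_smul]
    refine integral_congr_ae (Eventually.of_forall fun k => ?_)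
    simp only [hK, phase, kdot_ofReal]
    rw [jetExtend_ofReal _ (le_of_lt hp)]
  rw [hU, integral_integral_swap hKi]
  -- Laplace inversion is available wherever all majorants are finite, which is almost everywhere
  -- because their weighted sum is integrable.
  have hlap : ∀ᵐ k, ∫ p in Set.Ioi (0 : ℝ), K p k = phase k x • V t k - phase k x • a k := by
    obtain ⟨δ', hδ', hfin⟩ := exists_lintegral_majSum_lt_top (μ := μ) (β := β) (R := R) (nf := nf)
      hμ (half_pos hβ) (half_lt_self hβ) (ha.nonneg.trans hR) hf.nonneg
    filter_upwards [ae_lt_top (measurable_majSum ..) (hfin 1)] with k hk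
    have hA := hasAsympExpansion_flow hμ hβ hα hV ha hf hR (maj_ne_top hδ' hk.ne)
    have h1 := hA.laplace_borelCoeff hα hc ht
    simp only [taylor_zero] at h1
    have e : ∀ p : ℝ, K p k = phase k x • (Complex.exp (-(p : ℂ) / t) •
        borelCoeff c (fun t => V t k) (fun m => taylor a fh m k) 0 p) := by
      intro p
      simp only [hK]
      rw [smul_comm]
      rfl
    simp only [e]
    rw [integral_smul, h1, smul_sub]
  rw [integral_congr_ae hlap, integral_sub (integrable_phase_smul (hVF.tame hμ hβ t).int x)
    (integrable_phase_smul (ha.tame hμ hβ).int x)]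
  unfold invF
  abel

end Transform

/-! ### Almost everywhere bounds and the differential inequality for uniqueness -/

open scoped ContDiff

lemma bil_congr_ae {g g' h h' : R3 → C3} (hg : g =ᵐ[volume] g') (hh : h =ᵐ[volume] h') :
    bil g h = bil g' h' := by
  ext1 k
  unfold bil
  refine Finset.sum_congr rfl fun j _ => ?_
  congr 2
  unfold fconv
  refine integral_congr_ae ?_
  have h1 : (fun k' => h (k - k')) =ᵐ[volume] fun k' => h' (k - k') :=
    (quasiMeasurePreserving_sub_left volume k).ae_eq_comp hh
  filter_upwards [hg, h1] with k' e1 e2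
  rw [e1, e2]

/-- Convolutions do not see null sets. The estimate is needed in this form because the uniqueness
argument bounds the difference of two solutions only almost everywhere. -/
lemma norm_bil_le_of_ae {μ b : ℝ} (hμ : 3 < μ) (hb : 0 ≤ b) {g h : R3 → C3}
    (hg : StronglyMeasurable g) (hh : StronglyMeasurable h) {A B : ℝ} (hA : 0 ≤ A) (hB : 0 ≤ B)
    (hgA : ∀ᵐ k, ‖g k‖ ≤ A * wt μ b k) (hhB : ∀ᵐ k, ‖h k‖ ≤ B * wt μ b k) (k : R3) :
    ‖bil g h k‖ ≤ ‖k‖ * (A * B * convConst μ * wt μ b k) := by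
  have key : ∀ {g : R3 → C3} {A : ℝ}, 0 ≤ A → StronglyMeasurable g →
      (∀ᵐ k, ‖g k‖ ≤ A * wt μ b k) →
      ∃ g', StronglyMeasurable g' ∧ (∀ k, ‖g' k‖ ≤ A * wt μ b k) ∧ g =ᵐ[volume] g' := by
    intro g A hA hg hgA
    have hS : MeasurableSet {k | ‖g k‖ ≤ A * wt μ b k} :=
      measurableSet_le hg.norm.measurable ((measurable_wt μ b).const_mul A)
    refine ⟨Set.indicator {k | ‖g k‖ ≤ A * wt μ b k} g, hg.indicator hS, fun k => ?_, ?_⟩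
    · by_cases hk : k ∈ {k | ‖g k‖ ≤ A * wt μ b k}
      · rw [Set.indicator_of_mem hk]; exact hk
      · rw [Set.indicator_of_notMem hk, norm_zero]
        exact mul_nonneg hA (wt_pos _ _ _).le
    · filter_upwards [hgA] with k hk
      rw [Set.indicator_of_mem]
      exact hk
  obtain ⟨g', hg', hb', he⟩ := key hA hg hgA
  obtain ⟨h', hh', hbh', heh⟩ := key hB hh hhB
  rw [bil_congr_ae he heh]
  exact norm_bil_le hμ hb hg' hh' hA hB hb' hbh' k

/-- The right hand side of the equation in Fourier space, without forcing. -/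
def rate (g : R3 → C3) (k : R3) : C3 := (-((‖k‖ ^ 2 : ℝ) : ℂ)) • g k - bil g g k

section Rate

variable {μ β M : ℝ} {g h : R3 → C3}

lemma Datum.integrable_rate (hμ : 3 < μ) (hβ : 0 < β) (hg : Datum μ β M g) :
    Integrable (rate g) :=
  (hg.integrable_lap hμ hβ).sub (hg.integrable_bil hμ hβ)

lemma Datum.norm_rate_le (hμ : 3 < μ) (hβ : 0 < β) (hg : Datum μ β M g) (k : R3) :
    ‖rate g k‖ ≤ M * (‖k‖ ^ 2 * wt μ β k) + M * M * convConst μ * (‖k‖ ^ 1 * wt μ β k) := by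
  have h1 := norm_bil_le hμ hβ.le hg.meas hg.meas hg.nonneg hg.nonneg hg.bound hg.bound k
  have h2 : ‖(-((‖k‖ ^ 2 : ℝ) : ℂ)) • g k‖ ≤ ‖k‖ ^ 2 * (M * wt μ β k) := by
    rw [norm_smul, norm_neg, Complex.norm_real, Real.norm_of_nonneg (by positivity)]
    exact mul_le_mul_of_nonneg_left (hg.bound k) (by positivity)
  unfold rate
  refine (norm_sub_le _ _).trans ((add_le_add h2 h1).trans (le_of_eq ?_))
  ring

lemma Datum.exists_norm_invF_rate_le (hμ : 3 < μ) (hβ : 0 < β) (M : ℝ) :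
    ∃ L : ℝ, ∀ g, Datum μ β M g → ∀ x, ‖invF (rate g) x‖ ≤ L := by
  refine ⟨∫ k, (M * (‖k‖ ^ 2 * wt μ β k) + M * M * convConst μ * (‖k‖ ^ 1 * wt μ β k)),
    fun g hg x => (norm_invF_le _ x).trans ?_⟩
  exact integral_mono (hg.integrable_rate hμ hβ).norm
    (((integrable_pow_mul_wt hμ hβ 2).const_mul M).add
      ((integrable_pow_mul_wt hμ hβ 1).const_mul (M * M * convConst μ)))
    (hg.norm_rate_le hμ hβ)

lemma continuous_invF {E : Type*} [NormedAddCommGroup E] [NormedSpace ℂ E] {g : R3 → E}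
    (hg : Integrable g) : Continuous (invF g) := by
  have := contDiff_invF (g := g) (N := 0) fun n hn => by
    obtain rfl : n = 0 := by omega
    simpa using hg.norm
  exact this.continuous

lemma rate_sub (hμ : 3 < μ) (hβ : 0 < β) (hg : Datum μ β M g) (hh : Datum μ β M h) (k : R3) :
    rate g k - rate h k = (-((‖k‖ ^ 2 : ℝ) : ℂ)) • (g k - h k) -
      (bil (g - h) g k + bil h (g - h) k) := by
  rw [← bil_self_sub (hg.tame hμ hβ) (hh.tame hμ hβ)]
  unfold rate
  rw [smul_sub]
  abel

end Rate

/-- A linear differential inequality with zero initial value. -/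
lemma norm_le_of_linear_ode {E : Type*} [NormedAddCommGroup E] [NormedSpace ℝ E] {T κ lam A : ℝ}
    (hκ : 0 < κ + lam) {Y r : ℝ → E}
    (hY : ∀ s ∈ Set.Ioo 0 T, HasDerivAt Y (-κ • Y s + r s) s)
    (h0 : Tendsto Y (𝓝[>] 0) (𝓝 0)) (hr : ∀ s ∈ Set.Ioo 0 T, ‖r s‖ ≤ A * Real.exp (lam * s))
    {t : ℝ} (ht : t ∈ Set.Ioo 0 T) : ‖Y t‖ ≤ A * Real.exp (lam * t) / (κ + lam) := by
  -- The integrating factor e^{κs} leaves Z' = e^{κs} r(s), whose norm is at most A e^{(κ+λ)s}.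
  -- Integration produces the gain 1/(κ+λ).
  set Z : ℝ → E := fun s => Real.exp (κ * s) • Y s with hZ
  have hZd : ∀ s ∈ Set.Ioo 0 T, HasDerivAt Z (Real.exp (κ * s) • r s) s := by
    intro s hs
    have h1 : HasDerivAt (fun s : ℝ => Real.exp (κ * s)) (Real.exp (κ * s) * (κ * 1)) s :=
      ((hasDerivAt_id s).const_mul κ).exp
    refine (h1.smul (hY s hs)).congr_deriv ?_
    rw [smul_add, smul_smul, mul_one, add_right_comm, ← add_smul]
    simp
  have hZ0 : Tendsto Z (𝓝[>] 0) (𝓝 0) := by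
    have h1 : Tendsto (fun s : ℝ => Real.exp (κ * s)) (𝓝[>] 0) (𝓝 (Real.exp (κ * 0))) :=
      ((by fun_prop : Continuous fun s : ℝ => Real.exp (κ * s)).tendsto 0).mono_left
        nhdsWithin_le_nhds
    simpa using h1.smul h0
  have hb : ∀ ε ∈ Set.Ioo 0 t, ‖Z t - Z ε‖ ≤
      A / (κ + lam) * (Real.exp ((κ + lam) * t) - Real.exp ((κ + lam) * ε)) := by
    intro ε hε
    have hsub : ∀ s ∈ Set.Icc ε t, s ∈ Set.Ioo 0 T := fun s hs =>
      ⟨hε.1.trans_le hs.1, hs.2.trans_lt ht.2⟩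
    refine image_norm_le_of_norm_deriv_right_le_deriv_boundary (a := ε) (b := t)
      (f := fun s => Z s - Z ε) (f' := fun s => Real.exp (κ * s) • r s)
      (B := fun s => A / (κ + lam) * (Real.exp ((κ + lam) * s) - Real.exp ((κ + lam) * ε)))
      (B' := fun s => A * Real.exp ((κ + lam) * s)) ?_ ?_ ?_ ?_ ?_ (Set.right_mem_Icc.2 hε.2.le)
    · exact fun s hs => ((hZd s (hsub s hs)).sub_const _).continuousAt.continuousWithinAt
    · exact fun s hs => ((hZd s (hsub s ⟨hs.1, hs.2.le⟩)).sub_const _).hasDerivWithinAt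
    · simp
    · intro s
      have h1 : HasDerivAt (fun s : ℝ => Real.exp ((κ + lam) * s))
          (Real.exp ((κ + lam) * s) * ((κ + lam) * 1)) s :=
        ((hasDerivAt_id s).const_mul (κ + lam)).exp
      refine ((h1.sub_const _).const_mul (A / (κ + lam))).congr_deriv ?_
      field_simp
    · intro s hs
      rw [norm_smul, Real.norm_of_nonneg (Real.exp_nonneg _), add_mul, Real.exp_add]
      have := hr s (hsub s ⟨hs.1, hs.2.le⟩)
      calc _ ≤ Real.exp (κ * s) * (A * Real.exp (lam * s)) := by gcongr
        _ = _ := by ring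
  have hlim1 : Tendsto (fun ε => ‖Z t - Z ε‖) (𝓝[>] 0) (𝓝 ‖Z t - 0‖) :=
    (tendsto_const_nhds.sub hZ0).norm
  have hlim2 : Tendsto (fun ε : ℝ => A / (κ + lam) *
      (Real.exp ((κ + lam) * t) - Real.exp ((κ + lam) * ε))) (𝓝[>] 0)
      (𝓝 (A / (κ + lam) * (Real.exp ((κ + lam) * t) - Real.exp ((κ + lam) * 0)))) :=
    ((by fun_prop : Continuous fun ε : ℝ => A / (κ + lam) *
      (Real.exp ((κ + lam) * t) - Real.exp ((κ + lam) * ε))).tendsto 0).mono_left nhdsWithin_le_nhds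
  have hle := le_of_tendsto_of_tendsto hlim1 hlim2
    (by filter_upwards [Ioo_mem_nhdsGT ht.1] with ε hε using hb ε hε)
  have hA : 0 ≤ A := by
    have := (norm_nonneg _).trans (hr t ht)
    exact nonneg_of_mul_nonneg_left this (Real.exp_pos _)
  rw [sub_zero, hZ, norm_smul, Real.norm_of_nonneg (Real.exp_nonneg _), mul_zero,
    Real.exp_zero] at hle
  have h2 : Real.exp (κ * t) * ‖Y t‖ ≤
      Real.exp (κ * t) * (A * Real.exp (lam * t) / (κ + lam)) := by
    calc _ ≤ _ := hle
      _ ≤ A / (κ + lam) * Real.exp ((κ + lam) * t) := by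
          have : 0 ≤ A / (κ + lam) := by positivity
          nlinarith
      _ = _ := by rw [add_mul, Real.exp_add]; ring
  exact le_of_mul_le_mul_left h2 (Real.exp_pos _)

/-! ### Uniqueness -/

/-- Two families of Fourier data whose difference satisfies, in physical space, the difference of
the equations on `(0,T)`, with zero initial value. -/
structure TwoFlows (μ β M T : ℝ) (g h : ℝ → R3 → C3) : Prop where
  left : ∀ s ∈ Set.Ioo 0 T, Datum μ β M (g s)
  right : ∀ s ∈ Set.Ioo 0 T, Datum μ β M (h s)
  deriv : ∀ s ∈ Set.Ioo 0 T, ∀ x, HasDerivAt (fun s => invF (g s) x - invF (h s) x)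
    (invF (rate (g s)) x - invF (rate (h s)) x) s
  initial : ∀ x, Tendsto (fun s => invF (g s) x - invF (h s) x) (𝓝[>] 0) (𝓝 0)

namespace TwoFlows

variable {μ β M T : ℝ} {g h : ℝ → R3 → C3}

lemma integrable_smul {φ : R3 → ℂ} (hφ : Continuous φ) (hφc : HasCompactSupport φ) {u : R3 → C3}
    (hu : Integrable u) : Integrable fun k => φ k • u k := by
  obtain ⟨C, hC⟩ := hφ.bounded_above_of_compact_support hφc
  refine (hu.norm.const_mul C).mono' (hφ.aestronglyMeasurable.smul hu.1)
    (Eventually.of_forall fun k => ?_)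
  rw [norm_smul]
  exact mul_le_mul_of_nonneg_right (hC k) (norm_nonneg _)

/-- The weak formulation of the difference of the equations. -/
lemma weak (hμ : 3 < μ) (hβ : 0 < β) (H : TwoFlows μ β M T g h) (hT : 0 < T) {φ : R3 → ℂ}
    (hφ : ContDiff ℝ ∞ φ) (hφc : HasCompactSupport φ) :
    (∀ s ∈ Set.Ioo 0 T, HasDerivAt (fun s => ∫ k, φ k • (g s k - h s k))
      (∫ k, φ k • (rate (g s) k - rate (h s) k)) s) ∧
    Tendsto (fun s => ∫ k, φ k • (g s k - h s k)) (𝓝[>] 0) (𝓝 0) := by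
  obtain ⟨Φ, hΦ, rfl⟩ := exists_invF_eq hφ hφc
  obtain ⟨L, hL⟩ := Datum.exists_norm_invF_rate_le hμ hβ M
  have hgi : ∀ s ∈ Set.Ioo 0 T, Integrable (g s) := fun s hs => ((H.left s hs).tame hμ hβ).int
  have hhi : ∀ s ∈ Set.Ioo 0 T, Integrable (h s) := fun s hs => ((H.right s hs).tame hμ hβ).int
  have hpair : ∀ {u w : R3 → C3}, Integrable u → Integrable w →
      ∫ k, invF Φ k • (u k - w k) = ∫ x, Φ x • (invF u x - invF w x) := by
    intro u w hu hw
    refine (integral_invF_smul hΦ (hu.sub hw)).trans ?_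
    refine integral_congr_ae (Eventually.of_forall fun x => ?_)
    beta_reduce
    rw [← invF_sub hu hw]
    rfl
  have hm : ∀ {u w : R3 → C3}, Integrable u → Integrable w →
      AEStronglyMeasurable (fun x => Φ x • (invF u x - invF w x)) volume := by
    intro u w hu hw
    exact hΦ.1.smul ((continuous_invF hu).sub (continuous_invF hw)).aestronglyMeasurable
  have hwb : ∀ s ∈ Set.Ioo 0 T, ∀ x, ‖invF (g s) x - invF (h s) x‖ ≤ 2 * (M * ∫ k, wt μ β k) := by
    intro s hs x
    have hb : ∀ {u : R3 → C3}, Datum μ β M u → ‖invF u x‖ ≤ M * ∫ k, wt μ β k := by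
      intro u hu
      refine (norm_invF_le _ x).trans ?_
      rw [← integral_const_mul]
      exact integral_mono (hu.tame hμ hβ).int.norm ((integrable_wt hμ hβ.le).const_mul M) hu.bound
    have h1 := hb (H.left s hs)
    have h2 := hb (H.right s hs)
    have := norm_sub_le (invF (g s) x) (invF (h s) x)
    linarith
  have hIoo : ∀ s ∈ Set.Ioo 0 T, Set.Ioo 0 T ∈ 𝓝 s := fun s hs => isOpen_Ioo.mem_nhds hs
  constructor
  · intro s hs
    have hd := (hasDerivAt_integral_of_dominated_loc_of_deriv_le (μ := volume)
      (F := fun s x => Φ x • (invF (g s) x - invF (h s) x))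
      (F' := fun s x => Φ x • (invF (rate (g s)) x - invF (rate (h s)) x))
      (bound := fun x => ‖Φ x‖ * (2 * L)) (hIoo s hs) ?_ ?_ ?_ ?_ (hΦ.norm.mul_const _) ?_).2
    · rw [hpair ((H.left s hs).integrable_rate hμ hβ) ((H.right s hs).integrable_rate hμ hβ)]
      refine hd.congr_of_eventuallyEq ?_
      filter_upwards [hIoo s hs] with y hy using hpair (hgi y hy) (hhi y hy)
    · filter_upwards [hIoo s hs] with y hy using hm (hgi y hy) (hhi y hy)
    · refine (hΦ.norm.mul_const (2 * (M * ∫ k, wt μ β k))).mono' (hm (hgi s hs) (hhi s hs))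
        (Eventually.of_forall fun x => ?_)
      rw [norm_smul]
      exact mul_le_mul_of_nonneg_left (hwb s hs x) (norm_nonneg _)
    · exact hm ((H.left s hs).integrable_rate hμ hβ) ((H.right s hs).integrable_rate hμ hβ)
    · refine Eventually.of_forall fun x y hy => ?_
      rw [norm_smul]
      refine mul_le_mul_of_nonneg_left ?_ (norm_nonneg _)
      have h1 := hL _ (H.left y hy) x
      have h2 := hL _ (H.right y hy) x
      have := norm_sub_le (invF (rate (g y)) x) (invF (rate (h y)) x)
      linarith
    · exact Eventually.of_forall fun x y hy => (H.deriv y hy x).fun_const_smul (Φ x)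
  · have hev : ∀ᶠ s in 𝓝[>] (0 : ℝ), s ∈ Set.Ioo 0 T := Ioo_mem_nhdsGT hT
    have h1 : Tendsto (fun s => ∫ x, Φ x • (invF (g s) x - invF (h s) x)) (𝓝[>] 0)
        (𝓝 (∫ x, Φ x • (0 : C3))) := by
      refine tendsto_integral_filter_of_dominated_convergence
        (fun x => ‖Φ x‖ * (2 * (M * ∫ k, wt μ β k))) ?_ ?_ (hΦ.norm.mul_const _) ?_
      · filter_upwards [hev] with s hs using hm (hgi s hs) (hhi s hs)
      · filter_upwards [hev] with s hs
        refine Eventually.of_forall fun x => ?_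
        rw [norm_smul]
        exact mul_le_mul_of_nonneg_left (hwb s hs x) (norm_nonneg _)
      · exact Eventually.of_forall fun x => (H.initial x).const_smul (Φ x)
    simp only [smul_zero, integral_zero] at h1
    refine h1.congr' ?_
    filter_upwards [hev] with s hs using (hpair (hgi s hs) (hhi s hs)).symm

/-- The weak formulation tested with an average over a small set of wave numbers. -/
lemma norm_average_le (hμ : 3 < μ) (hβ : 0 < β) (H : TwoFlows μ β M T g h) (hM : 0 ≤ M)
    {Δ lam : ℝ} (hΔ0 : 0 ≤ Δ) (hlam : 0 < lam)
    (hΔ : ∀ s ∈ Set.Ioo 0 T, ∀ᵐ k, ‖g s k - h s k‖ ≤ Δ * Real.exp (lam * s) * wt μ β k)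
    {ψ : R3 → ℝ} (hψ : ContDiff ℝ ∞ ψ) (hψc : HasCompactSupport ψ) (hψ0 : ∀ k, 0 ≤ ψ k)
    (hψ1 : ∫ k, ψ k = 1) {κ S : ℝ} (hκ : 0 ≤ κ)
    (hS : ∀ k, ψ k ≠ 0 → (|κ - ‖k‖ ^ 2| + 2 * M * convConst μ * ‖k‖) * wt μ β k ≤ S)
    {t : ℝ} (ht : t ∈ Set.Ioo 0 T) :
    ‖∫ k, ψ k • (g t k - h t k)‖ ≤ Δ * S * Real.exp (lam * t) / (κ + lam) := by
  have hT : 0 < T := ht.1.trans ht.2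
  set φ : R3 → ℂ := fun k => (ψ k : ℂ) with hφ
  have hφd : ContDiff ℝ ∞ φ := Complex.ofRealCLM.contDiff.comp hψ
  have hφc : HasCompactSupport φ := hψc.comp_left (g := Complex.ofReal) Complex.ofReal_zero
  have hcoe : ∀ (k : R3) (w : C3), φ k • w = ψ k • w := fun k w => by
    rw [hφ]; exact Complex.coe_smul _ _
  obtain ⟨hder, hini⟩ := H.weak hμ hβ hT hφd hφc
  have hψi : Integrable ψ := hψ.continuous.integrable_of_hasCompactSupport hψc
  have hgi : ∀ s ∈ Set.Ioo 0 T, Integrable (fun k => g s k - h s k) := fun s hs =>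
    ((H.left s hs).tame hμ hβ).int.sub ((H.right s hs).tame hμ hβ).int
  set r : ℝ → C3 := fun s => ∫ k, φ k • (((κ - ‖k‖ ^ 2 : ℝ) : ℂ) • (g s k - h s k) -
    (bil (g s - h s) (g s) k + bil (h s) (g s - h s) k)) with hr
  have hode : ∀ s ∈ Set.Ioo 0 T, HasDerivAt (fun s => ∫ k, φ k • (g s k - h s k))
      (-κ • (∫ k, φ k • (g s k - h s k)) + r s) s := by
    intro s hs
    refine (hder s hs).congr_deriv ?_
    have hrate : Integrable fun k => rate (g s) k - rate (h s) k :=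
      ((H.left s hs).integrable_rate hμ hβ).sub ((H.right s hs).integrable_rate hμ hβ)
    have e : ∀ k, ((κ - ‖k‖ ^ 2 : ℝ) : ℂ) • (g s k - h s k) -
        (bil (g s - h s) (g s) k + bil (h s) (g s - h s) k) =
        (κ : ℂ) • (g s k - h s k) + (rate (g s) k - rate (h s) k) := by
      intro k
      rw [rate_sub hμ hβ (H.left s hs) (H.right s hs), add_sub_assoc', ← add_smul]
      congr 2
      push_cast
      ring
    have i1 : Integrable fun k => φ k • ((κ : ℂ) • (g s k - h s k)) :=
      integrable_smul hφd.continuous hφc ((hgi s hs).smul (κ : ℂ))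
    have i2 := integrable_smul hφd.continuous hφc hrate
    simp only [hr, e, smul_add]
    rw [integral_add i1 i2]
    have e2 : ∫ k, φ k • ((κ : ℂ) • (g s k - h s k)) = κ • ∫ k, φ k • (g s k - h s k) := by
      rw [← integral_smul]
      refine integral_congr_ae (Eventually.of_forall fun k => ?_)
      beta_reduce
      rw [smul_comm, Complex.coe_smul]
    rw [e2, neg_smul, neg_add_cancel_left]
  have hrb : ∀ s ∈ Set.Ioo 0 T, ‖r s‖ ≤ Δ * S * Real.exp (lam * s) := by
    intro s hs
    set D := Δ * Real.exp (lam * s) with hD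
    have hD0 : 0 ≤ D := by positivity
    have hgs := H.left s hs
    have hhs := H.right s hs
    have hb1 := norm_bil_le_of_ae hμ hβ.le (hgs.meas.sub hhs.meas) hgs.meas hD0 hM
      (hΔ s hs) (Eventually.of_forall hgs.bound)
    have hb2 := norm_bil_le_of_ae hμ hβ.le hhs.meas (hgs.meas.sub hhs.meas) hM hD0
      (Eventually.of_forall hhs.bound) (hΔ s hs)
    have hle : ‖r s‖ ≤ ∫ k, ψ k * (D * S) := by
      refine norm_integral_le_of_norm_le (hψi.mul_const _) ?_
      filter_upwards [hΔ s hs] with k hk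
      rw [norm_smul, hφ, Complex.norm_real, Real.norm_of_nonneg (hψ0 k)]
      by_cases hz : ψ k = 0
      · rw [hz, zero_mul, zero_mul]
      refine mul_le_mul_of_nonneg_left ?_ (hψ0 k)
      have hw := wt_pos μ β k
      have c1 : ‖((κ - ‖k‖ ^ 2 : ℝ) : ℂ) • (g s k - h s k)‖ ≤
          |κ - ‖k‖ ^ 2| * (D * wt μ β k) := by
        rw [norm_smul, Complex.norm_real, Real.norm_eq_abs]
        exact mul_le_mul_of_nonneg_left hk (abs_nonneg _)
      have c2 := hb1 k
      have c3 := hb2 k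
      have c4 := norm_sub_le (((κ - ‖k‖ ^ 2 : ℝ) : ℂ) • (g s k - h s k))
        (bil (g s - h s) (g s) k + bil (h s) (g s - h s) k)
      have c5 := norm_add_le (bil (g s - h s) (g s) k) (bil (h s) (g s - h s) k)
      calc _ ≤ D * ((|κ - ‖k‖ ^ 2| + 2 * M * convConst μ * ‖k‖) * wt μ β k) := by linarith
        _ ≤ D * S := mul_le_mul_of_nonneg_left (hS k hz) hD0
    rw [integral_mul_const, hψ1, one_mul, hD] at hle
    linarith
  have hfin := norm_le_of_linear_ode (by linarith) hode hini hrb ht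
  simpa only [hcoe] using hfin

/-- Averages over bumps at k₀ satisfy a linear equation with rate |k₀|², and the quadratic term
contributes 2M·`convConst`·|k₀|. Integration in time with the weight e^{λs} divides by |k₀|² + λ ≥
2|k₀|√λ, so the lost factor |k₀| is recovered together with 1/√λ. -/
lemma contraction (hμ : 3 < μ) (hβ : 0 < β) (H : TwoFlows μ β M T g h) (hM : 0 ≤ M)
    {Δ lam : ℝ} (hΔ0 : 0 ≤ Δ) (hlam : 0 < lam)
    (hΔ : ∀ s ∈ Set.Ioo 0 T, ∀ᵐ k, ‖g s k - h s k‖ ≤ Δ * Real.exp (lam * s) * wt μ β k)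
    {t : ℝ} (ht : t ∈ Set.Ioo 0 T) :
    ∀ᵐ k, ‖g t k - h t k‖ ≤ Δ * (M * convConst μ / √lam) * Real.exp (lam * t) * wt μ β k := by
  have hinteg : Integrable fun k => g t k - h t k :=
    ((H.left t ht).tame hμ hβ).int.sub ((H.right t ht).tame hμ hβ).int
  have hCC := convConst_nonneg μ
  set φ : ℕ → ContDiffBump (0 : R3) := fun n =>
    ⟨1 / (n + 1), 2 / (n + 1), by positivity, by gcongr; norm_num⟩ with hφ
  have hrOut : Tendsto (fun n => (φ n).rOut) atTop (𝓝 0) := by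
    have := (tendsto_one_div_add_atTop_nhds_zero_nat (𝕜 := ℝ)).const_mul 2
    simpa [hφ, div_eq_mul_inv] using this
  -- Lebesgue differentiation: at almost every k₀ the bump averages return the value of the
  -- difference.
  have hconv := ContDiffBump.ae_convolution_tendsto_right_of_locallyIntegrable (μ := volume)
    (φ := φ) (l := atTop) (K := 2) (g := fun k => g t k - h t k) hrOut
    (Eventually.of_forall fun n => by simp only [hφ]; exact le_of_eq (by ring))
    hinteg.locallyIntegrable
  filter_upwards [hconv] with k₀ hk₀
  simp only [convolution_eq_swap, ContinuousLinearMap.lsmul_apply] at hk₀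
  -- The heat rate is frozen at k₀. The error |κ - |k|²| on the support of the bump disappears as
  -- the bump shrinks.
  set κ := ‖k₀‖ ^ 2 with hκ
  have hκ0 : 0 ≤ κ := by positivity
  set w : R3 → ℝ := fun k => (|κ - ‖k‖ ^ 2| + 2 * M * convConst μ * ‖k‖) * wt μ β k with hw
  have hwc : Continuous w := by
    have := continuous_wt μ β
    fun_prop
  have hw0 : w k₀ = 2 * M * convConst μ * ‖k₀‖ * wt μ β k₀ := by
    simp [hw, hκ]
  have hη : ∀ η : ℝ, 0 < η → ‖g t k₀ - h t k₀‖ ≤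
      Δ * (w k₀ + η) * Real.exp (lam * t) / (κ + lam) := by
    intro η hη
    obtain ⟨ε, hε, hball⟩ := Metric.continuous_iff.1 hwc k₀ η hη
    refine le_of_tendsto hk₀.norm ?_
    filter_upwards [hrOut.eventually (gt_mem_nhds hε)] with n hn
    have hsmooth : ContDiff ℝ ∞ fun k => (φ n).normed volume (k₀ - k) :=
      ((φ n).contDiff_normed (n := ⊤)).comp (contDiff_const.sub contDiff_id)
    have hcs : HasCompactSupport fun k => (φ n).normed volume (k₀ - k) :=
      ((φ n).hasCompactSupport_normed (μ := volume)).comp_homeomorph (Homeomorph.subLeft k₀)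
    refine H.norm_average_le hμ hβ hM hΔ0 hlam hΔ hsmooth hcs (fun k => (φ n).nonneg_normed _)
      ?_ hκ0 (fun k hk => ?_) ht
    · rw [integral_sub_left_eq_self (fun k => (φ n).normed volume k) volume k₀]
      exact (φ n).integral_normed
    · have hmem : k₀ - k ∈ Function.support ((φ n).normed (volume : Measure R3)) := hk
      rw [(φ n).support_normed_eq, Metric.mem_ball, dist_zero_right] at hmem
      have h1 := hball k (by rw [dist_comm, dist_eq_norm]; linarith)
      rw [Real.dist_eq] at h1
      have h2 := (abs_lt.1 h1).2
      change w k ≤ w k₀ + η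
      linarith
  have hlimη : ‖g t k₀ - h t k₀‖ ≤ Δ * w k₀ * Real.exp (lam * t) / (κ + lam) := by
    have hl : Tendsto (fun η : ℝ => Δ * (w k₀ + η) * Real.exp (lam * t) / (κ + lam)) (𝓝[>] 0)
        (𝓝 (Δ * (w k₀ + 0) * Real.exp (lam * t) / (κ + lam))) :=
      ((by fun_prop : Continuous fun η : ℝ =>
        Δ * (w k₀ + η) * Real.exp (lam * t) / (κ + lam)).tendsto 0).mono_left nhdsWithin_le_nhds
    rw [add_zero] at hl
    exact ge_of_tendsto hl (by filter_upwards [self_mem_nhdsWithin] with η h using hη η h)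
  refine hlimη.trans ?_
  have hs : 0 < √lam := Real.sqrt_pos.2 hlam
  have hk : 2 * ‖k₀‖ / (κ + lam) ≤ 1 / √lam := by
    rw [div_le_div_iff₀ (by positivity) hs, one_mul]
    have h1 : √lam ^ 2 = lam := Real.sq_sqrt hlam.le
    rw [hκ]
    nlinarith [sq_nonneg (‖k₀‖ - √lam)]
  have hwp := wt_pos μ β k₀
  rw [hw0]
  calc _ = Δ * M * convConst μ * Real.exp (lam * t) * wt μ β k₀ * (2 * ‖k₀‖ / (κ + lam)) := by ring
    _ ≤ Δ * M * convConst μ * Real.exp (lam * t) * wt μ β k₀ * (1 / √lam) := by gcongr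
    _ = _ := by ring

/-- The parameter λ is taken so large that `contraction` halves the bound. Iterating from the
trivial bound 2M forces the difference to vanish, outside a countable union of null sets. -/
theorem ae_eq (hμ : 3 < μ) (hβ : 0 < β) (H : TwoFlows μ β M T g h) {t : ℝ}
    (ht : t ∈ Set.Ioo 0 T) : g t =ᵐ[volume] h t := by
  have hM : 0 ≤ M := (H.left t ht).nonneg
  have hCC := convConst_nonneg μ
  set lam := (2 * M * convConst μ + 1) ^ 2 with hlam
  have hlam0 : 0 < lam := by positivity
  have hratio : M * convConst μ / √lam ≤ 1 / 2 := by
    rw [hlam, Real.sqrt_sq (by positivity), div_le_div_iff₀ (by positivity) (by norm_num)]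
    linarith
  have hn : ∀ n : ℕ, ∀ s ∈ Set.Ioo 0 T, ∀ᵐ k,
      ‖g s k - h s k‖ ≤ (2 * M * (1 / 2) ^ n) * Real.exp (lam * s) * wt μ β k := by
    intro n
    induction n with
    | zero =>
      intro s hs
      refine Eventually.of_forall fun k => ?_
      have h1 := (H.left s hs).bound k
      have h2 := (H.right s hs).bound k
      have h3 := norm_sub_le (g s k) (h s k)
      have h4 : 1 ≤ Real.exp (lam * s) := Real.one_le_exp (mul_nonneg hlam0.le hs.1.le)
      have h5 := le_mul_of_one_le_left (mul_nonneg (mul_nonneg zero_le_two hM) (wt_pos μ β k).le) h4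
      rw [pow_zero]
      linarith
    | succ n ih =>
      intro s hs
      filter_upwards [H.contraction hμ hβ hM (by positivity) hlam0 ih hs] with k hk
      refine hk.trans ?_
      have := wt_pos μ β k
      rw [pow_succ, ← mul_assoc (2 * M)]
      gcongr
  have hall : ∀ᵐ k, ∀ n : ℕ,
      ‖g t k - h t k‖ ≤ (2 * M * (1 / 2) ^ n) * Real.exp (lam * t) * wt μ β k :=
    ae_all_iff.2 fun n => hn n t ht
  filter_upwards [hall] with k hk
  have hlim : Tendsto (fun n : ℕ => (2 * M * (1 / 2 : ℝ) ^ n) * Real.exp (lam * t) * wt μ β k) atTop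
      (𝓝 ((2 * M * 0) * Real.exp (lam * t) * wt μ β k)) :=
    (((tendsto_pow_atTop_nhds_zero_of_lt_one (by norm_num) (by norm_num)).const_mul _).mul_const
      _).mul_const _
  rw [mul_zero, zero_mul, zero_mul] at hlim
  have := ge_of_tendsto' hlim hk
  exact sub_eq_zero.1 (norm_le_zero_iff.1 this)

end TwoFlows

/-- A solution of the Navier-Stokes problem in Fourier space. -/
lemma IsNSSolution.exists_datum {μ β : ℝ} (hμ : 3 < μ) (hβ : 0 < β) {v₀ f : R3 → C3} {D : Set ℂ}
    {v : ℂ → R3 → C3} (hv : IsNSSolution μ β v₀ f D v) :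
    ∃ M : ℝ, ∃ g : ℂ → R3 → C3, ∀ t ∈ D, Datum μ β M (g t) ∧ v t = invF (g t) ∧
      ∀ x, HasDerivWithinAt (fun s => v s x) (invF (rate (g t)) x + f x) D t := by
  obtain ⟨M, hM, hb⟩ := hv.bounded
  have key : ∀ t ∈ D, ∃ g, Datum μ β M.toReal g ∧ v t = invF g ∧
      ∀ x, HasDerivWithinAt (fun s => v s x) (invF (rate g) x + f x) D t := by
    intro t ht
    obtain ⟨vhat, hpair, hle⟩ := hb t ht
    obtain ⟨g, hg, hvg, hdiv, -⟩ := NSBorel.exists_datum hμ hβ M.toReal_nonneg hpair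
      (fun k => (norm_le_of_wnorm (hle.trans_lt hM) k).trans
        (mul_le_mul_of_nonneg_right (ENNReal.toReal_mono hM.ne hle) (wt_pos _ _ _).le))
      (hv.divFree t ht)
    refine ⟨g, hg, hvg, fun x => ?_⟩
    obtain ⟨N, ⟨ghat, hgh, hN⟩, heq⟩ := hv.equation t ht
    have hconv := (isHodgeProjection_convect hμ hβ hg hdiv).1
    rw [hvg] at hgh
    -- The Hodge projection in a given solution comes with some unspecified transform of the
    -- convective term. Injectivity of the transform identifies it almost everywhere, and hence
    -- identifies N.
    have hae := ae_eq_of_invF_eq (isFourierPair_iff.1 hgh).1 (isFourierPair_iff.1 hconv).1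
      fun x => by rw [← (isFourierPair_iff.1 hgh).2, ← (isFourierPair_iff.1 hconv).2]
    have hNb : N = invF (bil g g) := by
      rw [(isFourierPair_iff.1 hN).2]
      refine invF_congr_ae (hae.mono fun k hk => ?_)
      beta_reduce
      rw [hk, bil_eq]
    refine (heq x).congr_deriv ?_
    rw [hvg, hNb, laplacian_invF_datum hμ hβ hg,
      ← invF_sub (hg.integrable_lap hμ hβ) (hg.integrable_bil hμ hβ)]
    rfl
  choose! g hg using key
  exact ⟨M.toReal, g, hg⟩

lemma Datum.mono {μ β M M' : ℝ} {g : R3 → C3} (hg : Datum μ β M g) (h : M ≤ M') :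
    Datum μ β M' g :=
  ⟨hg.meas, fun k => (hg.bound k).trans (mul_le_mul_of_nonneg_right h (wt_pos _ _ _).le)⟩

/-- Two solutions coincide on a common interval of real times. -/
theorem IsNSSolution.eq_of_real {μ β T : ℝ} (hμ : 3 < μ) (hβ : 0 < β) {v₀ f : R3 → C3}
    {D D' : Set ℂ} {u v : ℂ → R3 → C3} (hu : IsNSSolution μ β v₀ f D u)
    (hv : IsNSSolution μ β v₀ f D' v) (hD : Complex.ofReal '' Set.Ioo 0 T ⊆ D)
    (hD' : Complex.ofReal '' Set.Ioo 0 T ⊆ D') {t : ℝ} (ht : t ∈ Set.Ioo 0 T) :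
    u t = v t := by
  obtain ⟨M, g, hg⟩ := hu.exists_datum hμ hβ
  obtain ⟨M', h, hh⟩ := hv.exists_datum hμ hβ
  have mem : ∀ {E : Set ℂ}, Complex.ofReal '' Set.Ioo 0 T ⊆ E → ∀ s ∈ Set.Ioo 0 T, (s : ℂ) ∈ E :=
    fun hE s hs => hE ⟨s, hs, rfl⟩
  have hder : ∀ {E : Set ℂ} {w : ℂ → R3 → C3} {x : R3} {w' : C3} {s : ℝ},
      Complex.ofReal '' Set.Ioo 0 T ⊆ E → s ∈ Set.Ioo 0 T →
      HasDerivWithinAt (fun s => w s x) w' E s → HasDerivAt (fun s : ℝ => w s x) w' s := by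
    intro E w x w' s hE hs hw
    have h1 : HasDerivWithinAt (fun s : ℝ => (s : ℂ)) 1 (Set.Ioo 0 T) s :=
      Complex.ofRealCLM.hasDerivAt.hasDerivWithinAt
    have h2 := hw.scomp s h1 fun y hy => mem hE y hy
    rw [one_smul] at h2
    exact h2.hasDerivAt (isOpen_Ioo.mem_nhds hs)
  have hlim : ∀ {E : Set ℂ} {w : ℂ → R3 → C3} (x : R3), Complex.ofReal '' Set.Ioo 0 T ⊆ E →
      Tendsto (fun t => w t x) (𝓝[E] 0) (𝓝 (v₀ x)) →
      Tendsto (fun s : ℝ => w s x) (𝓝[>] 0) (𝓝 (v₀ x)) := by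
    intro E w x hE hw
    refine hw.comp (tendsto_nhdsWithin_iff.2 ⟨?_, ?_⟩)
    · exact (Complex.continuous_ofReal.tendsto' 0 0 Complex.ofReal_zero).mono_left
        nhdsWithin_le_nhds
    · filter_upwards [Ioo_mem_nhdsGT (ht.1.trans ht.2)] with s hs using mem hE s hs
  have hdiff : ∀ x, ∀ s ∈ Set.Ioo 0 T, u s x - v s x = invF (g s) x - invF (h s) x :=
    fun x s hs => by rw [(hg _ (mem hD s hs)).2.1, (hh _ (mem hD' s hs)).2.1]
  have H : TwoFlows μ β (max M M') T (fun s : ℝ => g s) fun s : ℝ => h s := by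
    refine ⟨fun s hs => (hg _ (mem hD s hs)).1.mono (le_max_left _ _),
      fun s hs => (hh _ (mem hD' s hs)).1.mono (le_max_right _ _), fun s hs x => ?_, fun x => ?_⟩
    · have h1 := (hder hD hs ((hg _ (mem hD s hs)).2.2 x)).sub
        (hder hD' hs ((hh _ (mem hD' s hs)).2.2 x))
      rw [add_sub_add_right_eq_sub] at h1
      refine h1.congr_of_eventuallyEq ?_
      filter_upwards [isOpen_Ioo.mem_nhds hs] with y hy using (hdiff x y hy).symm
    · have h1 := (hlim x hD (hu.initial x)).sub (hlim x hD' (hv.initial x))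
      rw [sub_self] at h1
      refine h1.congr' ?_
      filter_upwards [Ioo_mem_nhdsGT (ht.1.trans ht.2)] with s hs using hdiff x s hs
  rw [(hg _ (mem hD t ht)).2.1, (hh _ (mem hD' t ht)).2.1]
  exact invF_congr_ae (H.ae_eq hμ hβ ht)

/-! ### Norms of the data, the uniform remainder, and the assembly of the theorem -/

lemma ofReal_mem_timeDomain {α t : ℝ} (hα : 0 < α) (h0 : 0 < t) (h1 : t < 1 / α) :
    (t : ℂ) ∈ timeDomain α := by
  rw [mem_timeDomain_iff hα, Complex.norm_real, Real.norm_of_nonneg h0.le, Complex.ofReal_re]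
  rw [lt_div_iff₀ hα] at h1
  nlinarith

lemma pow_mul_wt_add_two_le (μ β : ℝ) (k : R3) {n : ℕ} (hn : n ≤ 2) :
    ‖k‖ ^ n * wt (μ + 2) β k ≤ wt μ β k := by
  have h0 : (0 : ℝ) < 1 + ‖k‖ := by positivity
  have h1 : wt μ β k = (1 + ‖k‖) ^ 2 * wt (μ + 2) β k := by
    unfold wt
    rw [← mul_assoc, ← Real.rpow_natCast, ← Real.rpow_add h0]
    congr 2
    push_cast
    ring
  rw [h1]
  refine mul_le_mul_of_nonneg_right ?_ (wt_pos _ _ _).le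
  exact (pow_le_pow_left₀ (norm_nonneg k) (by linarith) n).trans
    (pow_le_pow_right₀ (by linarith [norm_nonneg k]) hn)

lemma wnorm_lt_top_of_add_two {μ β : ℝ} {g : R3 → C3} (hg : wnorm (μ + 2) β g < ⊤) :
    wnorm μ β g < ⊤ := by
  refine (wnorm_le_of_norm_le (M := (wnorm (μ + 2) β g).toReal) fun k => ?_).trans_lt
    ENNReal.ofReal_lt_top
  refine (norm_le_of_wnorm hg k).trans (mul_le_mul_of_nonneg_left ?_ ENNReal.toReal_nonneg)
  simpa using pow_mul_wt_add_two_le μ β k (n := 0) (by norm_num)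

lemma v1hat_eq (g fh : R3 → C3) (k : R3) : v1hat g fh k = rate g k + fh k := rfl

lemma rate_congr_ae {g h : R3 → C3} (hgh : g =ᵐ[volume] h) : rate g =ᵐ[volume] rate h := by
  filter_upwards [hgh] with k hk
  rw [rate, rate, hk, bil_congr_ae hgh hgh]

/-- The two extra powers of decay of the initial datum absorb |k|² in the linear term and |k| in the
quadratic one, at the full exponential rate β. -/
lemma wnorm_v1hat_lt_top {μ β : ℝ} (hμ : 3 < μ) (hβ : 0 < β) {v₀ v0hat fhat : R3 → C3}
    (hv₀ : IsFourierPair v₀ v0hat) (hdiv : IsDivFree v₀) (hv : wnorm (μ + 2) β v0hat < ⊤)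
    (hf : wnorm μ β fhat < ⊤) : wnorm μ β (v1hat v0hat fhat) < ⊤ := by
  set M := (wnorm (μ + 2) β v0hat).toReal with hM
  have hM0 : 0 ≤ M := ENNReal.toReal_nonneg
  have hμ2 : 3 < μ + 2 := by linarith
  obtain ⟨g, hg, -, -, hae⟩ := exists_datum hμ2 hβ hM0 hv₀ (norm_le_of_wnorm hv) hdiv
  refine (wnorm_le_of_norm_le (M := M + M * M * convConst (μ + 2) + (wnorm μ β fhat).toReal)
    fun k => ?_).trans_lt ENNReal.ofReal_lt_top
  have h1 := norm_bil_le hμ2 hβ.le hg.meas hg.meas hM0 hM0 hg.bound hg.bound k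
  rw [bil_congr_ae hae hae] at h1
  have h2 := norm_le_of_wnorm hv k
  have h3 := norm_le_of_wnorm hf k
  have h4 := mul_le_mul_of_nonneg_left (pow_mul_wt_add_two_le μ β k le_rfl) hM0
  have h5 := mul_le_mul_of_nonneg_left (pow_mul_wt_add_two_le μ β k (n := 1) (by norm_num))
    (mul_nonneg (mul_nonneg hM0 hM0) (convConst_nonneg (μ + 2)))
  have h6 : ‖(-((‖k‖ ^ 2 : ℝ) : ℂ)) • v0hat k‖ ≤ ‖k‖ ^ 2 * (M * wt (μ + 2) β k) := by
    rw [norm_smul, norm_neg, Complex.norm_real, Real.norm_of_nonneg (by positivity)]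
    exact mul_le_mul_of_nonneg_left h2 (by positivity)
  rw [v1hat_eq]
  have h7 := norm_add_le (rate v0hat k) (fhat k)
  have h8 : ‖rate v0hat k‖ ≤ _ := norm_sub_le _ _
  linarith

lemma norm_invF_le_of_lintegral {g : R3 → C3} {C : ℝ} (hC : 0 ≤ C)
    (h : ∫⁻ k, ‖g k‖ₑ ≤ ENNReal.ofReal C) (x : R3) : ‖invF g x‖ ≤ C := by
  refine (norm_invF_le g x).trans ?_
  by_cases hg : AEStronglyMeasurable (fun k : R3 => ‖g k‖) volume
  · rw [integral_eq_lintegral_of_nonneg_ae (Eventually.of_forall fun k => norm_nonneg _) hg]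
    simp only [ofReal_norm]
    exact ENNReal.toReal_le_of_le_ofReal hC h
  · rw [integral_non_aestronglyMeasurable hg]
    exact hC

/-- The uniform remainder estimate for the expansion in powers of `t`. -/
lemma FourierFlow.exists_norm_sub_le {μ β α R n₀ nf : ℝ} (hμ : 3 < μ) (hβ : 0 < β) (hα : 0 < α)
    {a fh : R3 → C3} {V : ℂ → R3 → C3} (hV : FourierFlow μ β α R a fh V) (ha : Datum μ β n₀ a)
    (hf : Datum μ β nf fh) (hR : n₀ ≤ R) (N : ℕ) :
    ∃ K : ℝ, ∀ t ∈ timeDomain α, ∀ x, ‖invF (V t) x - invF a x -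
      ∑ m ∈ Finset.Icc 1 N, t ^ m • invF (taylor a fh m) x‖ ≤ K * ‖t‖ ^ (N + 1) := by
  obtain ⟨K, B, hK, hB, hle⟩ := exists_lintegral_maj_le (β' := β / 2) hμ (half_pos hβ)
    (half_lt_self hβ) (ha.nonneg.trans hR) hf.nonneg
  refine ⟨K * B ^ (N + 1) * (N + 1).factorial, fun t ht x => ?_⟩
  have hti : ∀ m, Integrable (fun k => t ^ m • taylor a fh m k) := fun m =>
    ((rapid_taylor hμ hβ ha.rapid hf.rapid m).tame hμ hβ).int.smul (t ^ m)
  have e : invF (V t) x - invF a x - ∑ m ∈ Finset.Icc 1 N, t ^ m • invF (taylor a fh m) x =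
      invF (flowRem a fh V (N + 1) t) x := by
    unfold flowRem
    rw [invF_sub ((hV.toTimeField.datum t).tame hμ hβ).int
      (integrable_finsetSum _ fun m _ => hti m), invF_sum _ fun m _ => hti m,
      Finset.sum_range_eq_add_Ico _ (Nat.succ_pos N), sub_add_eq_sub_sub]
    simp only [invF_smul, pow_zero, one_smul, taylor_zero]
    rfl
  rw [e]
  refine norm_invF_le_of_lintegral (by positivity) ?_ x
  calc ∫⁻ k, ‖flowRem a fh V (N + 1) t k‖ₑ
      ≤ ∫⁻ k, (ENNReal.ofReal (Real.exp (β / 2 * ‖k‖)) * maj μ β R nf (N + 1) k) *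
          ‖t‖ₑ ^ (N + 1) := by
        refine lintegral_mono fun k => (enorm_flowRem_le_maj hμ hβ hα hV ha hf hR _ ht k).trans ?_
        gcongr
        refine le_mul_of_one_le_left' ?_
        rw [ENNReal.one_le_ofReal]
        exact Real.one_le_exp (by positivity)
    _ ≤ ENNReal.ofReal (K * B ^ (N + 1) * (N + 1).factorial) * ‖t‖ₑ ^ (N + 1) := by
        rw [lintegral_mul_const' _ _ (by finiteness)]
        gcongr
        exact hle (N + 1)
    _ = _ := by
        rw [ENNReal.ofReal_mul (q := ‖t‖ ^ (N + 1)) (by positivity),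
          ENNReal.ofReal_pow (norm_nonneg t), ofReal_norm]

end NSBorel
end

theorem mainTheorem2 (μ β : ℝ) (hμ : 3 < μ) (hβ : 0 < β)
    (v₀ f v0hat fhat : NSBorel.R3 → NSBorel.C3)
    (hv₀ : NSBorel.IsFourierPair v₀ v0hat) (hf : NSBorel.IsFourierPair f fhat)
    (hv₀_norm : NSBorel.wnorm (μ + 2) β v0hat < ⊤) (hf_norm : NSBorel.wnorm μ β fhat < ⊤)
    (hv₀_div : NSBorel.IsDivFree v₀) (hf_div : NSBorel.IsDivFree f) :
    ∃ α : ℝ, 0 < α ∧ ∃ v : ℂ → NSBorel.R3 → NSBorel.C3,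
      -- `v` is the solution of the Navier-Stokes problem for `Re (1/t) > α`
      NSBorel.IsNSSolution μ β v₀ f (NSBorel.timeDomain α) v ∧
      (∀ (T : ℝ) (u : ℂ → NSBorel.R3 → NSBorel.C3),
        NSBorel.IsNSSolution μ β v₀ f (Complex.ofReal '' Set.Ioo 0 T) u →
        ∀ t : ℝ, 0 < t → t < T → t < 1 / α → ∀ x, u t x = v t x) ∧
      -- Borel summability
      (∃ U : NSBorel.C3 → ℂ → NSBorel.C3,
        (∀ β' : ℝ, 0 < β' → β' < β → ∃ δ : ℝ, 0 < δ ∧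
          DifferentiableOn ℂ (fun z : NSBorel.C3 × ℂ => U z.1 z.2)
            ({x | ‖NSBorel.imC3 x‖ < β'} ×ˢ NSBorel.halfLineNhd δ) ∧
          ∃ C : ℝ, ∀ x : NSBorel.C3, ‖NSBorel.imC3 x‖ < β' →
            ∀ p ∈ NSBorel.halfLineNhd δ, ‖U x p‖ ≤ C * Real.exp (α * ‖p‖)) ∧
        ∀ t ∈ NSBorel.timeDomain α, ∀ x : NSBorel.R3,
          v t x = v₀ x + ∫ p in Set.Ioi (0 : ℝ),
            Complex.exp (-(p : ℂ) / t) • U (NSBorel.toC3 x) (p : ℂ)) ∧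
      -- the asymptotic expansion and the Gevrey-1 bounds
      ∃ c : ℕ → NSBorel.R3 → NSBorel.C3,
        (∀ N : ℕ, ∃ K : ℝ, ∀ t ∈ NSBorel.timeDomain α, ∀ x,
          ‖v t x - v₀ x - ∑ m ∈ Finset.Icc 1 N, t ^ m • c m x‖ ≤ K * ‖t‖ ^ (N + 1)) ∧
        (∃ A₀ B₀ : ℝ, NSBorel.GevreyConstants μ β (NSBorel.wnorm μ β v0hat).toReal
          (NSBorel.wnorm μ β (NSBorel.v1hat v0hat fhat)).toReal A₀ B₀) ∧
        ∀ A₀ B₀ : ℝ, NSBorel.GevreyConstants μ β (NSBorel.wnorm μ β v0hat).toReal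
          (NSBorel.wnorm μ β (NSBorel.v1hat v0hat fhat)).toReal A₀ B₀ →
          ∀ m : ℕ, 1 ≤ m → ∀ x, ‖c m x‖ ≤ (m.factorial : ℝ) * A₀ * B₀ ^ m := by
  have hv₀μ := NSBorel.wnorm_lt_top_of_add_two hv₀_norm
  have hn₁ := NSBorel.wnorm_v1hat_lt_top hμ hβ hv₀ hv₀_div hv₀_norm hf_norm
  obtain ⟨a, ha, rfl, hak, hae⟩ := NSBorel.exists_datum hμ hβ ENNReal.toReal_nonneg hv₀
    (NSBorel.norm_le_of_wnorm hv₀μ) hv₀_div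
  obtain ⟨fh, hfh, rfl, hfk, hfe⟩ := NSBorel.exists_datum hμ hβ ENNReal.toReal_nonneg hf
    (NSBorel.norm_le_of_wnorm hf_norm) hf_div
  obtain ⟨α, hα, V, hV⟩ := NSBorel.exists_fourierFlow hμ hβ ha hfh
  -- The circle of the inverse Laplace integral must lie, apart from 0, in the domain where the flow
  -- exists. The constant in the theorem is therefore c = 2α, with α that of the flow.
  have hc : α < 2 * α := by linarith
  have hsub := NSBorel.timeDomain_anti hc.le
  have hsol := hV.isNSSolution hμ hβ hα hc.le hfh hak hfk
  have hR : (NSBorel.wnorm μ β v0hat).toReal ≤ (NSBorel.wnorm μ β v0hat).toReal + 1 := by linarith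
  refine ⟨2 * α, by linarith, fun t => NSBorel.invF (V t), hsol, fun T u hu t h0 hT ht x => ?_,
    ⟨NSBorel.borelU (2 * α) a fh V, fun β' hβ' hββ' =>
      NSBorel.differentiableOn_borelU hμ hα hc hV ha hfh hR hβ' hββ', fun t ht x =>
      NSBorel.laplace_borelU hμ hβ hα hc hV ha hfh hR ht x⟩,
    fun m => NSBorel.invF (NSBorel.taylor a fh m), fun N => ?_,
    NSBorel.exists_gevreyConstants hμ hβ ENNReal.toReal_nonneg ENNReal.toReal_nonneg,
    fun A₀ B₀ hAB m hm x => ?_⟩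
  · refine congrFun (hu.eq_of_real (T := min T (1 / (2 * α))) hμ hβ hsol
      (Set.image_mono (Set.Ioo_subset_Ioo_right (min_le_left _ _))) ?_ ⟨h0, lt_min hT ht⟩) x
    rintro _ ⟨s, hs, rfl⟩
    exact NSBorel.ofReal_mem_timeDomain (by linarith) hs.1 (hs.2.trans_le (min_le_right _ _))
  · obtain ⟨K, hK⟩ := hV.exists_norm_sub_le hμ hβ hα ha hfh hR N
    exact ⟨K, fun t ht x => hK t (hsub ht) x⟩
  · have hA := hAB.A_pos
    have hB := hAB.B_pos
    refine NSBorel.norm_invF_le_of_lintegral (by positivity)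
      (hAB.lintegral_taylor_le hμ hβ ha hfh.rapid ENNReal.toReal_nonneg ?_ hm) x
    -- The norm n₁ refers to the given transforms, which agree with the chosen representatives only
    -- almost everywhere; the moment estimate needs no more.
    filter_upwards [NSBorel.rate_congr_ae hae, hfe] with k h1 h2
    rw [NSBorel.taylor_one, NSBorel.v1hat_eq, h1, h2, ← NSBorel.v1hat_eq]
    exact NSBorel.norm_le_of_wnorm hn₁ k
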